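/- **Model.** Let $d,k\ge 1$, $N\ge 0$. Vectors are row vectors. The parameters are $\Psi=[\mathbf W,\boldsymbol\mu,\sigma^2,\boldsymbol\delta_\epsilon,\boldsymbol\delta_x]$ with $\mathbf W\in\mathbb R^{d\times k}$, $\boldsymbol\mu,\boldsymbol\delta_\epsilon\in\mathbb R^d$, $\boldsymbol\delta_x\in\mathbb R^k$, $\sigma^2>0$; the degrees of freedom $\nu_\epsilon^1,\dots,\nu_\epsilon^d,\nu_x^1,\dots,\nu_x^k>0$ are known. For $t=1,\dots,N$ let $S_{\epsilon,t},S_{x,t}\sim\mathcal U(0,1)$ and the standard normal vectors $\mathbf Z_{\epsilon,t}\in\mathbb R^d$, $\mathbf Z_{x,t}\in\mathbb R^k$ be all independent (also over $t$). With $\chi^{-1}_\nu$ the chi-square quantile function with $\nu$ degrees of freedom put $$T_\epsilon(s)=\Big(\tfrac{\chi^{-1}_{\nu_\epsilon^i}(s)}{\nu_\epsilon^i}\Big)_{i\le d},\quad T_x(s)=\Big(\tfrac{\chi^{-1}_{\nu_x^j}(s)}{\nu_x^j}\Big)_{j\le k},\quad \mathbf U_t=T_\epsilon(S_{\epsilon,t}),\quad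 \mathbf V_t=T_x(S_{x,t}),$$ $$\mathbf X_t=\mathbf V_t^{-1}\circ\boldsymbol\delta_x+\sqrt{\mathbf V_t^{-1}}\circ\mathbf Z_{x,t},\quad \boldsymbol\epsilon_t=\mathbf U_t^{-1}\circ\boldsymbol\delta_\epsilon+\sqrt{\sigma^2\mathbf U_t^{-1}}\circ\mathbf Z_{\epsilon,t},\quad \mathbf Y_t=\boldsymbol\mu+\mathbf X_t\mathbf W^T+\boldsymbol\epsilon_t .$$ At each $t$ the entries of $\mathbf Y_t$ with index in a given set $O_t\subseteq\{1,\dots,d\}$ are observed (superscript $o$), the others are missing (superscript $m$); the data are missing at random, so that the missingness mechanism is ignored. Write $\mathbf D_\epsilon=\operatorname{diag}(\mathbf u)$, $\mathbf D_x=\operatorname{diag}(\mathbf v)$. **Densities and $Q$.** The complete-data density at one time is $$\pi(\mathbf y,\mathbf x,\mathbf u,\mathbf v|\Psi)=\mathcal N(\mathbf y;\boldsymbol\mu+\boldsymbol\delta_\epsilon\mathbf D_\epsilon^{-1}+\mathbf x\mathbf W^T,\sigma^2\mathbf D_\epsilon^{-1})\;\mathcal N(\mathbf x;\boldsymbol\delta_x\mathbf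 D_x^{-1},\mathbf D_x^{-1})\;\pi_{\mathbf U}(\mathbf u)\,\pi_{\mathbf V}(\mathbf v),$$ where $\pi_{\mathbf U}(T_\epsilon(s))=|T_\epsilon'(s)|^{-1}$, $\pi_{\mathbf V}(T_x(s))=|T_x'(s)|^{-1}$ for $0<s<1$ (Euclidean norm; densities with respect to arc length on the curves that carry $\mathbf U_t$ and $\mathbf V_t$; zero off the curves), and the complete-data density of all $N$ times is the product. Let $\pi_{\mathbf Y^o_{1:N}|\Psi}$ be the resulting marginal density of the observed data and $$Q(\Psi,\Psi^*)=\mathbb E_{\mathbf Y^m_{1:N},\mathbf X_{1:N},\mathbf U_{1:N},\mathbf V_{1:N}|\mathbf Y^o_{1:N}=\mathbf y^o_{1:N},\Psi}\big[\log\pi(\mathbf Y_{1:N},\mathbf X_{1:N},\mathbf U_{1:N},\mathbf V_{1:N}|\Psi^*)\big],$$ the expectation being with respect to the conditional law that these densities define. **Closed form.** Let $\mathbf M=\sigma^2\mathbf D_x+\mathbf W^T\mathbf D_\epsilon\mathbf W$, $\mathbf N=\mathbb I_d-\mathbf W\mathbf M^{-1}\mathbf W^T\mathbf D_\epsilon$,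 $\boldsymbol\mu_y=\boldsymbol\mu+\boldsymbol\delta_\epsilon\mathbf D_\epsilon^{-1}+\sigma^2\boldsymbol\delta_x\mathbf M^{-1}\mathbf W^T\mathbf D_\epsilon(\mathbf D_\epsilon\mathbf N)^{-1}$, $\boldsymbol\Sigma_y=\sigma^2(\mathbf D_\epsilon\mathbf N)^{-1}$, with blocks $\boldsymbol\mu_y^o,\boldsymbol\mu_y^m,\boldsymbol\Sigma_y^{oo},\dots$; $\tilde{\boldsymbol\mu}=\boldsymbol\mu_y^m+(\mathbf y^o-\boldsymbol\mu_y^o)(\boldsymbol\Sigma_y^{oo})^{-1}\boldsymbol\Sigma_y^{om}$, $\tilde{\boldsymbol\Sigma}=\boldsymbol\Sigma_y^{mm}-\boldsymbol\Sigma_y^{mo}(\boldsymbol\Sigma_y^{oo})^{-1}\boldsymbol\Sigma_y^{om}$, $\mathbf e=[\mathbf y^o,\tilde{\boldsymbol\mu}]$, and $\mathbf E=\mathbf e^T\mathbf e$ with $\tilde{\boldsymbol\Sigma}$ added to its missing-missing block. Put $\mathbf b=-\boldsymbol\mu\mathbf D_\epsilon\mathbf W-\boldsymbol\delta_\epsilon\mathbf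 W+\sigma^2\boldsymbol\delta_x$, $\mathbf b^*=-\frac1{\sigma^{*2}}\mathbf W^{*T}\mathbf D_\epsilon\boldsymbol\mu^{*T}-\frac1{\sigma^{*2}}\mathbf W^{*T}\boldsymbol\delta_\epsilon^{*T}+\boldsymbol\delta_x^{*T}$, $\mathbf G^*=\frac1{\sigma^{*2}}\mathbf W^{*T}\mathbf D_\epsilon\mathbf W^*+\mathbf D_x$, and $$\begin{aligned}v(\mathbf y^o,\mathbf u,\mathbf v)=\;&\log\pi_{\mathbf U}(\mathbf u)+\log\pi_{\mathbf V}(\mathbf v)-\tfrac{k+d}2\log2\pi-\tfrac d2\log\sigma^{*2}+\tfrac12\sum_i\log u^i+\tfrac12\sum_j\log v^j-\tfrac12\boldsymbol\delta_x^*\mathbf D_x^{-1}\boldsymbol\delta_x^{*T}\\&-\tfrac1{2\sigma^{*2}}\operatorname{tr}\{\mathbf E\mathbf D_\epsilon\}+\tfrac1{\sigma^{*2}}\mathbf e(\mathbf D_\epsilon\boldsymbol\mu^{*T}+\boldsymbol\delta_\epsilon^{*T})-\tfrac1{2\sigma^{*2}}\boldsymbol\mu^*\mathbf D_\epsilon\boldsymbol\mu^{*T}-\tfrac1{\sigma^{*2}}\boldsymbol\mu^*\boldsymbol\delta_\epsilon^{*T}-\tfrac1{2\sigma^{*2}}\boldsymbol\delta_\epsilon^*\mathbf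 D_\epsilon^{-1}\boldsymbol\delta_\epsilon^{*T}\\&+\tfrac1{\sigma^{*2}}\operatorname{tr}\{\mathbf E\mathbf D_\epsilon\mathbf W\mathbf M^{-1}\mathbf W^{*T}\mathbf D_\epsilon\}+\mathbf e\mathbf D_\epsilon\mathbf W\mathbf M^{-1}\mathbf b^*+\tfrac1{\sigma^{*2}}\mathbf b\mathbf M^{-1}\mathbf W^{*T}\mathbf D_\epsilon\mathbf e^T+\mathbf b\mathbf M^{-1}\mathbf b^*\\&-\tfrac12\operatorname{tr}\{\mathbf M^{-1}\mathbf W^T\mathbf D_\epsilon\mathbf E\mathbf D_\epsilon\mathbf W\mathbf M^{-1}\mathbf G^*\}-\operatorname{tr}\{\mathbf M^{-1}\mathbf W^T\mathbf D_\epsilon\mathbf e^T\mathbf b\mathbf M^{-1}\mathbf G^*\}-\tfrac12\operatorname{tr}\{\mathbf M^{-1}\mathbf b^T\mathbf b\mathbf M^{-1}\mathbf G^*\}-\tfrac{\sigma^2}2\operatorname{tr}\{\mathbf M^{-1}\mathbf G^*\}.\end{aligned}$$ With $\mathbf u=T_\epsilon(s_\epsilon)$, $\mathbf v=T_x(s_x)$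 let $\tilde v(\mathbf y^o,s_\epsilon,s_x)=v(\mathbf y^o,\mathbf u,\mathbf v)$ and $$m(\mathbf y^o,s_\epsilon,s_x)=e^{-\frac12\boldsymbol\delta_x(\mathbf D_x^{-1}-\sigma^2\mathbf M^{-1}\mathbf W^T\mathbf D_\epsilon(\mathbf D_\epsilon\mathbf N)^{-1}\mathbf D_\epsilon\mathbf W\mathbf M^{-1}-\sigma^2\mathbf M^{-1})\boldsymbol\delta_x^T}\,\mathcal N(\mathbf y^o;\boldsymbol\mu_y^o,\boldsymbol\Sigma_y^{oo})\,(\sigma^2)^{k/2}|\mathbf D_x|^{1/2}|\mathbf M|^{-1/2}|\mathbf N|^{-1/2},$$ $$I_1(\mathbf y^o)=\int_0^1\!\!\int_0^1\tilde v\,m\,ds_\epsilon\,ds_x,\qquad I_2(\mathbf y^o)=\int_0^1\!\!\int_0^1 m\,ds_\epsilon\,ds_x .$$ **Theorem.** The law of $\mathbf Y^o_{1:N}$ has Lebesgue density $\pi_{\mathbf Y^o_{1:N}|\Psi}$, the conditional law used in $Q$ is a version of the regular conditional distribution of $(\mathbf Y^m,\mathbf X,\mathbf U,\mathbf V)_{1:N}$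 given $\mathbf Y^o_{1:N}$, and for every realisation $\mathbf y^o_{1:N}$ one has $\pi_{\mathbf Y^o_{1:N}|\Psi}(\mathbf y^o_{1:N})>0$, this conditional law is a probability measure, and $m(\mathbf y_t^o,\cdot,\cdot)$ is integrable on $[0,1]^2$ for each $t$. For every $\Psi^*$ with $\sigma^{*2}>0$ such that the expectation $Q(\Psi,\Psi^*)$ exists (the log-density in it is integrable), all $\tilde v\,m$ are integrable on $[0,1]^2$ and $$Q(\Psi,\Psi^*)=\frac1{\pi_{\mathbf Y^o_{1:N}|\Psi}(\mathbf y^o_{1:N})}\sum_{t=1}^N\Big\{I_1(\mathbf y_t^o;\Psi,\Psi^*)\prod_{s\ne t}I_2(\mathbf y_s^o;\Psi)\Big\}.$$ -/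

import Mathlib

open MeasureTheory ProbabilityTheory Matrix

noncomputable section

namespace GStPPCA

/-- The static parameters `Ψ = [W, μ, σ², δ_ε, δ_x]` of the model. All vectors are row vectors. -/
structure Params (d k : ℕ) where
  /-- the loading matrix -/
  W : Matrix (Fin d) (Fin k) ℝ
  /-- the location vector -/
  μ : Fin d → ℝ
  /-- the noise variance `σ²` -/
  σ2 : ℝ
  /-- the skewness vector of the noise -/
  δε : Fin d → ℝ
  /-- the skewness vector of the latent variable -/
  δx : Fin k → ℝ

/-! ### The chi-square scales -/

/-- The chi-square distribution with `ν > 0` degrees of freedom: Gamma, shape `ν / 2`,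
rate `1 / 2`. -/
def chiSq (ν : ℝ) : Measure ℝ := gammaMeasure (ν / 2) (1 / 2)

/-- The quantile function of the chi-square distribution (used for `0 < s < 1`). -/
def chiSqQuantile (ν s : ℝ) : ℝ := sInf {x : ℝ | s ≤ cdf (chiSq ν) x}

/-- The map `T(s) = (χ⁻¹_{ν¹}(s) / ν¹, …, χ⁻¹_{νⁿ}(s) / νⁿ)`. -/
def scale {n : ℕ} (ν : Fin n → ℝ) (s : ℝ) : Fin n → ℝ := fun i => chiSqQuantile (ν i) s / ν i

/-- The uniform distribution on `[0,1]`. -/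
def uniform01 : Measure ℝ := volume.restrict (Set.Icc 0 1)

/-- The law of the co-monotone vector `T(S)`, `S` uniform on `[0,1]`. -/
def scaleLaw {n : ℕ} (ν : Fin n → ℝ) : Measure (Fin n → ℝ) := uniform01.map (scale ν)

/-- The (Euclidean) length `|∂T(s)/∂s|` of the velocity of the curve `T`. -/
def scaleSpeed {n : ℕ} (ν : Fin n → ℝ) (s : ℝ) : ℝ :=
  Real.sqrt (∑ i, (deriv (fun r => scale ν r i) s) ^ 2)

/-- The density of `T(S)`: it is carried by the curve `T((0,1))`, where its value at `u = T(s)` is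
`|∂T(s)/∂s|⁻¹` (the density with respect to arc length on the curve). -/
def scaleDensity {n : ℕ} (ν : Fin n → ℝ) : (Fin n → ℝ) → ℝ :=
  (scale ν '' Set.Ioo 0 1).indicator
    (fun u => (scaleSpeed ν (Function.invFunOn (scale ν) (Set.Ioo 0 1) u))⁻¹)

/-! ### The stochastic representation of the model -/

/-- The standard normal distribution on `ℝⁿ`. -/
def stdNormal (n : ℕ) : Measure (Fin n → ℝ) := Measure.pi (fun _ => gaussianReal 0 1)

/-- The primitive random variables of the model: for each `t`, the uniform variables
`S_{ε,t}`, `S_{x,t}` and the standard normal vectors `Z_{ε,t}`, `Z_{x,t}` are mutually independent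
(their joint law is the product law), and the quadruples are independent over `t`. -/
structure IsModel {d k N : ℕ} {Ω : Type*} [MeasurableSpace Ω] (P : Measure Ω)
    (Sε Sx : Fin N → Ω → ℝ) (Zε : Fin N → Ω → Fin d → ℝ) (Zx : Fin N → Ω → Fin k → ℝ) : Prop where
  law : ∀ t, HasLaw (fun ω => (Sε t ω, Sx t ω, Zε t ω, Zx t ω))
    (uniform01.prod (uniform01.prod ((stdNormal d).prod (stdNormal k)))) P
  indep : iIndepFun (fun t ω => (Sε t ω, Sx t ω, Zε t ω, Zx t ω)) P

/-- `X_t = V_t⁻¹ ∘ δ_x + √(V_t⁻¹) ∘ Z_{x,t}`. -/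
def latentX {d k : ℕ} (Ψ : Params d k) (v z : Fin k → ℝ) : Fin k → ℝ :=
  fun j => (v j)⁻¹ * Ψ.δx j + Real.sqrt ((v j)⁻¹) * z j

/-- `ε_t = U_t⁻¹ ∘ δ_ε + √(σ² U_t⁻¹) ∘ Z_{ε,t}`. -/
def noise {d k : ℕ} (Ψ : Params d k) (u z : Fin d → ℝ) : Fin d → ℝ :=
  fun i => (u i)⁻¹ * Ψ.δε i + Real.sqrt (Ψ.σ2 * (u i)⁻¹) * z i

/-- `Y_t = μ + X_t Wᵀ + ε_t`. -/
def obsY {d k : ℕ} (Ψ : Params d k) (x : Fin k → ℝ) (e : Fin d → ℝ) : Fin d → ℝ :=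
  Ψ.μ + x ᵥ* Ψ.Wᵀ + e

/-! ### Observed and missing entries -/

/-- The observed entries of an observation, with index set `O`. -/
abbrev Obs {d : ℕ} (O : Finset (Fin d)) : Type := {i : Fin d // i ∈ O} → ℝ

/-- The missing entries of an observation. -/
abbrev Mis {d : ℕ} (O : Finset (Fin d)) : Type := {i : Fin d // i ∉ O} → ℝ

/-- The hidden variables `(y^m, x, u, v)` at one time point. -/
abbrev Hidden {d : ℕ} (k : ℕ) (O : Finset (Fin d)) : Type :=
  Mis O × (Fin k → ℝ) × (Fin d → ℝ) × (Fin k → ℝ)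

instance instStandardBorelHidden {d k N : ℕ} (O : Fin N → Finset (Fin d)) :
    StandardBorelSpace (∀ t, Hidden k (O t)) := by
  have : ∀ t, StandardBorelSpace (Hidden k (O t)) := fun t => inferInstance
  exact StandardBorelSpace.pi_countable

/-- The full vector `y = [y^o, y^m]`. -/
def assemble {d : ℕ} (O : Finset (Fin d)) (yo : Obs O) (ym : Mis O) : Fin d → ℝ :=
  fun i => if h : i ∈ O then yo ⟨i, h⟩ else ym ⟨i, h⟩

/-- The random vector `Y_t` obtained from the primitive variables. -/
def randY {d k : ℕ} (νε : Fin d → ℝ) (νx : Fin k → ℝ) (Ψ : Params d k)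
    (sε sx : ℝ) (zε : Fin d → ℝ) (zx : Fin k → ℝ) : Fin d → ℝ :=
  obsY Ψ (latentX Ψ (scale νx sx) zx) (noise Ψ (scale νε sε) zε)

/-- The observed data `Y^o_{1:N}` as a random variable. -/
def randObs {d k N : ℕ} {Ω : Type*} (νε : Fin d → ℝ) (νx : Fin k → ℝ) (Ψ : Params d k)
    (O : Fin N → Finset (Fin d)) (Sε Sx : Fin N → Ω → ℝ)
    (Zε : Fin N → Ω → Fin d → ℝ) (Zx : Fin N → Ω → Fin k → ℝ) (ω : Ω) (t : Fin N) : Obs (O t) :=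
  fun i => randY νε νx Ψ (Sε t ω) (Sx t ω) (Zε t ω) (Zx t ω) i.1

/-- The hidden data `(Y^m, X, U, V)_{1:N}` as a random variable. -/
def randHidden {d k N : ℕ} {Ω : Type*} (νε : Fin d → ℝ) (νx : Fin k → ℝ) (Ψ : Params d k)
    (O : Fin N → Finset (Fin d)) (Sε Sx : Fin N → Ω → ℝ)
    (Zε : Fin N → Ω → Fin d → ℝ) (Zx : Fin N → Ω → Fin k → ℝ) (ω : Ω) (t : Fin N) :
    Hidden k (O t) :=
  (fun i => randY νε νx Ψ (Sε t ω) (Sx t ω) (Zε t ω) (Zx t ω) i.1,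
    latentX Ψ (scale νx (Sx t ω)) (Zx t ω), scale νε (Sε t ω), scale νx (Sx t ω))

/-! ### Densities and the function `Q` -/

/-- The density of the Gaussian distribution with mean `m` and covariance matrix `C` on `ℝ^ι`. -/
def gaussDensity {ι : Type*} [Fintype ι] [DecidableEq ι] (m : ι → ℝ) (C : Matrix ι ι ℝ)
    (y : ι → ℝ) : ℝ :=
  (2 * Real.pi) ^ (-(Fintype.card ι : ℝ) / 2) * C.det ^ (-(1 / 2) : ℝ) *
    Real.exp (-(1 / 2) * ((y - m) ⬝ᵥ (C⁻¹ *ᵥ (y - m))))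

/-- `π(y | x, u, v, Ψ) · π(x | u, v, Ψ)`. -/
def condJointDensity {d k : ℕ} (Ψ : Params d k) (y : Fin d → ℝ) (x : Fin k → ℝ)
    (u : Fin d → ℝ) (v : Fin k → ℝ) : ℝ :=
  gaussDensity (Ψ.μ + Ψ.δε ᵥ* (diagonal u)⁻¹ + x ᵥ* Ψ.Wᵀ) (Ψ.σ2 • (diagonal u)⁻¹) y *
    gaussDensity (Ψ.δx ᵥ* (diagonal v)⁻¹) (diagonal v)⁻¹ x

/-- The complete-data density
`π(y, x, u, v | Ψ) = π(y | x, u, v, Ψ) π(x | u, v, Ψ) π(u) π(v)` at one time point. -/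
def jointDensity {d k : ℕ} (νε : Fin d → ℝ) (νx : Fin k → ℝ) (Ψ : Params d k)
    (y : Fin d → ℝ) (x : Fin k → ℝ) (u : Fin d → ℝ) (v : Fin k → ℝ) : ℝ :=
  condJointDensity Ψ y x u v * scaleDensity νε u * scaleDensity νx v

/-- The measure `dy^m dx π(du) π(dv)` over all time points. -/
def hiddenRef {d k N : ℕ} (νε : Fin d → ℝ) (νx : Fin k → ℝ) (O : Fin N → Finset (Fin d)) :
    Measure (∀ t, Hidden k (O t)) :=
  Measure.pi (fun t => (volume : Measure (Mis (O t))).prod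
    ((volume : Measure (Fin k → ℝ)).prod ((scaleLaw νε).prod (scaleLaw νx))))

/-- `∏_t π(y_t | x_t, u_t, v_t, Ψ) π(x_t | u_t, v_t, Ψ)`, the density of the complete data with
respect to `dy dx π(du) π(dv)`. -/
def completeLik {d k N : ℕ} (Ψ : Params d k) (O : Fin N → Finset (Fin d))
    (yo : ∀ t, Obs (O t)) (h : ∀ t, Hidden k (O t)) : ℝ :=
  ∏ t, condJointDensity Ψ (assemble (O t) (yo t) (h t).1) (h t).2.1 (h t).2.2.1 (h t).2.2.2

/-- The density `π(y^o_{1:N} | Ψ)` of the observed data. -/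
def obsDensity {d k N : ℕ} (νε : Fin d → ℝ) (νx : Fin k → ℝ) (Ψ : Params d k)
    (O : Fin N → Finset (Fin d)) (yo : ∀ t, Obs (O t)) : ℝ :=
  ∫ h, completeLik Ψ O yo h ∂(hiddenRef νε νx O)

/-- The conditional law of `(Y^m, X, U, V)_{1:N}` given `Y^o_{1:N} = y^o_{1:N}`, under `Ψ`. -/
def hiddenCondLaw {d k N : ℕ} (νε : Fin d → ℝ) (νx : Fin k → ℝ) (Ψ : Params d k)
    (O : Fin N → Finset (Fin d)) (yo : ∀ t, Obs (O t)) : Measure (∀ t, Hidden k (O t)) :=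
  (hiddenRef νε νx O).withDensity
    (fun h => ENNReal.ofReal (completeLik Ψ O yo h / obsDensity νε νx Ψ O yo))

/-- The complete-data log-likelihood `log π(y_{1:N}, x_{1:N}, u_{1:N}, v_{1:N} | Ψ)`. -/
def completeLogLik {d k N : ℕ} (νε : Fin d → ℝ) (νx : Fin k → ℝ) (Ψ : Params d k)
    (O : Fin N → Finset (Fin d)) (yo : ∀ t, Obs (O t)) (h : ∀ t, Hidden k (O t)) : ℝ :=
  Real.log (∏ t, jointDensity νε νx Ψ
    (assemble (O t) (yo t) (h t).1) (h t).2.1 (h t).2.2.1 (h t).2.2.2)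

/-- The E-step function `Q(Ψ, Ψ*)`. -/
def eStepQ {d k N : ℕ} (νε : Fin d → ℝ) (νx : Fin k → ℝ) (Ψ Ψs : Params d k)
    (O : Fin N → Finset (Fin d)) (yo : ∀ t, Obs (O t)) : ℝ :=
  ∫ h, completeLogLik νε νx Ψs O yo h ∂(hiddenCondLaw νε νx Ψ O yo)

/-! ### The closed form -/

section ClosedForm

variable {d k : ℕ} (Ψ Ψs : Params d k) (u : Fin d → ℝ) (v : Fin k → ℝ)

/-- `M = σ² D_x + Wᵀ D_ε W`. -/
def matM : Matrix (Fin k) (Fin k) ℝ :=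
  Ψ.σ2 • diagonal v + Ψ.Wᵀ * diagonal u * Ψ.W

/-- `N = I - W M⁻¹ Wᵀ D_ε`. -/
def matN : Matrix (Fin d) (Fin d) ℝ :=
  1 - Ψ.W * (matM Ψ u v)⁻¹ * Ψ.Wᵀ * diagonal u

/-- `D_ε N = D_ε - D_ε W M⁻¹ Wᵀ D_ε`. -/
def matDN : Matrix (Fin d) (Fin d) ℝ := diagonal u * matN Ψ u v

/-- `μ_y = μ + δ_ε D_ε⁻¹ + σ² δ_x M⁻¹ Wᵀ D_ε (D_ε N)⁻¹`. -/
def meanY : Fin d → ℝ :=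
  Ψ.μ + Ψ.δε ᵥ* (diagonal u)⁻¹ +
    Ψ.σ2 • (Ψ.δx ᵥ* ((matM Ψ u v)⁻¹ * Ψ.Wᵀ * diagonal u * (matDN Ψ u v)⁻¹))

/-- `Σ_y = σ² (D_ε N)⁻¹`. -/
def covY : Matrix (Fin d) (Fin d) ℝ := Ψ.σ2 • (matDN Ψ u v)⁻¹

variable (O : Finset (Fin d))

/-- `μ_y^o`. -/
def meanO : Obs O := fun i => meanY Ψ u v i.1

/-- `μ_y^m`. -/
def meanM : Mis O := fun i => meanY Ψ u v i.1

/-- `Σ_y^{oo}`. -/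
def covOO : Matrix {i : Fin d // i ∈ O} {i : Fin d // i ∈ O} ℝ :=
  (covY Ψ u v).submatrix Subtype.val Subtype.val

/-- `Σ_y^{om}`. -/
def covOM : Matrix {i : Fin d // i ∈ O} {i : Fin d // i ∉ O} ℝ :=
  (covY Ψ u v).submatrix Subtype.val Subtype.val

/-- `Σ_y^{mo}`. -/
def covMO : Matrix {i : Fin d // i ∉ O} {i : Fin d // i ∈ O} ℝ :=
  (covY Ψ u v).submatrix Subtype.val Subtype.val

/-- `Σ_y^{mm}`. -/
def covMM : Matrix {i : Fin d // i ∉ O} {i : Fin d // i ∉ O} ℝ :=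
  (covY Ψ u v).submatrix Subtype.val Subtype.val

/-- The Gaussian density of `Y^o` given `(u, v)`. -/
def densityO (yo : Obs O) : ℝ := gaussDensity (meanO Ψ u v O) (covOO Ψ u v O) yo

/-- The conditional mean `μ_y^m + (y^o - μ_y^o) (Σ_y^{oo})⁻¹ Σ_y^{om}` of `Y^m`. -/
def condMeanM (yo : Obs O) : Mis O :=
  meanM Ψ u v O + (yo - meanO Ψ u v O) ᵥ* ((covOO Ψ u v O)⁻¹ * covOM Ψ u v O)

/-- The conditional covariance `Σ_y^{mm} - Σ_y^{mo} (Σ_y^{oo})⁻¹ Σ_y^{om}` of `Y^m`. -/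
def condCovM : Matrix {i : Fin d // i ∉ O} {i : Fin d // i ∉ O} ℝ :=
  covMM Ψ u v O - covMO Ψ u v O * (covOO Ψ u v O)⁻¹ * covOM Ψ u v O

/-- `E[Y] = [y^o, μ̃]`, the conditional mean of `Y` given `y^o`, `u`, `v`. -/
def expY (yo : Obs O) : Fin d → ℝ := assemble O yo (condMeanM Ψ u v O yo)

/-- `E[Yᵀ Y]`, the conditional second moment of `Y` given `y^o`, `u`, `v`. -/
def expYY (yo : Obs O) : Matrix (Fin d) (Fin d) ℝ :=
  Matrix.of (fun i j =>
    if h : i ∉ O ∧ j ∉ O then condCovM Ψ u v O ⟨i, h.1⟩ ⟨j, h.2⟩ else 0) +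
    vecMulVec (expY Ψ u v O yo) (expY Ψ u v O yo)

/-- `b = -μ D_ε W - δ_ε W + σ² δ_x`. -/
def vecB : Fin k → ℝ :=
  -(Ψ.μ ᵥ* (diagonal u * Ψ.W)) - Ψ.δε ᵥ* Ψ.W + Ψ.σ2 • Ψ.δx

/-- `b* = -(1/σ*²) W*ᵀ D_ε μ*ᵀ - (1/σ*²) W*ᵀ δ_ε*ᵀ + δ_x*ᵀ`. -/
def vecBs : Fin k → ℝ :=
  -((1 / Ψs.σ2) • ((Ψs.Wᵀ * diagonal u) *ᵥ Ψs.μ)) - (1 / Ψs.σ2) • (Ψs.Wᵀ *ᵥ Ψs.δε) + Ψs.δx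

/-- `G* = (1/σ*²) W*ᵀ D_ε W* + D_x`. -/
def matGs : Matrix (Fin k) (Fin k) ℝ :=
  (1 / Ψs.σ2) • (Ψs.Wᵀ * diagonal u * Ψs.W) + diagonal v

variable (νε : Fin d → ℝ) (νx : Fin k → ℝ)

/-- The function `v(y^o, u, v; Ψ, Ψ*)`. -/
def fnV (yo : Obs O) : ℝ :=
  Real.log (scaleDensity νε u) + Real.log (scaleDensity νx v)
  - ((k : ℝ) + d) / 2 * Real.log (2 * Real.pi) - (d : ℝ) / 2 * Real.log Ψs.σ2
  + 1 / 2 * ∑ i, Real.log (u i) + 1 / 2 * ∑ j, Real.log (v j)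
  - 1 / 2 * (Ψs.δx ⬝ᵥ ((diagonal v)⁻¹ *ᵥ Ψs.δx))
  - 1 / (2 * Ψs.σ2) * trace (expYY Ψ u v O yo * diagonal u)
  + 1 / Ψs.σ2 * (expY Ψ u v O yo ⬝ᵥ (diagonal u *ᵥ Ψs.μ + Ψs.δε))
  - 1 / (2 * Ψs.σ2) * (Ψs.μ ⬝ᵥ (diagonal u *ᵥ Ψs.μ))
  - 1 / Ψs.σ2 * (Ψs.μ ⬝ᵥ Ψs.δε)
  - 1 / (2 * Ψs.σ2) * (Ψs.δε ⬝ᵥ ((diagonal u)⁻¹ *ᵥ Ψs.δε))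
  + 1 / Ψs.σ2 * trace (expYY Ψ u v O yo * diagonal u * Ψ.W * (matM Ψ u v)⁻¹ *
      Ψs.Wᵀ * diagonal u)
  + expY Ψ u v O yo ⬝ᵥ ((diagonal u * Ψ.W * (matM Ψ u v)⁻¹) *ᵥ vecBs Ψs u)
  + 1 / Ψs.σ2 * (vecB Ψ u ⬝ᵥ (((matM Ψ u v)⁻¹ * Ψs.Wᵀ * diagonal u) *ᵥ expY Ψ u v O yo))
  + vecB Ψ u ⬝ᵥ ((matM Ψ u v)⁻¹ *ᵥ vecBs Ψs u)
  - 1 / 2 * trace ((matM Ψ u v)⁻¹ * Ψ.Wᵀ * diagonal u * expYY Ψ u v O yo * diagonal u * Ψ.W *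
      (matM Ψ u v)⁻¹ * matGs Ψs u v)
  - trace ((matM Ψ u v)⁻¹ * Ψ.Wᵀ * diagonal u * vecMulVec (expY Ψ u v O yo) (vecB Ψ u) *
      (matM Ψ u v)⁻¹ * matGs Ψs u v)
  - 1 / 2 * trace ((matM Ψ u v)⁻¹ * vecMulVec (vecB Ψ u) (vecB Ψ u) *
      (matM Ψ u v)⁻¹ * matGs Ψs u v)
  - Ψ.σ2 / 2 * trace ((matM Ψ u v)⁻¹ * matGs Ψs u v)

/-- The matrix in the exponent of the weight function,
`D_x⁻¹ - σ² M⁻¹ Wᵀ D_ε (D_ε N)⁻¹ D_ε W M⁻¹ - σ² M⁻¹`. -/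
def skewMat : Matrix (Fin k) (Fin k) ℝ :=
  (diagonal v)⁻¹
  - Ψ.σ2 • ((matM Ψ u v)⁻¹ * Ψ.Wᵀ * diagonal u * (matDN Ψ u v)⁻¹ * diagonal u * Ψ.W *
      (matM Ψ u v)⁻¹)
  - Ψ.σ2 • (matM Ψ u v)⁻¹

/-- The weight function as a function of `u` and `v`. -/
def weight (yo : Obs O) : ℝ :=
  Real.exp (-(1 / 2) * (Ψ.δx ⬝ᵥ (skewMat Ψ u v *ᵥ Ψ.δx))) * densityO Ψ u v O yo *
    Ψ.σ2 ^ ((k : ℝ) / 2) * (diagonal v).det ^ (1 / 2 : ℝ) *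
    (matM Ψ u v).det ^ (-(1 / 2) : ℝ) * (matN Ψ u v).det ^ (-(1 / 2) : ℝ)

/-- `ṽ(y^o, s_ε, s_x; Ψ, Ψ*) = v(y^o, T_ε(s_ε), T_x(s_x); Ψ, Ψ*)`. -/
def fnVTilde (yo : Obs O) (sε sx : ℝ) : ℝ :=
  fnV Ψ Ψs (scale νε sε) (scale νx sx) O νε νx yo

/-- The weight function `m(y^o, s_ε, s_x; Ψ)`. -/
def fnM (yo : Obs O) (sε sx : ℝ) : ℝ := weight Ψ (scale νε sε) (scale νx sx) O yo

/-- `I₁(y^o; Ψ, Ψ*) = ∫₀¹ ∫₀¹ ṽ m ds_ε ds_x`. -/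
def I₁ (yo : Obs O) : ℝ :=
  ∫ sx in (0 : ℝ)..1, ∫ sε in (0 : ℝ)..1, fnVTilde Ψ Ψs O νε νx yo sε sx * fnM Ψ O νε νx yo sε sx

/-- `I₂(y^o; Ψ) = ∫₀¹ ∫₀¹ m ds_ε ds_x`. -/
def I₂ (yo : Obs O) : ℝ :=
  ∫ sx in (0 : ℝ)..1, ∫ sε in (0 : ℝ)..1, fnM Ψ O νε νx yo sε sx

end ClosedForm

end GStPPCA

end

open GStPPCA

/-! Given the scales `(u, v)` the model is linear Gaussian, so the E-step reduces to Gaussian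
integrals in `(y^m, x)`, followed by an average over the law of the scales and a product over time.

At fixed positive scales, completing the square in `x` gives `condJointDensity_eq`: the density of
`(y, x)` is `N(y; μ_y, Σ_y)` times `N(x; postMean, σ² M⁻¹)`. All matrix identities come from `Wᵀ D_ε
W = M - σ² D_x`. It yields the Woodbury identity `Σ_y = σ² D_ε⁻¹ + W D_x⁻¹ Wᵀ` and shows that the
exponent matrix `skewMat` vanishes. Sylvester's identity gives `det M · det N = σ^{2k} det D_x`, so
the remaining prefactors cancel as well and the weight `m` is exactly the density of `Y^o` given the
scales (`weight_eq_densityO`). The Schur complement factors the `y`-density further into observed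
and conditional missing parts (`gaussDensity_assemble`).

The log-density at `Ψ*` is quadratic in `x`. Its mean under the posterior of `x` is quadratic in
`y`, and the mean of that under the law of `y^m` involves only `e` and `E`; the outcome is `v` times
the density of `y^o` (`integral_integral_log_jointDensity`). The arc-length densities enter only
through their logarithms, hence only their almost sure positivity matters.

Substituting `u = T_ε(s_ε)`, `v = T_x(s_x)` turns averages over the scales into integrals over the
unit square: `I₂` is the density `Z_t` of one observation and `I₁ / Z_t` the conditional mean of one
log-density. Integrability of `m` rests on the bound `c ∏ (1 + u^i)` (`densityO_le`) and on the
moments of the chi-square law.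

Over time, likelihood and reference measure are products, so the conditional law is a product
(`hiddenCondLaw_eq_pi`) and `Q = ∑ I₁(t) / Z_t`, which is the claim after expanding each fraction by
`∏_{s ≠ t} Z_s`. The probabilistic statements follow by transporting the law of the primitive
variables (`map_randObs_randHidden`) and by uniqueness of disintegrations. -/

noncomputable section

namespace GStPPCA

/-! ### Product measures: densities, rearrangement of coordinates, integrable sums. -/

section ProductMeasures

open scoped ENNReal

theorem lintegral_fin_prod_eq_prod {n : ℕ} {E : Fin n → Type*}
    {mE : ∀ i, MeasurableSpace (E i)} {μ : (i : Fin n) → Measure (E i)} [∀ i, SigmaFinite (μ i)]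
    {f : (i : Fin n) → E i → ℝ≥0∞} (hf : ∀ i, Measurable (f i)) :
    ∫⁻ x : (i : Fin n) → E i, ∏ i, f i (x i) ∂(Measure.pi μ) = ∏ i, ∫⁻ x, f i x ∂(μ i) := by
  induction n with
  | zero => simp
  | succ n n_ih =>
      have hm : Measurable fun x : (i : Fin n) → E (Fin.succ i) =>
          ∏ i : Fin n, f (Fin.succ i) (x i) :=
        Finset.measurable_prod _ fun i _ => (hf _).comp (measurable_pi_apply i)
      calc
        _ = ∫⁻ x : E 0 × ((i : Fin n) → E (Fin.succ i)),
            f 0 x.1 * ∏ i : Fin n, f (Fin.succ i) (x.2 i)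
            ∂((μ 0).prod (Measure.pi (fun i ↦ μ i.succ))) := by
          rw [← ((measurePreserving_piFinSuccAbove μ 0).symm).lintegral_comp_emb
            (MeasurableEquiv.measurableEmbedding _)]
          simp_rw [MeasurableEquiv.piFinSuccAbove_symm_apply, Fin.insertNthEquiv,
            Fin.prod_univ_succ, Fin.insertNth_zero, Equiv.coe_fn_mk, Fin.cons_succ,
            Fin.cons_zero]
          rfl
        _ = (∫⁻ x, f 0 x ∂μ 0)
            * ∏ i : Fin n, ∫⁻ (x : E (Fin.succ i)), f (Fin.succ i) x ∂(μ i.succ) := by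
          rw [← n_ih fun i => hf _, ← lintegral_prod_mul (hf 0).aemeasurable hm.aemeasurable]
        _ = ∏ i, ∫⁻ x, f i x ∂(μ i) := by rw [Fin.prod_univ_succ]

variable {ι : Type*} [Fintype ι]

theorem lintegral_fintype_prod_eq_prod {E : ι → Type*} {mE : ∀ i, MeasurableSpace (E i)}
    {μ : (i : ι) → Measure (E i)} [∀ i, SigmaFinite (μ i)]
    {f : (i : ι) → E i → ℝ≥0∞} (hf : ∀ i, Measurable (f i)) :
    ∫⁻ x : (i : ι) → E i, ∏ i, f i (x i) ∂(Measure.pi μ) = ∏ i, ∫⁻ x, f i x ∂(μ i) := by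
  let e := (Fintype.equivFin ι).symm
  rw [← (measurePreserving_piCongrLeft _ e).lintegral_comp_emb
    (MeasurableEquiv.measurableEmbedding _)]
  simp_rw [← e.prod_comp, MeasurableEquiv.coe_piCongrLeft, Equiv.piCongrLeft_apply_apply]
  exact lintegral_fin_prod_eq_prod fun i => hf _

/-- It suffices to compare the measures on boxes, where the indicator is a product and Tonelli
applies. Finiteness of the densities keeps each factor σ-finite. The lemma serves both the
coordinates of a Gaussian vector and the time points. -/
theorem pi_withDensity {E : ι → Type*} {mE : ∀ i, MeasurableSpace (E i)}
    {μ : (i : ι) → Measure (E i)} [∀ i, SigmaFinite (μ i)]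
    {f : (i : ι) → E i → ℝ≥0∞} (hf : ∀ i, Measurable (f i)) (hf' : ∀ i x, f i x ≠ ∞) :
    Measure.pi (fun i => (μ i).withDensity (f i)) =
      (Measure.pi μ).withDensity (fun x => ∏ i, f i (x i)) := by
  have : ∀ i, SigmaFinite ((μ i).withDensity (f i)) := fun i =>
    SigmaFinite.withDensity_of_ne_top' (hf' i)
  refine Measure.pi_eq fun s hs => ?_
  rw [withDensity_apply _ (MeasurableSet.univ_pi hs)]
  simp_rw [withDensity_apply _ (hs _)]
  rw [← lintegral_indicator (MeasurableSet.univ_pi hs)]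
  simp_rw [← lintegral_indicator (hs _)]
  rw [← lintegral_fintype_prod_eq_prod fun i => (hf i).indicator (hs i)]
  congr 1
  ext x
  by_cases hx : x ∈ Set.univ.pi s
  · rw [Set.indicator_of_mem hx]
    exact Finset.prod_congr rfl fun i _ => (Set.indicator_of_mem (hx i trivial) _).symm
  · rw [Set.indicator_of_notMem hx]
    simp only [Set.mem_pi, Set.mem_univ, forall_const, not_forall] at hx
    obtain ⟨i, hi⟩ := hx
    exact (Finset.prod_eq_zero (Finset.mem_univ i) (Set.indicator_of_notMem hi _)).symm

/-- Both measures agree on products of two boxes, a π-system with finite spanning sets. This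
separates all observed from all hidden coordinates after the time points have been multiplied
together. -/
theorem map_unzip_pi_prod {α β : ι → Type*} {mα : ∀ i, MeasurableSpace (α i)}
    {mβ : ∀ i, MeasurableSpace (β i)} (μ : ∀ i, Measure (α i)) (ν : ∀ i, Measure (β i))
    [∀ i, SigmaFinite (μ i)] [∀ i, SigmaFinite (ν i)] :
    (Measure.pi fun i => (μ i).prod (ν i)).map
        (fun x => ((fun i => (x i).1, fun i => (x i).2) : (∀ i, α i) × (∀ i, β i))) =
      (Measure.pi μ).prod (Measure.pi ν) := by
  have hm : Measurable (fun x : ∀ i, α i × β i =>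
      ((fun i => (x i).1, fun i => (x i).2) : (∀ i, α i) × (∀ i, β i))) := by fun_prop
  refine (Measure.FiniteSpanningSetsIn.ext ?_ (isPiSystem_pi.prod isPiSystem_pi)
      ((Measure.FiniteSpanningSetsIn.pi fun i ↦ (μ i).toFiniteSpanningSetsIn).prod
      (Measure.FiniteSpanningSetsIn.pi (fun i ↦ (ν i).toFiniteSpanningSetsIn))) ?_).symm
  · refine (generateFrom_eq_prod generateFrom_pi generateFrom_pi ?_ ?_).symm
    · exact (Measure.FiniteSpanningSetsIn.pi
        (fun i ↦ (μ i).toFiniteSpanningSetsIn)).isCountablySpanning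
    · exact (Measure.FiniteSpanningSetsIn.pi
        (fun i ↦ (ν i).toFiniteSpanningSetsIn)).isCountablySpanning
  · rintro _ ⟨s, ⟨s, hs, rfl⟩, ⟨_, ⟨t, ht, rfl⟩, rfl⟩⟩
    rw [Measure.map_apply hm ((MeasurableSet.univ_pi fun i => hs i trivial).prod
      (MeasurableSet.univ_pi fun i => ht i trivial)),
      show (fun x : ∀ i, α i × β i =>
        ((fun i => (x i).1, fun i => (x i).2) : (∀ i, α i) × (∀ i, β i))) ⁻¹'
          (Set.univ.pi s ×ˢ Set.univ.pi t) = (Set.univ.pi fun i ↦ s i ×ˢ t i) by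
          ext; simp [Set.mem_pi, forall_and]]
    simp_rw [Measure.pi_pi, Measure.prod_prod, Measure.pi_pi, Finset.prod_mul_distrib]

/-- Resampling one coordinate independently does not change a product law. -/
theorem measurePreserving_update [DecidableEq ι] {E : ι → Type*} {mE : ∀ i, MeasurableSpace (E i)}
    (μ : (i : ι) → Measure (E i)) [∀ i, IsProbabilityMeasure (μ i)] (i : ι) :
    MeasurePreserving (fun p : E i × (∀ j, E j) => Function.update p.2 i p.1)
      ((μ i).prod (Measure.pi μ)) (Measure.pi μ) := by
  have hm : Measurable (fun p : E i × (∀ j, E j) => Function.update p.2 i p.1) := by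
    refine measurable_pi_lambda _ fun j => ?_
    by_cases h : j = i
    · subst h; simpa using measurable_fst
    · simp only [Function.update_of_ne h]; fun_prop
  refine ⟨hm, (Measure.pi_eq fun s hs => ?_).symm⟩
  rw [Measure.map_apply hm (MeasurableSet.univ_pi hs),
    show (fun p : E i × (∀ j, E j) => Function.update p.2 i p.1) ⁻¹' (Set.univ.pi s) =
      s i ×ˢ Set.univ.pi (Function.update s i Set.univ) by
      ext p
      simp only [Set.mem_preimage, Set.mem_pi, Set.mem_univ, forall_const, Set.mem_prod]
      constructor
      · intro h
        refine ⟨by simpa using h i, fun j => ?_⟩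
        by_cases hj : j = i
        · subst hj; simp
        · simpa [hj] using h j
      · rintro ⟨h1, h2⟩ j
        by_cases hj : j = i
        · subst hj; simpa using h1
        · simpa [hj] using h2 j,
    Measure.prod_prod, Measure.pi_pi, ← Finset.mul_prod_erase Finset.univ _ (Finset.mem_univ i),
    ← Finset.mul_prod_erase Finset.univ (fun j => μ j (s j)) (Finset.mem_univ i)]
  simp only [Function.update_self, measure_univ, one_mul]
  congr 1
  refine Finset.prod_congr rfl fun j hj => ?_
  rw [Function.update_of_ne (Finset.ne_of_mem_erase hj)]

/-- By Fubini the sum is integrable in the `i`-th coordinate for almost every choice of the others.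
Freezing them at one such point changes `f i` only by a constant, and constants are integrable under
a probability measure. Hence integrability of the full log-likelihood passes to each time point. -/
theorem integrable_of_integrable_sum_eval {E : ι → Type*} {mE : ∀ i, MeasurableSpace (E i)}
    {μ : (i : ι) → Measure (E i)} [∀ i, IsProbabilityMeasure (μ i)] {f : ∀ i, E i → ℝ}
    (hf : Integrable (fun x => ∑ i, f i (x i)) (Measure.pi μ)) (i : ι) :
    Integrable (f i) (μ i) := by
  classical
  have h := (measurePreserving_update μ i).integrable_comp_of_integrable hf
  obtain ⟨y, hy⟩ := h.prod_left_ae.exists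
  have : f i = fun a => (∑ j, f j (Function.update y i a j)) -
      ∑ j ∈ Finset.univ.erase i, f j (y j) := by
    ext a
    rw [← Finset.add_sum_erase Finset.univ _ (Finset.mem_univ i), Function.update_self,
      Finset.sum_congr rfl (g := fun j => f j (y j)) fun j hj => by
        rw [Function.update_of_ne (Finset.ne_of_mem_erase hj)]]
    ring
  rw [this]
  exact hy.sub (integrable_const _)

end ProductMeasures

/-! ### The chi-square distribution function, its quantile function and its moments. -/

section ChiSquare

open Set Filter Topology
open scoped ENNReal

theorem isProbabilityMeasure_chiSq {ν : ℝ} (hν : 0 < ν) : IsProbabilityMeasure (chiSq ν) :=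
  isProbabilityMeasure_gammaMeasure (by positivity) (by norm_num)

theorem integrable_gammaPDFReal {a r : ℝ} (ha : 0 < a) (hr : 0 < r) :
    Integrable (gammaPDFReal a r) := by
  refine ⟨(stronglyMeasurable_gammaPDFReal a r).aestronglyMeasurable, ?_⟩
  rw [hasFiniteIntegral_iff_ofReal (ae_of_all _ (gammaPDFReal_nonneg ha hr))]
  exact (lintegral_gammaPDF_eq_one ha hr).trans_lt ENNReal.one_lt_top

theorem continuousAt_gammaPDFReal {a r x : ℝ} (hx : 0 < x) : ContinuousAt (gammaPDFReal a r) x := by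
  have h : ContinuousAt (fun x : ℝ => r ^ a / (Real.Gamma a) * x ^ (a - 1) * Real.exp (-(r * x))) x :=
    by
      have := Real.continuousAt_rpow_const x (a - 1) (Or.inl hx.ne')
      fun_prop
  refine h.congr ?_
  filter_upwards [lt_mem_nhds hx] with y hy
  simp [gammaPDFReal, hy.le]

theorem cdf_chiSq_of_nonpos {ν x : ℝ} (hν : 0 < ν) (hx : x ≤ 0) : cdf (chiSq ν) x = 0 := by
  rw [chiSq, cdf_gammaMeasure_eq_lintegral (by positivity) (by norm_num),
    setLIntegral_congr Iio_ae_eq_Iic.symm, lintegral_gammaPDF_of_nonpos hx, ENNReal.toReal_zero]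

/-- There is no mass below `0`, so the distribution function is the integral of the density from
`0`; the density is continuous at positive points and the fundamental theorem of calculus applies.
-/
theorem hasDerivAt_cdf_chiSq {ν x : ℝ} (hν : 0 < ν) (hx : 0 < x) :
    HasDerivAt (cdf (chiSq ν)) (gammaPDFReal (ν / 2) (1 / 2) x) x := by
  have hi : Integrable (gammaPDFReal (ν / 2) (1 / 2)) :=
    integrable_gammaPDFReal (by positivity) (by norm_num)
  have h : ⇑(cdf (chiSq ν)) = fun y => ∫ t in (0 : ℝ)..y, gammaPDFReal (ν / 2) (1 / 2) t := by
    ext y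
    rw [← intervalIntegral.integral_Iic_sub_Iic hi.integrableOn hi.integrableOn,
      ← cdf_gammaMeasure_eq_integral (by positivity) (by norm_num),
      ← cdf_gammaMeasure_eq_integral (by positivity) (by norm_num)]
    change _ = cdf (chiSq ν) y - cdf (chiSq ν) 0
    rw [cdf_chiSq_of_nonpos hν le_rfl, sub_zero]
  rw [h]
  exact intervalIntegral.integral_hasDerivAt_right hi.intervalIntegrable
    (stronglyMeasurable_gammaPDFReal _ _).stronglyMeasurableAtFilter (continuousAt_gammaPDFReal hx)

theorem strictMonoOn_cdf_chiSq {ν : ℝ} (hν : 0 < ν) : StrictMonoOn (cdf (chiSq ν)) (Ioi 0) := by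
  refine strictMonoOn_of_deriv_pos (convex_Ioi 0)
    (fun x hx => (hasDerivAt_cdf_chiSq hν hx).continuousAt.continuousWithinAt) fun x hx => ?_
  rw [interior_Ioi] at hx
  rw [(hasDerivAt_cdf_chiSq hν hx).deriv]
  exact gammaPDFReal_pos (by positivity) (by norm_num) hx

theorem cdf_chiSq_mem_Ioo {ν x : ℝ} (hν : 0 < ν) (hx : 0 < x) : cdf (chiSq ν) x ∈ Ioo 0 1 := by
  constructor
  · exact (cdf_nonneg _ _).trans_lt (strictMonoOn_cdf_chiSq hν (half_pos hx) hx (half_lt_self hx))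
  · exact (strictMonoOn_cdf_chiSq hν hx (add_pos hx one_pos) (lt_add_one x)).trans_le
      (cdf_le_one _ _)

theorem cdf_chiSq_lt_one {ν : ℝ} (hν : 0 < ν) (x : ℝ) : cdf (chiSq ν) x < 1 := by
  rcases lt_or_ge 0 x with h | h
  · exact (cdf_chiSq_mem_Ioo hν h).2
  · rw [cdf_chiSq_of_nonpos hν h]; norm_num

/-- The Galois connection between quantile and distribution function: right continuity makes the
infimum attained. Measurability and the law of the quantile both follow from it. -/
theorem chiSqQuantile_le_iff {ν s : ℝ} (hν : 0 < ν) (hs : s ∈ Ioo (0 : ℝ) 1) (x : ℝ) :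
    chiSqQuantile ν s ≤ x ↔ s ≤ cdf (chiSq ν) x := by
  set S : Set ℝ := {x : ℝ | s ≤ cdf (chiSq ν) x}
  have hbdd : BddBelow S := ⟨0, fun y hy => by
    by_contra! h
    exact absurd (show s ≤ cdf (chiSq ν) y from hy) (by
      rw [cdf_chiSq_of_nonpos hν h.le]; exact not_le.2 hs.1)⟩
  have hne : S.Nonempty := by
    obtain ⟨y, hy⟩ := ((tendsto_cdf_atTop (chiSq ν)).eventually_const_lt hs.2).exists
    exact ⟨y, hy.le⟩
  refine ⟨fun h => ?_, fun h => csInf_le hbdd h⟩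
  refine le_trans ?_ (monotone_cdf _ h)
  have hr : Tendsto (cdf (chiSq ν)) (𝓝[>] chiSqQuantile ν s)
      (𝓝 (cdf (chiSq ν) (chiSqQuantile ν s))) :=
    ((cdf (chiSq ν)).right_continuous _).tendsto.mono_left (nhdsWithin_mono _ Ioi_subset_Ici_self)
  refine ge_of_tendsto hr ?_
  filter_upwards [self_mem_nhdsWithin] with y hy
  obtain ⟨z, hz, hzy⟩ := exists_lt_of_csInf_lt hne hy
  exact le_trans hz (monotone_cdf _ hzy.le)

theorem chiSqQuantile_pos {ν s : ℝ} (hν : 0 < ν) (hs : s ∈ Ioo (0 : ℝ) 1) :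
    0 < chiSqQuantile ν s := by
  by_contra! h
  have := (chiSqQuantile_le_iff hν hs _).1 h
  rw [cdf_chiSq_of_nonpos hν le_rfl] at this
  exact absurd hs.1 (not_lt.2 this)

theorem cdf_chiSqQuantile {ν s : ℝ} (hν : 0 < ν) (hs : s ∈ Ioo (0 : ℝ) 1) :
    cdf (chiSq ν) (chiSqQuantile ν s) = s := by
  refine le_antisymm ?_ ((chiSqQuantile_le_iff hν hs _).1 le_rfl)
  -- Left continuity gives the other inequality: strictly below the quantile the distribution
  -- function is less than `s`.
  have hc : Tendsto (cdf (chiSq ν)) (𝓝[<] chiSqQuantile ν s)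
      (𝓝 (cdf (chiSq ν) (chiSqQuantile ν s))) :=
    (hasDerivAt_cdf_chiSq hν (chiSqQuantile_pos hν hs)).continuousAt.continuousWithinAt
  refine le_of_tendsto hc ?_
  filter_upwards [self_mem_nhdsWithin] with y hy
  by_contra! h
  exact absurd ((chiSqQuantile_le_iff hν hs y).2 h.le) (not_le.2 hy)

theorem chiSqQuantile_cdf {ν x : ℝ} (hν : 0 < ν) (hx : 0 < x) :
    chiSqQuantile ν (cdf (chiSq ν) x) = x :=
  (strictMonoOn_cdf_chiSq hν).injOn (chiSqQuantile_pos hν (cdf_chiSq_mem_Ioo hν hx)) hx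
    (cdf_chiSqQuantile hν (cdf_chiSq_mem_Ioo hν hx))

theorem monotoneOn_chiSqQuantile {ν : ℝ} (hν : 0 < ν) :
    MonotoneOn (chiSqQuantile ν) (Ioo 0 1) := fun _ hs _ ht hst =>
  (chiSqQuantile_le_iff hν hs _).2 (hst.trans (cdf_chiSqQuantile hν ht).ge)

/-- A monotone function whose image contains a neighbourhood of its value is continuous there; every
`y > 0` is attained, at the level `cdf y`. -/
theorem continuousAt_chiSqQuantile {ν s : ℝ} (hν : 0 < ν) (hs : s ∈ Ioo (0 : ℝ) 1) :
    ContinuousAt (chiSqQuantile ν) s := by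
  refine continuousAt_of_monotoneOn_of_image_mem_nhds (monotoneOn_chiSqQuantile hν)
    (Ioo_mem_nhds hs.1 hs.2) ?_
  filter_upwards [lt_mem_nhds (chiSqQuantile_pos hν hs)] with y hy
  exact ⟨_, cdf_chiSq_mem_Ioo hν hy, chiSqQuantile_cdf hν hy⟩

theorem hasDerivAt_chiSqQuantile {ν s : ℝ} (hν : 0 < ν) (hs : s ∈ Ioo (0 : ℝ) 1) :
    HasDerivAt (chiSqQuantile ν) (gammaPDFReal (ν / 2) (1 / 2) (chiSqQuantile ν s))⁻¹ s := by
  refine HasDerivAt.of_local_left_inverse (continuousAt_chiSqQuantile hν hs)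
    (hasDerivAt_cdf_chiSq hν (chiSqQuantile_pos hν hs))
    (gammaPDFReal_pos (by positivity) (by norm_num) (chiSqQuantile_pos hν hs)).ne' ?_
  filter_upwards [Ioo_mem_nhds hs.1 hs.2] with y hy using cdf_chiSqQuantile hν hy

/-- Default values of `sInf`: the set is all of `ℝ` for `s ≤ 0` and empty for `s ≥ 1`. Knowing the
value there gives measurability on the whole line. -/
theorem chiSqQuantile_of_notMem {ν s : ℝ} (hν : 0 < ν) (hs : s ∉ Ioo (0 : ℝ) 1) :
    chiSqQuantile ν s = 0 := by
  rcases le_or_gt s 0 with h | h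
  · have : {x : ℝ | s ≤ cdf (chiSq ν) x} = univ :=
      eq_univ_of_forall fun x => h.trans (cdf_nonneg _ _)
    rw [chiSqQuantile, this, Real.sInf_univ]
  · have : {x : ℝ | s ≤ cdf (chiSq ν) x} = ∅ := by
      refine eq_empty_of_forall_notMem fun x hx => hs ⟨h, ?_⟩
      exact lt_of_le_of_lt hx (cdf_chiSq_lt_one hν x)
    rw [chiSqQuantile, this, Real.sInf_empty]

theorem measurable_chiSqQuantile {ν : ℝ} (hν : 0 < ν) : Measurable (chiSqQuantile ν) := by
  refine measurable_of_Iic fun x => ?_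
  have : chiSqQuantile ν ⁻¹' Iic x =
      (Ioo 0 1 ∩ Iic (cdf (chiSq ν) x)) ∪ ((Ioo 0 1)ᶜ ∩ {_s : ℝ | (0 : ℝ) ≤ x}) := by
    ext s
    by_cases hs : s ∈ Ioo (0 : ℝ) 1
    · simp only [mem_preimage, mem_Iic, chiSqQuantile_le_iff hν hs, mem_union, mem_inter_iff, hs,
        mem_compl_iff, not_true, true_and, false_and, or_false]
    · simp only [mem_preimage, mem_Iic, chiSqQuantile_of_notMem hν hs, mem_union, mem_inter_iff,
        hs, mem_compl_iff, not_false_eq_true, true_and, false_and, false_or, mem_ofPred_eq]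
  rw [this]
  exact (measurableSet_Ioo.inter measurableSet_Iic).union
    (measurableSet_Ioo.compl.inter (MeasurableSet.const _))

instance : IsProbabilityMeasure uniform01 := ⟨by simp [uniform01]⟩

theorem ae_uniform01_mem_Ioo : ∀ᵐ s ∂uniform01, s ∈ Ioo (0 : ℝ) 1 := by
  rw [uniform01, ← restrict_Ioo_eq_restrict_Icc]
  exact ae_restrict_mem measurableSet_Ioo

/-- Inverse transform sampling: almost surely `chiSqQuantile ν s ≤ x` means `s ≤ cdf x`, an event of
probability `cdf x`. -/
theorem map_chiSqQuantile_uniform01 {ν : ℝ} (hν : 0 < ν) :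
    uniform01.map (chiSqQuantile ν) = chiSq ν := by
  have := isProbabilityMeasure_chiSq hν
  have : IsProbabilityMeasure (uniform01.map (chiSqQuantile ν)) :=
    Measure.isProbabilityMeasure_map (measurable_chiSqQuantile hν).aemeasurable
  refine Measure.eq_of_cdf _ _ (StieltjesFunction.ext fun x => ?_)
  rw [cdf_eq_real, measureReal_def, Measure.map_apply (measurable_chiSqQuantile hν) measurableSet_Iic,
    measure_congr (t := Iic (cdf (chiSq ν) x)), uniform01, Measure.restrict_apply measurableSet_Iic,
    show Iic (cdf (chiSq ν) x) ∩ Icc 0 1 = Icc 0 (cdf (chiSq ν) x) by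
      ext y; simp only [mem_inter_iff, mem_Iic, mem_Icc]
      exact ⟨fun h => ⟨h.2.1, h.1⟩, fun h => ⟨h.2, h.1, h.2.trans (cdf_le_one _ _)⟩⟩,
    Real.volume_Icc, sub_zero, ENNReal.toReal_ofReal (cdf_nonneg _ _)]
  filter_upwards [ae_uniform01_mem_Ioo] with s hs
  exact propext (chiSqQuantile_le_iff hν hs x)

/-- Multiplying the Gamma density of shape `ν / 2` by `x ^ n` gives a constant multiple of the Gamma
density of shape `ν / 2 + n`. -/
theorem integrable_pow_chiSq {ν : ℝ} (hν : 0 < ν) (n : ℕ) :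
    Integrable (fun x : ℝ => x ^ n) (chiSq ν) := by
  rw [chiSq, gammaMeasure, integrable_withDensity_iff
    (f := gammaPDF (ν / 2) (1 / 2)) (measurable_gammaPDFReal _ _).ennreal_ofReal
    (ae_of_all _ fun _ => ENNReal.ofReal_lt_top)]
  have hΓ : Real.Gamma (ν / 2 + n) ≠ 0 := (Real.Gamma_pos_of_pos (by positivity)).ne'
  refine (((integrable_gammaPDFReal (a := ν / 2 + n) (r := 1 / 2) (by positivity)
    (by norm_num)).const_mul ((1 / 2 : ℝ) ^ (ν / 2) / Real.Gamma (ν / 2) *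
      (Real.Gamma (ν / 2 + n) / (1 / 2 : ℝ) ^ (ν / 2 + n))))).congr ?_
  have h0 : ∀ᵐ x : ℝ, x ≠ 0 := by simp [ae_iff]
  filter_upwards [h0] with x hx
  rw [gammaPDF, ENNReal.toReal_ofReal (gammaPDFReal_nonneg (by positivity) (by norm_num) x)]
  rcases lt_or_gt_of_ne hx with h | h
  · simp [gammaPDFReal, not_le.2 h]
  · simp only [gammaPDFReal, if_pos h.le]
    have h1 : x ^ (ν / 2 + n - 1) = x ^ (ν / 2 - 1) * x ^ n := by
      rw [show ν / 2 + n - 1 = (ν / 2 - 1) + n by ring, Real.rpow_add_natCast h.ne']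
    have h2 : ((1 : ℝ) / 2) ^ (ν / 2 + n) ≠ 0 := (Real.rpow_pos_of_pos (by norm_num) _).ne'
    rw [h1]
    field_simp

end ChiSquare

/-! ### The curve of scales: positivity of its density and moments of its law. -/

section Scale

open Set Filter Topology
open scoped ENNReal

variable {n : ℕ} {ν : Fin n → ℝ}

theorem scale_pos (hν : ∀ i, 0 < ν i) {s : ℝ} (hs : s ∈ Ioo (0 : ℝ) 1) (i : Fin n) :
    0 < scale ν s i :=
  div_pos (chiSqQuantile_pos (hν i) hs) (hν i)

theorem measurable_scale (hν : ∀ i, 0 < ν i) : Measurable (scale ν) :=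
  measurable_pi_lambda _ fun i => (measurable_chiSqQuantile (hν i)).div_const _

theorem isProbabilityMeasure_scaleLaw (hν : ∀ i, 0 < ν i) : IsProbabilityMeasure (scaleLaw ν) :=
  Measure.isProbabilityMeasure_map (measurable_scale hν).aemeasurable

/-- Each coordinate of the velocity is positive. At least one coordinate is needed: for `n = 0` the
sum is empty and the speed is `0`. -/
theorem scaleSpeed_pos (hn : 0 < n) (hν : ∀ i, 0 < ν i) {s : ℝ} (hs : s ∈ Ioo (0 : ℝ) 1) :
    0 < scaleSpeed ν s := by
  refine Real.sqrt_pos.2 (Finset.sum_pos (fun i _ => pow_pos ?_ 2) ⟨⟨0, hn⟩, Finset.mem_univ _⟩)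
  change 0 < deriv (fun r => chiSqQuantile (ν i) r / ν i) s
  rw [((hasDerivAt_chiSqQuantile (hν i) hs).div_const (ν i)).deriv]
  exact div_pos (inv_pos.2 (gammaPDFReal_pos (half_pos (hν i)) (by norm_num)
    (chiSqQuantile_pos (hν i) hs))) (hν i)

/-- Any preimage in `(0, 1)` has positive speed, so it is irrelevant which one `Function.invFunOn`
selects. -/
theorem scaleDensity_pos (hn : 0 < n) (hν : ∀ i, 0 < ν i) {u : Fin n → ℝ}
    (hu : u ∈ scale ν '' Ioo 0 1) : 0 < scaleDensity ν u := by
  rw [scaleDensity, indicator_of_mem hu]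
  exact inv_pos.2 (scaleSpeed_pos hn hν (Function.invFunOn_mem hu))

/-- An injective continuous image of a Borel set is Borel (Lusin–Souslin); the first coordinate
alone is already injective. -/
theorem measurableSet_scale_image (hn : 0 < n) (hν : ∀ i, 0 < ν i) :
    MeasurableSet (scale ν '' Ioo 0 1) := by
  refine measurableSet_Ioo.image_of_continuousOn_injOn (fun s hs => ?_) fun s hs t ht h => ?_
  · refine ContinuousAt.continuousWithinAt (continuousAt_pi.2 fun i => ?_)
    exact (continuousAt_chiSqQuantile (hν i) hs).div_const _
  · have h0 := congrFun h ⟨0, hn⟩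
    simp only [scale, div_left_inj' (hν ⟨0, hn⟩).ne'] at h0
    rw [← cdf_chiSqQuantile (hν ⟨0, hn⟩) hs, h0, cdf_chiSqQuantile (hν ⟨0, hn⟩) ht]

theorem ae_scaleLaw_pos (hν : ∀ i, 0 < ν i) : ∀ᵐ u ∂scaleLaw ν, ∀ i, 0 < u i := by
  rw [scaleLaw, ae_map_iff (measurable_scale hν).aemeasurable]
  · filter_upwards [ae_uniform01_mem_Ioo] with s hs using scale_pos hν hs
  · simp only [ofPred_forall]
    exact MeasurableSet.iInter fun i => measurableSet_lt measurable_const (measurable_pi_apply i)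

/-- All that the E-step needs of the arc-length density: the logarithm of the complete density may
be split into a sum. -/
theorem ae_scaleDensity_pos (hn : 0 < n) (hν : ∀ i, 0 < ν i) :
    ∀ᵐ u ∂scaleLaw ν, 0 < scaleDensity ν u := by
  have : ∀ᵐ u ∂scaleLaw ν, u ∈ scale ν '' Ioo 0 1 := by
    refine (ae_map_iff (p := fun u => u ∈ scale ν '' Ioo 0 1) (measurable_scale hν).aemeasurable
      (measurableSet_scale_image hn hν)).2 ?_
    filter_upwards [ae_uniform01_mem_Ioo] with s hs using ⟨s, hs, rfl⟩
  filter_upwards [this] with u hu using scaleDensity_pos hn hν hu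

theorem memLp_one_add_eval_scaleLaw (hν : ∀ i, 0 < ν i) (i : Fin n) {p : ℕ} (hp : p ≠ 0) :
    MemLp (fun u : Fin n → ℝ => 1 + u i) p (scaleLaw ν) := by
  have := isProbabilityMeasure_scaleLaw hν
  have hq : MemLp (chiSqQuantile (ν i)) p uniform01 := by
    have h := (memLp_map_measure_iff (g := fun x : ℝ => x) (p := (p : ℝ≥0∞)) (μ := uniform01)
      (f := chiSqQuantile (ν i)) measurable_id.aestronglyMeasurable
      (measurable_chiSqQuantile (hν i)).aemeasurable)
    refine h.1 ?_
    rw [map_chiSqQuantile_uniform01 (hν i)]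
    have hm : AEStronglyMeasurable (fun x : ℝ => x) (chiSq (ν i)) :=
      measurable_id.aestronglyMeasurable
    rw [← integrable_norm_rpow_iff hm (by simpa using hp) (by simp)]
    simpa using (integrable_pow_chiSq (hν i) p).norm
  have hu : MemLp (fun u : Fin n → ℝ => u i) p (scaleLaw ν) :=
    (memLp_map_measure_iff (g := fun u : Fin n → ℝ => u i)
      (measurable_pi_apply i).aestronglyMeasurable (measurable_scale hν).aemeasurable).2
      (hq.mul_const (ν i)⁻¹)
  exact (memLp_const (1 : ℝ)).add hu

/-- The coordinates are functions of one and the same uniform variable, so the expectation does not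
factor. Hölder's inequality with `|O|` factors in `L^{|O|}` replaces independence. -/
theorem integrable_prod_one_add_scaleLaw (hν : ∀ i, 0 < ν i) (O : Finset (Fin n)) :
    Integrable (fun u : Fin n → ℝ => ∏ i ∈ O, (1 + u i)) (scaleLaw ν) := by
  have := isProbabilityMeasure_scaleLaw hν
  rcases O.eq_empty_or_nonempty with rfl | hO
  · simp
  have hc : O.card ≠ 0 := hO.card_ne_zero
  have h := MemLp.prod (s := O) (p := fun _ => (O.card : ℝ≥0∞)) (μ := scaleLaw ν)
    (f := fun i u => 1 + u i) fun i _ => memLp_one_add_eval_scaleLaw hν i hc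
  rw [Finset.sum_const, nsmul_eq_mul, ENNReal.mul_inv_cancel (by simpa using hc) (by simp),
    inv_one, memLp_one_iff_integrable] at h
  refine h.congr (ae_of_all _ fun u => ?_)
  simp

end Scale

/-! ### Multivariate Gaussian laws: density, normalisation, first and second moments. -/

section Gaussian

open scoped ENNReal

variable {ι : Type*} [Fintype ι] [DecidableEq ι]

open scoped MatrixOrder ComplexOrder in
-- A root `B` of the covariance presents the Gaussian law as the image of the standard normal law
-- under `z ↦ m + B z`, from which normalisation and moments are read off.
theorem exists_mul_transpose_eq {C : Matrix ι ι ℝ} (hC : C.PosDef) :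
    ∃ B : Matrix ι ι ℝ, B * Bᵀ = C ∧ B.det ≠ 0 := by
  obtain ⟨B, hB⟩ := CStarAlgebra.nonneg_iff_eq_mul_star_self.1 hC.posSemidef.nonneg
  refine ⟨B, ?_, fun h => ?_⟩
  · rw [hB]; rfl
  · have := hC.det_pos
    rw [hB, Matrix.det_mul, h, zero_mul] at this
    exact lt_irrefl _ this

theorem gaussDensity_pos (m : ι → ℝ) {C : Matrix ι ι ℝ} (hC : C.PosDef) (y : ι → ℝ) :
    0 < gaussDensity m C y := by
  have := Real.rpow_pos_of_pos hC.det_pos (-(1 / 2))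
  unfold gaussDensity
  positivity

theorem measurable_matrix_det {X : Type*} [MeasurableSpace X] {A : X → Matrix ι ι ℝ}
    (hA : ∀ i j, Measurable fun x => A x i j) : Measurable fun x => (A x).det := by
  simp_rw [Matrix.det_apply]
  exact Finset.measurable_sum _ fun σ _ =>
    (Finset.measurable_prod _ fun i _ => hA (σ i) i).const_smul _

/-- The entries of the inverse are cofactors divided by the determinant. With the convention `0⁻¹ =
0` this also covers singular matrices, so no invertibility is required. -/
theorem measurable_matrix_inv_apply {X : Type*} [MeasurableSpace X] {A : X → Matrix ι ι ℝ}
    (hA : ∀ i j, Measurable fun x => A x i j) (i j : ι) : Measurable fun x => (A x)⁻¹ i j := by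
  simp_rw [Matrix.inv_def, Ring.inverse_eq_inv', Matrix.smul_apply, smul_eq_mul,
    Matrix.adjugate_apply]
  refine (measurable_matrix_det hA).inv.mul (measurable_matrix_det fun a b => ?_)
  simp only [Matrix.updateRow_apply]
  split_ifs
  · exact measurable_const
  · exact hA a b

theorem measurable_gaussDensity {X : Type*} [MeasurableSpace X] {m y : X → ι → ℝ}
    {C : X → Matrix ι ι ℝ} (hm : Measurable m) (hC : ∀ i j, Measurable fun x => C x i j)
    (hy : Measurable y) : Measurable fun x => gaussDensity (m x) (C x) (y x) := by
  have h1 : ∀ i, Measurable fun x => y x i := fun i => (measurable_pi_apply i).comp hy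
  have h2 : ∀ i, Measurable fun x => m x i := fun i => (measurable_pi_apply i).comp hm
  have h3 : ∀ i j, Measurable fun x => (C x)⁻¹ i j := measurable_matrix_inv_apply hC
  have hq : Measurable fun x => (y x - m x) ⬝ᵥ ((C x)⁻¹ *ᵥ (y x - m x)) := by
    simp only [dotProduct, Matrix.mulVec, Pi.sub_apply]
    exact Finset.measurable_sum _ fun i _ => ((h1 i).sub (h2 i)).mul
      (Finset.measurable_sum _ fun j _ => (h3 i j).mul ((h1 j).sub (h2 j)))
  unfold gaussDensity
  exact (((measurable_matrix_det hC).pow_const _).const_mul _).mul (hq.const_mul _).exp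

theorem measurable_gaussDensity_right (m : ι → ℝ) (C : Matrix ι ι ℝ) :
    Measurable (gaussDensity m C) :=
  measurable_gaussDensity measurable_const (fun _ _ => measurable_const) measurable_id

omit [DecidableEq ι] in
theorem measurable_add_mulVec (m : ι → ℝ) (B : Matrix ι ι ℝ) :
    Measurable fun z : ι → ℝ => m + B *ᵥ z :=
  (Continuous.matrix_mulVec continuous_const continuous_id).measurable.const_add m

omit [DecidableEq ι] in
theorem pi_gaussianReal_eq_withDensity :
    Measure.pi (fun _ : ι => gaussianReal 0 1) = volume.withDensity (fun z : ι → ℝ =>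
      ENNReal.ofReal ((2 * Real.pi) ^ (-(Fintype.card ι : ℝ) / 2) *
        Real.exp (-(1 / 2) * (z ⬝ᵥ z)))) := by
  simp_rw [gaussianReal_of_var_ne_zero 0 one_ne_zero]
  rw [pi_withDensity (fun _ => measurable_gaussianPDF 0 1) (fun _ _ => gaussianPDF_ne_top)]
  congr 1
  ext z
  simp only [gaussianPDF]
  rw [← ENNReal.ofReal_prod_of_nonneg fun i _ => gaussianPDFReal_nonneg 0 1 (z i)]
  congr 1
  simp only [gaussianPDFReal, sub_zero, NNReal.coe_one, mul_one]
  rw [Finset.prod_mul_distrib, Finset.prod_const, ← Real.exp_sum, Finset.card_univ]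
  congr 1
  · rw [Real.sqrt_eq_rpow, ← Real.rpow_neg_one, ← Real.rpow_mul (by positivity),
      ← Real.rpow_natCast, ← Real.rpow_mul (by positivity)]
    congr 1; ring
  · congr 1
    rw [dotProduct, Finset.mul_sum]
    refine Finset.sum_congr rfl fun i _ => ?_
    ring

/-- In the coordinate `z` the quadratic form becomes `z · z`, and `det (B Bᵀ) ^ (-1/2) = |det B|⁻¹`
is the Jacobian factor. -/
theorem gaussDensity_add_mulVec (m : ι → ℝ) {B : Matrix ι ι ℝ} (hB : B.det ≠ 0) (z : ι → ℝ) :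
    gaussDensity m (B * Bᵀ) (m + B *ᵥ z) = |B.det|⁻¹ *
      ((2 * Real.pi) ^ (-(Fintype.card ι : ℝ) / 2) * Real.exp (-(1 / 2) * (z ⬝ᵥ z))) := by
  have hu : IsUnit B.det := isUnit_iff_ne_zero.2 hB
  have hu' : IsUnit Bᵀ.det := by rwa [Matrix.det_transpose]
  have h1 : (B *ᵥ z) ⬝ᵥ ((B * Bᵀ)⁻¹ *ᵥ (B *ᵥ z)) = z ⬝ᵥ z := by
    rw [Matrix.mul_inv_rev, Matrix.mulVec_mulVec, Matrix.mul_assoc, Matrix.nonsing_inv_mul _ hu,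
      Matrix.mul_one, dotProduct_mulVec, ← Matrix.vecMul_transpose, Matrix.vecMul_vecMul,
      Matrix.mul_nonsing_inv _ hu', Matrix.vecMul_one]
  have h2 : (B * Bᵀ).det ^ (-(1 / 2) : ℝ) = |B.det|⁻¹ := by
    rw [Matrix.det_mul, Matrix.det_transpose, ← abs_mul_abs_self, Real.rpow_neg (by positivity),
      ← Real.sqrt_eq_rpow, Real.sqrt_mul_self (abs_nonneg _)]
  rw [gaussDensity, add_sub_cancel_left, h1, h2]
  ring

theorem map_add_mulVec_pi_gaussianReal (m : ι → ℝ) {B : Matrix ι ι ℝ} (hB : B.det ≠ 0) :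
    (Measure.pi (fun _ : ι => gaussianReal 0 1)).map (fun z => m + B *ᵥ z) =
      volume.withDensity (fun y => ENNReal.ofReal (gaussDensity m (B * Bᵀ) y)) := by
  have hBm : Measurable fun z : ι → ℝ => B *ᵥ z :=
    (Continuous.matrix_mulVec continuous_const continuous_id).measurable
  have hm := measurable_add_mulVec m B
  have hd : Measurable fun y : ι → ℝ => ENNReal.ofReal (gaussDensity m (B * Bᵀ) y) :=
    (measurable_gaussDensity_right _ _).ennreal_ofReal
  have hφ : Measurable fun z : ι → ℝ => ENNReal.ofReal
      ((2 * Real.pi) ^ (-(Fintype.card ι : ℝ) / 2) * Real.exp (-(1 / 2) * (z ⬝ᵥ z))) := by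
    refine Measurable.ennreal_ofReal ?_
    simp only [dotProduct]
    fun_prop
  -- Lebesgue measure is `|det B|` times its image under `B`; this factor cancels the `|det B|⁻¹` of
  -- the density.
  have hvol : (volume : Measure (ι → ℝ)) =
      ENNReal.ofReal |B.det| • Measure.map (fun z => B *ᵥ z) volume := by
    have := Real.map_matrix_volume_pi_eq_smul_volume_pi hB
    rw [show (fun z : ι → ℝ => B *ᵥ z) = ⇑(Matrix.toLin' B) by ext z; simp, this, smul_smul,
      ← ENNReal.ofReal_mul (abs_nonneg _), abs_inv, mul_inv_cancel₀ (abs_ne_zero.2 hB),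
      ENNReal.ofReal_one, one_smul]
  refine Measure.ext_of_lintegral _ fun g hg => ?_
  have hH : Measurable fun y : ι → ℝ => ENNReal.ofReal (gaussDensity m (B * Bᵀ) y) * g y :=
    hd.mul hg
  have hH' : Measurable fun y : ι → ℝ =>
      ENNReal.ofReal (gaussDensity m (B * Bᵀ) (m + y)) * g (m + y) :=
    hH.comp (measurable_const_add m)
  calc ∫⁻ y, g y ∂(Measure.pi (fun _ : ι => gaussianReal 0 1)).map (fun z => m + B *ᵥ z)
      = ∫⁻ z : ι → ℝ, ENNReal.ofReal ((2 * Real.pi) ^ (-(Fintype.card ι : ℝ) / 2) *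
          Real.exp (-(1 / 2) * (z ⬝ᵥ z))) * g (m + B *ᵥ z) := by
        rw [lintegral_map hg hm, pi_gaussianReal_eq_withDensity,
          lintegral_withDensity_eq_lintegral_mul _ hφ (g := fun z => g (m + B *ᵥ z)) (hg.comp hm)]
        rfl
    _ = ENNReal.ofReal |B.det| * ∫⁻ z : ι → ℝ,
          ENNReal.ofReal (gaussDensity m (B * Bᵀ) (m + B *ᵥ z)) * g (m + B *ᵥ z) := by
        rw [← lintegral_const_mul (ENNReal.ofReal |B.det|) (show Measurable fun z : ι → ℝ =>
          ENNReal.ofReal (gaussDensity m (B * Bᵀ) (m + B *ᵥ z)) * g (m + B *ᵥ z) from hH.comp hm)]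
        refine lintegral_congr fun z => ?_
        rw [gaussDensity_add_mulVec m hB, ← mul_assoc, ← ENNReal.ofReal_mul (abs_nonneg _),
          ← mul_assoc, mul_inv_cancel₀ (abs_ne_zero.2 hB), one_mul]
    _ = ∫⁻ y, ENNReal.ofReal (gaussDensity m (B * Bᵀ) (m + y)) * g (m + y) := by
        conv_rhs => rw [hvol]
        rw [lintegral_smul_measure, lintegral_map hH' hBm, smul_eq_mul]
    _ = ∫⁻ y, ENNReal.ofReal (gaussDensity m (B * Bᵀ) y) * g y :=
        lintegral_add_left_eq_self
          (fun y => ENNReal.ofReal (gaussDensity m (B * Bᵀ) y) * g y) m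
    _ = _ := by
        rw [lintegral_withDensity_eq_lintegral_mul _ hd hg]
        rfl

/-- The Gaussian distribution with mean `m` and covariance matrix `C`, defined by its density. -/
def gaussLaw (m : ι → ℝ) (C : Matrix ι ι ℝ) : Measure (ι → ℝ) :=
  volume.withDensity (fun y => ENNReal.ofReal (gaussDensity m C y))

theorem isProbabilityMeasure_gaussLaw (m : ι → ℝ) {C : Matrix ι ι ℝ} (hC : C.PosDef) :
    IsProbabilityMeasure (gaussLaw m C) := by
  obtain ⟨B, rfl, hB⟩ := exists_mul_transpose_eq hC
  rw [gaussLaw, ← map_add_mulVec_pi_gaussianReal m hB]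
  exact Measure.isProbabilityMeasure_map
    (measurable_add_mulVec m B).aemeasurable

theorem lintegral_gaussDensity (m : ι → ℝ) {C : Matrix ι ι ℝ} (hC : C.PosDef) :
    ∫⁻ y, ENNReal.ofReal (gaussDensity m C y) = 1 := by
  have := isProbabilityMeasure_gaussLaw m hC
  simpa [gaussLaw] using measure_univ (μ := gaussLaw m C)

omit [DecidableEq ι] in
theorem memLp_eval_pi_gaussianReal (i : ι) :
    MemLp (fun z : ι → ℝ => z i) 2 (Measure.pi (fun _ : ι => gaussianReal 0 1)) :=
  (memLp_id_gaussianReal' 2 (by simp)).comp_measurePreserving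
    (measurePreserving_eval (fun _ : ι => gaussianReal 0 1) i)

theorem integral_eval_mul_eval_pi_gaussianReal (i j : ι) :
    ∫ z : ι → ℝ, z i * z j ∂(Measure.pi (fun _ : ι => gaussianReal 0 1)) =
      if i = j then 1 else 0 := by
  have h0 : ∀ i, ∫ z : ι → ℝ, z i ∂(Measure.pi (fun _ : ι => gaussianReal 0 1)) = 0 := fun i => by
    rw [integral_eval (μ := fun _ : ι => gaussianReal 0 1), integral_id_gaussianReal]
  split_ifs with h
  · subst h
    rw [integral_comp_eval (μ := fun _ : ι => gaussianReal 0 1) (f := fun x : ℝ => x * x)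
      (by fun_prop)]
    have h1 := variance_fun_id_gaussianReal (μ := 0) (v := 1)
    rw [variance_of_integral_eq_zero aemeasurable_id' (by simp)] at h1
    simpa [sq] using h1
  · have hi : iIndepFun (fun (i : ι) (z : ι → ℝ) => z i)
        (Measure.pi (fun _ : ι => gaussianReal 0 1)) :=
      iIndepFun_pi (X := fun _ x => x) (μ := fun _ : ι => gaussianReal 0 1) fun _ => aemeasurable_id
    rw [(hi.indepFun h).integral_fun_mul_eq_mul_integral
      (measurable_pi_apply i).aestronglyMeasurable (measurable_pi_apply j).aestronglyMeasurable,
      h0, zero_mul]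

theorem memLp_eval_gaussLaw (m : ι → ℝ) {C : Matrix ι ι ℝ} (hC : C.PosDef) (i : ι) :
    MemLp (fun y : ι → ℝ => y i) 2 (gaussLaw m C) := by
  obtain ⟨B, rfl, hB⟩ := exists_mul_transpose_eq hC
  rw [gaussLaw, ← map_add_mulVec_pi_gaussianReal m hB,
    memLp_map_measure_iff (measurable_pi_apply i).aestronglyMeasurable
    (measurable_add_mulVec m B).aemeasurable]
  exact (memLp_const (m i)).add (memLp_finsetSum Finset.univ fun j _ =>
    (memLp_eval_pi_gaussianReal j).const_mul (B i j))

theorem integral_eval_gaussLaw (m : ι → ℝ) {C : Matrix ι ι ℝ} (hC : C.PosDef) (i : ι) :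
    ∫ y : ι → ℝ, y i ∂(gaussLaw m C) = m i := by
  obtain ⟨B, rfl, hB⟩ := exists_mul_transpose_eq hC
  have hint : ∀ j, Integrable (fun z : ι → ℝ => z j) (Measure.pi (fun _ : ι => gaussianReal 0 1)) :=
    fun j => (memLp_eval_pi_gaussianReal j).integrable one_le_two
  rw [gaussLaw, ← map_add_mulVec_pi_gaussianReal m hB, integral_map
    (measurable_add_mulVec m B).aemeasurable
    (measurable_pi_apply i).aestronglyMeasurable]
  simp only [Pi.add_apply, Matrix.mulVec, dotProduct]
  rw [integral_add (integrable_const _) (integrable_finsetSum _ fun j _ => (hint j).const_mul _),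
    integral_finsetSum _ fun j _ => (hint j).const_mul _]
  simp_rw [integral_const_mul]
  have h0 : ∀ i, ∫ z : ι → ℝ, z i ∂(Measure.pi (fun _ : ι => gaussianReal 0 1)) = 0 := fun i => by
    rw [integral_eval (μ := fun _ : ι => gaussianReal 0 1), integral_id_gaussianReal]
  simp [h0]

/-- In the expansion of `(m + B z)_i (m + B z)_j` the terms linear in `z` have mean zero, and `E[z_a
z_b] = δ_ab` leaves `(B Bᵀ)_ij`. -/
theorem integral_eval_mul_eval_gaussLaw (m : ι → ℝ) {C : Matrix ι ι ℝ} (hC : C.PosDef) (i j : ι) :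
    ∫ y : ι → ℝ, y i * y j ∂(gaussLaw m C) = m i * m j + C i j := by
  obtain ⟨B, rfl, hB⟩ := exists_mul_transpose_eq hC
  have hLp := memLp_eval_pi_gaussianReal (ι := ι)
  have hint : ∀ j, Integrable (fun z : ι → ℝ => z j) (Measure.pi (fun _ : ι => gaussianReal 0 1)) :=
    fun j => (hLp j).integrable one_le_two
  have hint2 : ∀ a b, Integrable (fun z : ι → ℝ => z a * z b)
      (Measure.pi (fun _ : ι => gaussianReal 0 1)) :=
    fun a b => (hLp a).integrable_mul (hLp b)
  have h0 : ∀ i, ∫ z : ι → ℝ, z i ∂(Measure.pi (fun _ : ι => gaussianReal 0 1)) = 0 := fun i => by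
    rw [integral_eval (μ := fun _ : ι => gaussianReal 0 1), integral_id_gaussianReal]
  rw [gaussLaw, ← map_add_mulVec_pi_gaussianReal m hB, integral_map
    (measurable_add_mulVec m B).aemeasurable
    (f := fun y : ι → ℝ => y i * y j)
    ((measurable_pi_apply i).mul (measurable_pi_apply j)).aestronglyMeasurable]
  have hexp : ∀ z : ι → ℝ, (m + B *ᵥ z) i * (m + B *ᵥ z) j = m i * m j +
      ((∑ a, m i * B j a * z a + ∑ a, m j * B i a * z a) +
        ∑ a, ∑ b, B i a * B j b * (z a * z b)) := fun z => by
    simp only [Pi.add_apply, Matrix.mulVec, dotProduct]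
    rw [add_mul, mul_add, mul_add, Finset.sum_mul_sum, Finset.mul_sum, Finset.sum_mul]
    have e1 : ∀ a, B i a * z a * m j = m j * B i a * z a := fun a => by ring
    have e2 : ∀ a, m i * (B j a * z a) = m i * B j a * z a := fun a => by ring
    have e3 : ∀ a b, B i a * z a * (B j b * z b) = B i a * B j b * (z a * z b) := fun a b => by ring
    simp_rw [e1, e2, e3]
    ring
  simp_rw [hexp]
  have i1 : ∀ c : ι → ℝ, Integrable (fun z : ι → ℝ => ∑ a, c a * z a)
      (Measure.pi (fun _ : ι => gaussianReal 0 1)) := fun c =>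
    integrable_finsetSum _ fun a _ => (hint a).const_mul _
  have i2 : ∀ a, Integrable (fun z : ι → ℝ => ∑ b, B i a * B j b * (z a * z b))
      (Measure.pi (fun _ : ι => gaussianReal 0 1)) := fun a =>
    integrable_finsetSum _ fun b _ => (hint2 a b).const_mul _
  have i3 : Integrable (fun z : ι → ℝ => ∑ a, m i * B j a * z a + ∑ a, m j * B i a * z a)
      (Measure.pi (fun _ : ι => gaussianReal 0 1)) := (i1 _).add (i1 _)
  have i4 : Integrable (fun z : ι → ℝ => ∑ a, ∑ b, B i a * B j b * (z a * z b))
      (Measure.pi (fun _ : ι => gaussianReal 0 1)) := integrable_finsetSum _ fun a _ => i2 a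
  have i5 : Integrable (fun z : ι → ℝ => (∑ a, m i * B j a * z a + ∑ a, m j * B i a * z a) +
      ∑ a, ∑ b, B i a * B j b * (z a * z b))
      (Measure.pi (fun _ : ι => gaussianReal 0 1)) := i3.add i4
  rw [integral_add (integrable_const _) i5, integral_add i3 i4,
    integral_add (i1 _) (i1 _), integral_finsetSum _ fun a _ => i2 a,
    integral_finsetSum _ fun a _ => (hint a).const_mul _,
    integral_finsetSum _ fun a _ => (hint a).const_mul _]
  simp_rw [integral_finsetSum _ fun b _ => (hint2 _ b).const_mul _, integral_const_mul, h0,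
    integral_eval_mul_eval_pi_gaussianReal]
  simp [Matrix.mul_apply]

theorem integrable_eval_gaussLaw (m : ι → ℝ) {C : Matrix ι ι ℝ} (hC : C.PosDef) (i : ι) :
    Integrable (fun y : ι → ℝ => y i) (gaussLaw m C) := by
  have := isProbabilityMeasure_gaussLaw m hC
  exact (memLp_eval_gaussLaw m hC i).integrable one_le_two

theorem integrable_eval_mul_eval_gaussLaw (m : ι → ℝ) {C : Matrix ι ι ℝ} (hC : C.PosDef) (i j : ι) :
    Integrable (fun y : ι → ℝ => y i * y j) (gaussLaw m C) :=
  (memLp_eval_gaussLaw m hC i).integrable_mul (memLp_eval_gaussLaw m hC j)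

theorem integral_gaussLaw (m : ι → ℝ) {C : Matrix ι ι ℝ} (hC : C.PosDef) (f : (ι → ℝ) → ℝ) :
    ∫ y, f y ∂(gaussLaw m C) = ∫ y, f y * gaussDensity m C y := by
  rw [gaussLaw, integral_withDensity_eq_integral_toReal_smul₀
    (measurable_gaussDensity_right _ _).ennreal_ofReal.aemeasurable
    (ae_of_all _ fun _ => ENNReal.ofReal_lt_top)]
  refine integral_congr_ae (ae_of_all _ fun y => ?_)
  simp only [ENNReal.toReal_ofReal (gaussDensity_pos m hC _).le, smul_eq_mul]
  ring

end Gaussian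

/-! ### Schur complements and conditioning of a Gaussian vector on its observed entries. -/

section Blocks

variable {d : ℕ} (O : Finset (Fin d))

open scoped MatrixOrder ComplexOrder in
theorem posDef_schur_complement {m n : Type*} [Fintype m] [Fintype n] [DecidableEq m]
    [DecidableEq n] {A : Matrix m m ℝ} {B : Matrix m n ℝ} {D : Matrix n n ℝ}
    (h : (fromBlocks A B Bᵀ D).PosDef) :
    A.PosDef ∧ (D - Bᵀ * A⁻¹ * B).PosDef ∧
      (fromBlocks A B Bᵀ D).det = A.det * (D - Bᵀ * A⁻¹ * B).det := by
  have hA : A.PosDef := h.submatrix (e := Sum.inl) Sum.inl_injective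
  have := hA.isUnit.invertible
  have hdet : (fromBlocks A B Bᵀ D).det = A.det * (D - Bᵀ * A⁻¹ * B).det := by
    rw [Matrix.det_fromBlocks₁₁, Matrix.invOf_eq_nonsing_inv]
  refine ⟨hA, ?_, hdet⟩
  -- The Schur criterion gives semidefiniteness; definiteness follows since the determinant
  -- factorisation excludes a zero determinant.
  have hs : (D - Bᵀ * A⁻¹ * B).PosSemidef := (PosDef.fromBlocks₁₁ B D hA).1 h.posSemidef
  refine hs.posDef_iff_det_ne_zero.2 fun h0 => ?_
  rw [h0, mul_zero] at hdet
  exact h.det_pos.ne' hdet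

/-- Block elimination: the linear system is solved by `z₂ = S⁻¹ t` and `z₁ = A⁻¹ (w₁ - B z₂)`, where
`S` is the Schur complement and `t` the residual of `w₂` after regression on `w₁`. -/
theorem dotProduct_inv_mulVec_fromBlocks {m n : Type*} [Fintype m] [Fintype n] [DecidableEq m]
    [DecidableEq n] {A : Matrix m m ℝ} {B : Matrix m n ℝ} {D : Matrix n n ℝ}
    (h : (fromBlocks A B Bᵀ D).PosDef) (w₁ : m → ℝ) (w₂ : n → ℝ) :
    Sum.elim w₁ w₂ ⬝ᵥ ((fromBlocks A B Bᵀ D)⁻¹ *ᵥ Sum.elim w₁ w₂) =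
      w₁ ⬝ᵥ (A⁻¹ *ᵥ w₁) + (w₂ - w₁ ᵥ* (A⁻¹ * B)) ⬝ᵥ
        ((D - Bᵀ * A⁻¹ * B)⁻¹ *ᵥ (w₂ - w₁ ᵥ* (A⁻¹ * B))) := by
  obtain ⟨hA, hS, -⟩ := posDef_schur_complement h
  have hAu : IsUnit A.det := (Matrix.isUnit_iff_isUnit_det _).1 hA.isUnit
  have hSu : IsUnit (D - Bᵀ * A⁻¹ * B).det := (Matrix.isUnit_iff_isUnit_det _).1 hS.isUnit
  have hFu : IsUnit (fromBlocks A B Bᵀ D).det := (Matrix.isUnit_iff_isUnit_det _).1 h.isUnit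
  have hAt : A⁻¹ᵀ = A⁻¹ := by
    have := hA.inv.isHermitian
    rwa [Matrix.IsHermitian, Matrix.conjTranspose_eq_transpose_of_trivial] at this
  set t := w₂ - w₁ ᵥ* (A⁻¹ * B) with ht
  have ht' : w₁ ᵥ* (A⁻¹ * B) = Bᵀ *ᵥ (A⁻¹ *ᵥ w₁) := by
    rw [← Matrix.mulVec_transpose, Matrix.transpose_mul, hAt, Matrix.mulVec_mulVec]
  set z₂ := (D - Bᵀ * A⁻¹ * B)⁻¹ *ᵥ t with hz₂
  have hz₂' : D *ᵥ z₂ = t + Bᵀ *ᵥ (A⁻¹ *ᵥ (B *ᵥ z₂)) := by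
    have : (D - Bᵀ * A⁻¹ * B) *ᵥ z₂ = t := by
      rw [hz₂, Matrix.mulVec_mulVec, Matrix.mul_nonsing_inv _ hSu, Matrix.one_mulVec]
    rw [Matrix.sub_mulVec, sub_eq_iff_eq_add] at this
    rw [this, Matrix.mulVec_mulVec z₂, Matrix.mulVec_mulVec z₂, Matrix.mul_assoc]
  have hz : (fromBlocks A B Bᵀ D)⁻¹ *ᵥ Sum.elim w₁ w₂ =
      Sum.elim (A⁻¹ *ᵥ (w₁ - B *ᵥ z₂)) z₂ := by
    have : fromBlocks A B Bᵀ D *ᵥ Sum.elim (A⁻¹ *ᵥ (w₁ - B *ᵥ z₂)) z₂ = Sum.elim w₁ w₂ := by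
      rw [Matrix.fromBlocks_mulVec]
      congr 1
      · simp only [Sum.elim_comp_inl, Sum.elim_comp_inr]
        rw [Matrix.mulVec_mulVec, Matrix.mul_nonsing_inv _ hAu, Matrix.one_mulVec,
          sub_add_cancel]
      · simp only [Sum.elim_comp_inl, Sum.elim_comp_inr]
        rw [hz₂', Matrix.mulVec_sub, Matrix.mulVec_sub, ht, ht']
        abel
    rw [← this, Matrix.mulVec_mulVec, Matrix.nonsing_inv_mul _ hFu, Matrix.one_mulVec]
  rw [hz, sumElim_dotProduct_sumElim, Matrix.mulVec_sub, dotProduct_sub]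
  have : w₁ ⬝ᵥ (A⁻¹ *ᵥ (B *ᵥ z₂)) = (w₁ ᵥ* (A⁻¹ * B)) ⬝ᵥ z₂ := by
    rw [Matrix.mulVec_mulVec, dotProduct_mulVec]
  rw [this, ht, sub_dotProduct]
  ring

variable {O} (S : Matrix (Fin d) (Fin d) ℝ) (O)

/-- The observed-observed block. -/
abbrev blockOO : Matrix {i // i ∈ O} {i // i ∈ O} ℝ := S.submatrix Subtype.val Subtype.val

/-- The observed-missing block. -/
abbrev blockOM : Matrix {i // i ∈ O} {i // i ∉ O} ℝ := S.submatrix Subtype.val Subtype.val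

/-- The missing-observed block. -/
abbrev blockMO : Matrix {i // i ∉ O} {i // i ∈ O} ℝ := S.submatrix Subtype.val Subtype.val

/-- The missing-missing block. -/
abbrev blockMM : Matrix {i // i ∉ O} {i // i ∉ O} ℝ := S.submatrix Subtype.val Subtype.val

/-- The Schur complement of the observed-observed block. -/
abbrev schurMM : Matrix {i // i ∉ O} {i // i ∉ O} ℝ :=
  blockMM O S - blockMO O S * (blockOO O S)⁻¹ * blockOM O S

variable {S O}

/-- The blocks of a symmetric matrix with respect to the observed and missing indices. -/
theorem submatrix_sumCompl_eq_fromBlocks (hS : Sᵀ = S) :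
    S.submatrix (Equiv.sumCompl (· ∈ O)) (Equiv.sumCompl (· ∈ O)) =
      fromBlocks (blockOO O S) (blockOM O S) (blockOM O S)ᵀ (blockMM O S) := by
  ext i j
  rcases i with i | i <;> rcases j with j | j <;>
    simp [Equiv.sumCompl_apply_inl, Equiv.sumCompl_apply_inr]
  rw [← congrFun (congrFun hS _) _, Matrix.transpose_apply]

theorem assemble_sub_comp_sumCompl (m : Fin d → ℝ) (yo : Obs O) (ym : Mis O) :
    (assemble O yo ym - m) ∘ Equiv.sumCompl (· ∈ O) =
      Sum.elim (yo - fun i => m i.1) (ym - fun i => m i.1) := by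
  ext i
  rcases i with i | i
  · simp [assemble]
  · simp [assemble, i.2]

theorem card_obs_add_card_mis (O : Finset (Fin d)) :
    Fintype.card {i // i ∈ O} + Fintype.card {i // i ∉ O} = d := by
  rw [← Fintype.card_sum, Fintype.card_congr (Equiv.sumCompl (· ∈ O)), Fintype.card_fin]

/-- A Gaussian density factors into the marginal density of the observed entries and the
conditional density of the missing ones. -/
theorem gaussDensity_assemble (m : Fin d → ℝ) (hS : S.PosDef) (yo : Obs O) (ym : Mis O) :
    gaussDensity m S (assemble O yo ym) =
      gaussDensity (fun i : {i // i ∈ O} => m i.1) (blockOO O S) yo *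
      gaussDensity ((fun i : {i // i ∉ O} => m i.1) +
        (yo - fun i => m i.1) ᵥ* ((blockOO O S)⁻¹ * blockOM O S)) (schurMM O S) ym := by
  have hSt : Sᵀ = S := by
    simpa [Matrix.IsHermitian, Matrix.conjTranspose_eq_transpose_of_trivial] using hS.isHermitian
  have hF := submatrix_sumCompl_eq_fromBlocks (O := O) hSt
  have hFp := hS.submatrix (e := Equiv.sumCompl (· ∈ O)) (Equiv.injective _)
  -- Determinant and quadratic form are unchanged by reindexing along observed ⊕ missing, which
  -- makes the block identities available.
  have hdet : S.det = (S.submatrix (Equiv.sumCompl (· ∈ O)) (Equiv.sumCompl (· ∈ O))).det :=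
    (Matrix.det_submatrix_equiv_self _ _).symm
  have hquad : (assemble O yo ym - m) ⬝ᵥ (S⁻¹ *ᵥ (assemble O yo ym - m)) =
      ((assemble O yo ym - m) ∘ Equiv.sumCompl (· ∈ O)) ⬝ᵥ
        ((S.submatrix (Equiv.sumCompl (· ∈ O)) (Equiv.sumCompl (· ∈ O)))⁻¹ *ᵥ
          ((assemble O yo ym - m) ∘ Equiv.sumCompl (· ∈ O))) := by
    rw [Matrix.inv_submatrix_equiv, Matrix.submatrix_mulVec_equiv, Function.comp_assoc,
      Equiv.self_comp_symm, Function.comp_id, comp_equiv_dotProduct_comp_equiv]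
  rw [hF] at hFp hdet hquad
  obtain ⟨hA, hC, hdet'⟩ := posDef_schur_complement hFp
  rw [assemble_sub_comp_sumCompl, dotProduct_inv_mulVec_fromBlocks hFp] at hquad
  have hBt : (blockOM O S)ᵀ = blockMO O S := by
    rw [Matrix.transpose_submatrix, hSt]
  rw [hBt] at hdet' hC hquad hdet
  have hd : (d : ℝ) = Fintype.card {i // i ∈ O} + Fintype.card {i // i ∉ O} := by
    exact_mod_cast (card_obs_add_card_mis O).symm
  unfold gaussDensity
  rw [hquad, hdet, hdet', Real.mul_rpow hA.det_pos.le hC.det_pos.le, Fintype.card_fin, hd,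
    mul_add, Real.exp_add, neg_add, add_div, Real.rpow_add (by positivity), sub_sub]
  ring

theorem posDef_schurMM (hS : S.PosDef) : (schurMM O S).PosDef := by
  have hSt : Sᵀ = S := by
    simpa [Matrix.IsHermitian, Matrix.conjTranspose_eq_transpose_of_trivial] using hS.isHermitian
  have hFp := hS.submatrix (e := Equiv.sumCompl (· ∈ O)) (Equiv.injective _)
  rw [submatrix_sumCompl_eq_fromBlocks (O := O) hSt] at hFp
  have := (posDef_schur_complement hFp).2.1
  rwa [Matrix.transpose_submatrix, hSt] at this

theorem posDef_blockOO (hS : S.PosDef) : (blockOO O S).PosDef :=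
  hS.submatrix Subtype.val_injective

end Blocks

/-! ### Woodbury identities and the factorisation of the joint density of `(Y, X)`. -/

section Factorisation

variable {d k : ℕ} (Ψ : Params d k) {u : Fin d → ℝ} {v : Fin k → ℝ}

theorem inv_diagonal_of_pos {ι : Type*} [Fintype ι] [DecidableEq ι] {u : ι → ℝ}
    (hu : ∀ i, 0 < u i) : (diagonal u)⁻¹ = diagonal fun i => (u i)⁻¹ := by
  refine Matrix.inv_eq_right_inv ?_
  rw [Matrix.diagonal_mul_diagonal, ← Matrix.diagonal_one]
  congr 1
  ext i
  exact mul_inv_cancel₀ (hu i).ne'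

theorem isUnit_det_diagonal {ι : Type*} [Fintype ι] [DecidableEq ι] {u : ι → ℝ}
    (hu : ∀ i, 0 < u i) : IsUnit (diagonal u).det := by
  rw [Matrix.det_diagonal]
  exact isUnit_iff_ne_zero.2 (Finset.prod_pos fun i _ => hu i).ne'

theorem posDef_matM (hσ : 0 < Ψ.σ2) (hu : ∀ i, 0 < u i) (hv : ∀ j, 0 < v j) :
    (matM Ψ u v).PosDef := by
  refine PosDef.add_posSemidef ((PosDef.diagonal hv).smul hσ) ?_
  have h := (PosSemidef.diagonal (fun i => (hu i).le : (0 : Fin d → ℝ) ≤ u)).conjTranspose_mul_mul_same Ψ.W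
  rwa [Matrix.conjTranspose_eq_transpose_of_trivial] at h

theorem isUnit_det_matM (hσ : 0 < Ψ.σ2) (hu : ∀ i, 0 < u i) (hv : ∀ j, 0 < v j) :
    IsUnit (matM Ψ u v).det :=
  (Matrix.isUnit_iff_isUnit_det _).1 (posDef_matM Ψ hσ hu hv).isUnit

theorem transpose_eq_of_posDef {ι : Type*} [Fintype ι] {A : Matrix ι ι ℝ}
    (hA : A.PosDef) : Aᵀ = A := by
  simpa [Matrix.IsHermitian, Matrix.conjTranspose_eq_transpose_of_trivial] using hA.isHermitian

/-- The covariance matrix `σ² D_ε⁻¹ + W D_x⁻¹ Wᵀ` of `Y` given the scales. -/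
def marginalCov (u : Fin d → ℝ) (v : Fin k → ℝ) : Matrix (Fin d) (Fin d) ℝ :=
  Ψ.σ2 • (diagonal u)⁻¹ + Ψ.W * (diagonal v)⁻¹ * Ψ.Wᵀ

theorem posDef_smul_inv_diagonal {ι : Type*} [Fintype ι] [DecidableEq ι] {c : ℝ} (hc : 0 < c)
    {u : ι → ℝ} (hu : ∀ i, 0 < u i) : (c • (diagonal u)⁻¹).PosDef :=
  (PosDef.diagonal hu).inv.smul hc

theorem posDef_marginalCov (hσ : 0 < Ψ.σ2) (hu : ∀ i, 0 < u i) (hv : ∀ j, 0 < v j) :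
    (marginalCov Ψ u v).PosDef := by
  refine PosDef.add_posSemidef (posDef_smul_inv_diagonal hσ hu) ?_
  have h := (PosDef.diagonal hv).inv.posSemidef.mul_mul_conjTranspose_same Ψ.W
  rwa [Matrix.conjTranspose_eq_transpose_of_trivial] at h

theorem matDN_eq : matDN Ψ u v =
    diagonal u - diagonal u * Ψ.W * (matM Ψ u v)⁻¹ * Ψ.Wᵀ * diagonal u := by
  rw [matDN, matN, Matrix.mul_sub, Matrix.mul_one]
  simp only [Matrix.mul_assoc]

/-- The substitution `Wᵀ D_ε W = M - σ² D_x`, in the form in which the Woodbury identities below use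
it. -/
theorem inv_matM_mul_mul_inv_diagonal (hσ : 0 < Ψ.σ2) (hu : ∀ i, 0 < u i) (hv : ∀ j, 0 < v j) :
    (matM Ψ u v)⁻¹ * (Ψ.Wᵀ * diagonal u * Ψ.W) * (diagonal v)⁻¹ =
      (diagonal v)⁻¹ - Ψ.σ2 • (matM Ψ u v)⁻¹ := by
  have h : Ψ.Wᵀ * diagonal u * Ψ.W = matM Ψ u v - Ψ.σ2 • diagonal v := by
    rw [matM, add_sub_cancel_left]
  rw [h, Matrix.mul_sub, Matrix.nonsing_inv_mul _ (isUnit_det_matM Ψ hσ hu hv), Matrix.sub_mul,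
    Matrix.one_mul, Matrix.mul_smul, Matrix.smul_mul, Matrix.mul_assoc,
    Matrix.mul_nonsing_inv _ (isUnit_det_diagonal hv), Matrix.mul_one]

/-- The Woodbury identity: `σ⁻² D_ε N` is the precision matrix of `Y` given the scales. -/
theorem matDN_mul_marginalCov (hσ : 0 < Ψ.σ2) (hu : ∀ i, 0 < u i) (hv : ∀ j, 0 < v j) :
    matDN Ψ u v * marginalCov Ψ u v = Ψ.σ2 • 1 := by
  have hD := Matrix.mul_nonsing_inv _ (isUnit_det_diagonal hu)
  have e : diagonal u * Ψ.W * (matM Ψ u v)⁻¹ * Ψ.Wᵀ * diagonal u *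
      (Ψ.W * (diagonal v)⁻¹ * Ψ.Wᵀ) =
      diagonal u * Ψ.W * ((matM Ψ u v)⁻¹ * (Ψ.Wᵀ * diagonal u * Ψ.W) * (diagonal v)⁻¹) * Ψ.Wᵀ := by
    simp only [Matrix.mul_assoc]
  rw [matDN_eq, marginalCov, Matrix.sub_mul, Matrix.mul_add, Matrix.mul_add, e,
    inv_matM_mul_mul_inv_diagonal Ψ hσ hu hv, Matrix.mul_smul, hD, Matrix.mul_smul,
    Matrix.mul_assoc (diagonal u * Ψ.W * (matM Ψ u v)⁻¹ * Ψ.Wᵀ), hD, Matrix.mul_one,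
    Matrix.mul_sub, Matrix.sub_mul, Matrix.mul_smul, Matrix.smul_mul]
  simp only [Matrix.mul_assoc]
  abel

theorem inv_matDN (hσ : 0 < Ψ.σ2) (hu : ∀ i, 0 < u i) (hv : ∀ j, 0 < v j) :
    (matDN Ψ u v)⁻¹ = Ψ.σ2⁻¹ • marginalCov Ψ u v := by
  refine Matrix.inv_eq_right_inv ?_
  rw [Matrix.mul_smul, matDN_mul_marginalCov Ψ hσ hu hv, smul_smul, inv_mul_cancel₀ hσ.ne',
    one_smul]

theorem inv_marginalCov (hσ : 0 < Ψ.σ2) (hu : ∀ i, 0 < u i) (hv : ∀ j, 0 < v j) :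
    (marginalCov Ψ u v)⁻¹ = Ψ.σ2⁻¹ • matDN Ψ u v := by
  refine Matrix.inv_eq_left_inv ?_
  rw [Matrix.smul_mul, matDN_mul_marginalCov Ψ hσ hu hv, smul_smul, inv_mul_cancel₀ hσ.ne',
    one_smul]

theorem covY_eq (hσ : 0 < Ψ.σ2) (hu : ∀ i, 0 < u i) (hv : ∀ j, 0 < v j) :
    covY Ψ u v = marginalCov Ψ u v := by
  rw [covY, inv_matDN Ψ hσ hu hv, smul_smul, mul_inv_cancel₀ hσ.ne', one_smul]

theorem posDef_covY (hσ : 0 < Ψ.σ2) (hu : ∀ i, 0 < u i) (hv : ∀ j, 0 < v j) :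
    (covY Ψ u v).PosDef := by
  rw [covY_eq Ψ hσ hu hv]
  exact posDef_marginalCov Ψ hσ hu hv

/-- This collapses the coefficient of `δ_x` in `μ_y` to that of the prior mean `D_x⁻¹ δ_x` carried
through `W`. -/
theorem smul_inv_matM_mul_inv_matDN (hσ : 0 < Ψ.σ2) (hu : ∀ i, 0 < u i) (hv : ∀ j, 0 < v j) :
    Ψ.σ2 • ((matM Ψ u v)⁻¹ * Ψ.Wᵀ * diagonal u * (matDN Ψ u v)⁻¹) = (diagonal v)⁻¹ * Ψ.Wᵀ := by
  have hD := Matrix.mul_nonsing_inv _ (isUnit_det_diagonal hu)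
  have e : (matM Ψ u v)⁻¹ * Ψ.Wᵀ * diagonal u * (Ψ.W * (diagonal v)⁻¹ * Ψ.Wᵀ) =
      ((matM Ψ u v)⁻¹ * (Ψ.Wᵀ * diagonal u * Ψ.W) * (diagonal v)⁻¹) * Ψ.Wᵀ := by
    simp only [Matrix.mul_assoc]
  rw [inv_matDN Ψ hσ hu hv, Matrix.mul_smul, smul_smul, mul_inv_cancel₀ hσ.ne', one_smul,
    marginalCov, Matrix.mul_add, e, inv_matM_mul_mul_inv_diagonal Ψ hσ hu hv, Matrix.mul_smul,
    Matrix.mul_assoc _ (diagonal u), hD, Matrix.mul_one, Matrix.sub_mul, Matrix.smul_mul]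
  abel

theorem meanY_eq (hσ : 0 < Ψ.σ2) (hu : ∀ i, 0 < u i) (hv : ∀ j, 0 < v j) :
    meanY Ψ u v = Ψ.μ + (diagonal u)⁻¹ *ᵥ Ψ.δε + Ψ.W *ᵥ ((diagonal v)⁻¹ *ᵥ Ψ.δx) := by
  have h1 : Ψ.δε ᵥ* (diagonal u)⁻¹ = (diagonal u)⁻¹ *ᵥ Ψ.δε := by
    rw [← Matrix.mulVec_transpose, transpose_eq_of_posDef (PosDef.diagonal hu).inv]
  have h2 : Ψ.δx ᵥ* (diagonal v)⁻¹ = (diagonal v)⁻¹ *ᵥ Ψ.δx := by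
    rw [← Matrix.mulVec_transpose, transpose_eq_of_posDef (PosDef.diagonal hv).inv]
  rw [meanY, ← Matrix.vecMul_smul, smul_inv_matM_mul_inv_matDN Ψ hσ hu hv, h1,
    ← Matrix.vecMul_vecMul, h2, Matrix.vecMul_transpose]

/-- By the preceding collapse the middle term is `D_x⁻¹ (M - σ² D_x) M⁻¹ = D_x⁻¹ - σ² M⁻¹`, so the
three terms cancel and the exponential factor of the weight is `1`. -/
theorem skewMat_eq_zero (hσ : 0 < Ψ.σ2) (hu : ∀ i, 0 < u i) (hv : ∀ j, 0 < v j) :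
    skewMat Ψ u v = 0 := by
  have e : Ψ.σ2 • ((matM Ψ u v)⁻¹ * Ψ.Wᵀ * diagonal u * (matDN Ψ u v)⁻¹ * diagonal u * Ψ.W *
      (matM Ψ u v)⁻¹) = (diagonal v)⁻¹ * (Ψ.Wᵀ * diagonal u * Ψ.W) * (matM Ψ u v)⁻¹ := by
    rw [← Matrix.smul_mul, ← Matrix.smul_mul, ← Matrix.smul_mul,
      smul_inv_matM_mul_inv_matDN Ψ hσ hu hv]
    simp only [Matrix.mul_assoc]
  have h : Ψ.Wᵀ * diagonal u * Ψ.W = matM Ψ u v - Ψ.σ2 • diagonal v := by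
    rw [matM, add_sub_cancel_left]
  rw [skewMat, e, h, Matrix.mul_sub, Matrix.mul_smul,
    Matrix.nonsing_inv_mul _ (isUnit_det_diagonal hv), Matrix.sub_mul, Matrix.mul_assoc,
    Matrix.mul_nonsing_inv _ (isUnit_det_matM Ψ hσ hu hv), Matrix.mul_one, Matrix.smul_mul,
    Matrix.one_mul]
  abel

/-- Sylvester's identity `det (1 - A B) = det (1 - B A)` moves the determinant to size `k`, where `M
- Wᵀ D_ε W = σ² D_x`. -/
theorem det_matM_mul_det_matN (hσ : 0 < Ψ.σ2) (hu : ∀ i, 0 < u i) (hv : ∀ j, 0 < v j) :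
    (matM Ψ u v).det * (matN Ψ u v).det = Ψ.σ2 ^ k * (diagonal v).det := by
  have h : Ψ.Wᵀ * diagonal u * Ψ.W = matM Ψ u v - Ψ.σ2 • diagonal v := by
    rw [matM, add_sub_cancel_left]
  rw [matN, Matrix.mul_assoc, Matrix.mul_assoc, Matrix.det_one_sub_mul_comm, ← Matrix.det_mul,
    Matrix.mul_sub, Matrix.mul_one, ← Matrix.mul_assoc, ← Matrix.mul_assoc,
    Matrix.mul_nonsing_inv _ (isUnit_det_matM Ψ hσ hu hv), Matrix.one_mul, h, sub_sub_cancel,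
    Matrix.det_smul, Fintype.card_fin]

/-- The exponential factor is `1`, and the powers of `σ²`, `det D_x`, `det M`, `det N` cancel by
Sylvester's identity. -/
theorem weight_eq_densityO (hσ : 0 < Ψ.σ2) (hu : ∀ i, 0 < u i) (hv : ∀ j, 0 < v j)
    (O : Finset (Fin d)) (yo : Obs O) : weight Ψ u v O yo = densityO Ψ u v O yo := by
  have hM := (posDef_matM Ψ hσ hu hv).det_pos
  have hX : 0 < (diagonal v).det := (PosDef.diagonal hv).det_pos
  have hd := det_matM_mul_det_matN Ψ hσ hu hv
  -- `N` need not be symmetric, so the sign of its determinant is read off from the product with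
  -- `det M`.
  have hN : 0 < (matN Ψ u v).det := by
    refine (pos_iff_pos_of_mul_pos ?_).1 hM
    rw [hd]; positivity
  have h : Ψ.σ2 ^ ((k : ℝ) / 2) * (diagonal v).det ^ (1 / 2 : ℝ) *
      (matM Ψ u v).det ^ (-(1 / 2) : ℝ) * (matN Ψ u v).det ^ (-(1 / 2) : ℝ) = 1 := by
    rw [mul_assoc, ← Real.mul_rpow hM.le hN.le, hd, show (k : ℝ) / 2 = k * (1 / 2) by ring,
      Real.rpow_mul hσ.le, Real.rpow_natCast, ← Real.mul_rpow (by positivity) hX.le,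
      ← Real.rpow_add (by positivity), add_neg_cancel, Real.rpow_zero]
  rw [weight, skewMat_eq_zero Ψ hσ hu hv, Matrix.zero_mulVec, dotProduct_zero, mul_zero,
    Real.exp_zero, one_mul]
  linear_combination densityO Ψ u v O yo * h

/-- The conditional mean `M⁻¹ (Wᵀ D_ε y + b)` of `X` given `Y = y` and the scales. -/
def postMean (u : Fin d → ℝ) (v : Fin k → ℝ) (y : Fin d → ℝ) : Fin k → ℝ :=
  (matM Ψ u v)⁻¹ *ᵥ ((Ψ.Wᵀ * diagonal u) *ᵥ y + vecB Ψ u)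

/-- Regression form of the posterior mean: prior mean plus gain times residual. It holds because `M
D_x⁻¹ δ_x = σ² δ_x + Wᵀ D_ε W D_x⁻¹ δ_x`. -/
theorem postMean_eq (hσ : 0 < Ψ.σ2) (hu : ∀ i, 0 < u i) (hv : ∀ j, 0 < v j) (y : Fin d → ℝ) :
    postMean Ψ u v y = (diagonal v)⁻¹ *ᵥ Ψ.δx +
      (matM Ψ u v)⁻¹ *ᵥ ((Ψ.Wᵀ * diagonal u) *ᵥ (y - meanY Ψ u v)) := by
  have hD := Matrix.mul_nonsing_inv _ (isUnit_det_diagonal hu)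
  have hX := Matrix.mul_nonsing_inv _ (isUnit_det_diagonal hv)
  have hMc : (diagonal v)⁻¹ *ᵥ Ψ.δx =
      (matM Ψ u v)⁻¹ *ᵥ (Ψ.σ2 • Ψ.δx + (Ψ.Wᵀ * diagonal u * Ψ.W) *ᵥ ((diagonal v)⁻¹ *ᵥ Ψ.δx)) := by
    have : Ψ.σ2 • Ψ.δx + (Ψ.Wᵀ * diagonal u * Ψ.W) *ᵥ ((diagonal v)⁻¹ *ᵥ Ψ.δx) =
        matM Ψ u v *ᵥ ((diagonal v)⁻¹ *ᵥ Ψ.δx) := by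
      rw [matM, Matrix.add_mulVec, Matrix.smul_mulVec, Matrix.mulVec_mulVec _ (diagonal v), hX,
        Matrix.one_mulVec]
    rw [this, Matrix.mulVec_mulVec, Matrix.nonsing_inv_mul _ (isUnit_det_matM Ψ hσ hu hv),
      Matrix.one_mulVec]
  rw [hMc, ← Matrix.mulVec_add, postMean, meanY_eq Ψ hσ hu hv, vecB]
  congr 1
  have h1 : Ψ.μ ᵥ* (diagonal u * Ψ.W) = (Ψ.Wᵀ * diagonal u) *ᵥ Ψ.μ := by
    rw [← Matrix.mulVec_transpose, Matrix.transpose_mul, Matrix.diagonal_transpose]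
  have h2 : Ψ.δε ᵥ* Ψ.W = (Ψ.Wᵀ * diagonal u) *ᵥ ((diagonal u)⁻¹ *ᵥ Ψ.δε) := by
    rw [Matrix.mulVec_mulVec, Matrix.mul_assoc, hD, Matrix.mul_one, Matrix.mulVec_transpose]
  rw [h1, h2, ← Matrix.mulVec_mulVec _ (Ψ.Wᵀ * diagonal u)]
  simp only [Matrix.mulVec_sub, Matrix.mulVec_add]
  abel

theorem mulVec_dotProduct_eq {m n : Type*} [Fintype m] [Fintype n] (A : Matrix m n ℝ)
    (x : n → ℝ) (y : m → ℝ) : (A *ᵥ x) ⬝ᵥ y = x ⬝ᵥ (Aᵀ *ᵥ y) := by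
  rw [← Matrix.vecMul_transpose, ← dotProduct_mulVec]

/-- Completing the square in `ξ`: the quadratic part is `M`, the linear part is `Wᵀ D_ε r`, and the
remainder in `r` is the form `D_ε N`. -/
theorem diagonal_quadratic_split (hσ : 0 < Ψ.σ2) (hu : ∀ i, 0 < u i) (hv : ∀ j, 0 < v j)
    (r : Fin d → ℝ) (ξ : Fin k → ℝ) :
    (r - Ψ.W *ᵥ ξ) ⬝ᵥ (diagonal u *ᵥ (r - Ψ.W *ᵥ ξ)) + Ψ.σ2 * (ξ ⬝ᵥ (diagonal v *ᵥ ξ)) =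
      r ⬝ᵥ (matDN Ψ u v *ᵥ r) +
      (ξ - (matM Ψ u v)⁻¹ *ᵥ ((Ψ.Wᵀ * diagonal u) *ᵥ r)) ⬝ᵥ
        (matM Ψ u v *ᵥ (ξ - (matM Ψ u v)⁻¹ *ᵥ ((Ψ.Wᵀ * diagonal u) *ᵥ r))) := by
  set h := (Ψ.Wᵀ * diagonal u) *ᵥ r with hh
  have hMt := transpose_eq_of_posDef (posDef_matM Ψ hσ hu hv)
  have hM : matM Ψ u v *ᵥ ((matM Ψ u v)⁻¹ *ᵥ h) = h := by
    rw [Matrix.mulVec_mulVec, Matrix.mul_nonsing_inv _ (isUnit_det_matM Ψ hσ hu hv),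
      Matrix.one_mulVec]
  have e1 : r ⬝ᵥ (diagonal u *ᵥ (Ψ.W *ᵥ ξ)) = ξ ⬝ᵥ h := by
    rw [hh, Matrix.mulVec_mulVec, dotProduct_mulVec, dotProduct_comm, ← Matrix.mulVec_transpose,
      Matrix.transpose_mul, Matrix.diagonal_transpose]
  have e2 : (Ψ.W *ᵥ ξ) ⬝ᵥ (diagonal u *ᵥ r) = ξ ⬝ᵥ h := by
    rw [hh, ← Matrix.mulVec_mulVec, ← Matrix.vecMul_transpose, ← dotProduct_mulVec]
  have e3 : (Ψ.W *ᵥ ξ) ⬝ᵥ (diagonal u *ᵥ (Ψ.W *ᵥ ξ)) + Ψ.σ2 * (ξ ⬝ᵥ (diagonal v *ᵥ ξ)) =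
      ξ ⬝ᵥ (matM Ψ u v *ᵥ ξ) := by
    rw [matM, Matrix.add_mulVec, dotProduct_add, Matrix.smul_mulVec, dotProduct_smul, smul_eq_mul,
      mulVec_dotProduct_eq, Matrix.mulVec_mulVec, Matrix.mulVec_mulVec]
    ring
  have e4 : ((matM Ψ u v)⁻¹ *ᵥ h) ⬝ᵥ (matM Ψ u v *ᵥ ξ) = ξ ⬝ᵥ h := by
    rw [dotProduct_mulVec, ← Matrix.mulVec_transpose, hMt, hM, dotProduct_comm]
  have e5 : r ⬝ᵥ (matDN Ψ u v *ᵥ r) = r ⬝ᵥ (diagonal u *ᵥ r) - ((matM Ψ u v)⁻¹ *ᵥ h) ⬝ᵥ h := by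
    rw [matDN_eq, Matrix.sub_mulVec, dotProduct_sub]
    congr 1
    rw [show diagonal u * Ψ.W * (matM Ψ u v)⁻¹ * Ψ.Wᵀ * diagonal u =
      (diagonal u * Ψ.W) * ((matM Ψ u v)⁻¹ * (Ψ.Wᵀ * diagonal u)) by
        simp only [Matrix.mul_assoc], ← Matrix.mulVec_mulVec, dotProduct_mulVec,
      ← Matrix.mulVec_transpose, Matrix.transpose_mul, Matrix.diagonal_transpose,
      dotProduct_comm, hh, Matrix.mulVec_mulVec _ (matM Ψ u v)⁻¹]
  simp only [Matrix.mulVec_sub, dotProduct_sub, sub_dotProduct, hM, e1, e2, e4, e5]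
  linear_combination e3

theorem dotProduct_smul_inv_inv {ι : Type*} [Fintype ι] [DecidableEq ι] {A : Matrix ι ι ℝ}
    (hA : IsUnit A.det) {c : ℝ} (hc : c ≠ 0) (w : ι → ℝ) :
    w ⬝ᵥ ((c • A⁻¹)⁻¹ *ᵥ w) = c⁻¹ * (w ⬝ᵥ (A *ᵥ w)) := by
  have : (c • A⁻¹)⁻¹ = c⁻¹ • A := by
    refine Matrix.inv_eq_right_inv ?_
    rw [Matrix.smul_mul, Matrix.mul_smul, smul_smul, mul_inv_cancel₀ hc, one_smul,
      Matrix.nonsing_inv_mul _ hA]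
  rw [this, Matrix.smul_mulVec, dotProduct_smul, smul_eq_mul]

/-- The joint Gaussian density of `(Y, X)` given the scales is the marginal density of `Y` times
the conditional density of `X` given `Y`. -/
theorem condJointDensity_eq (hσ : 0 < Ψ.σ2) (hu : ∀ i, 0 < u i) (hv : ∀ j, 0 < v j)
    (y : Fin d → ℝ) (x : Fin k → ℝ) :
    condJointDensity Ψ y x u v = gaussDensity (meanY Ψ u v) (covY Ψ u v) y *
      gaussDensity (postMean Ψ u v y) (Ψ.σ2 • (matM Ψ u v)⁻¹) x := by
  have hMp := posDef_matM Ψ hσ hu hv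
  have hD : 0 < (diagonal u).det := (PosDef.diagonal hu).det_pos
  have hX : 0 < (diagonal v).det := (PosDef.diagonal hv).det_pos
  have hS := posDef_marginalCov Ψ hσ hu hv
  have h1 : Ψ.δε ᵥ* (diagonal u)⁻¹ = (diagonal u)⁻¹ *ᵥ Ψ.δε := by
    rw [← Matrix.mulVec_transpose, transpose_eq_of_posDef (PosDef.diagonal hu).inv]
  have h2 : Ψ.δx ᵥ* (diagonal v)⁻¹ = (diagonal v)⁻¹ *ᵥ Ψ.δx := by
    rw [← Matrix.mulVec_transpose, transpose_eq_of_posDef (PosDef.diagonal hv).inv]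
  -- Eliminating `det N` between the determinants of the Woodbury and Sylvester identities.
  have hdet : (Ψ.σ2 • (diagonal u)⁻¹).det * ((diagonal v)⁻¹).det =
      (marginalCov Ψ u v).det * (Ψ.σ2 • (matM Ψ u v)⁻¹).det := by
    have a1 := congrArg Matrix.det (matDN_mul_marginalCov Ψ hσ hu hv)
    have a2 := det_matM_mul_det_matN Ψ hσ hu hv
    rw [matDN, Matrix.det_mul, Matrix.det_mul, Matrix.det_smul, Matrix.det_one, mul_one,
      Fintype.card_fin] at a1
    have hM := hMp.det_pos
    simp only [Matrix.det_smul, Matrix.det_nonsing_inv, Ring.inverse_eq_inv', Fintype.card_fin]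
    field_simp
    rw [← a1]
    linear_combination (diagonal u).det * (marginalCov Ψ u v).det * a2
  set c := (diagonal v)⁻¹ *ᵥ Ψ.δx with hc
  set r := y - meanY Ψ u v with hr
  have e1 : y - (Ψ.μ + Ψ.δε ᵥ* (diagonal u)⁻¹ + x ᵥ* Ψ.Wᵀ) = r - Ψ.W *ᵥ (x - c) := by
    rw [hr, meanY_eq Ψ hσ hu hv, h1, Matrix.vecMul_transpose, Matrix.mulVec_sub]
    abel
  have e2 : x - postMean Ψ u v y = (x - c) - (matM Ψ u v)⁻¹ *ᵥ ((Ψ.Wᵀ * diagonal u) *ᵥ r) := by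
    rw [postMean_eq Ψ hσ hu hv, sub_sub]
  have hq := diagonal_quadratic_split Ψ hσ hu hv r (x - c)
  unfold condJointDensity gaussDensity
  rw [e1, e2, h2, ← hr, covY_eq Ψ hσ hu hv, inv_marginalCov Ψ hσ hu hv,
    dotProduct_smul_inv_inv (isUnit_det_diagonal hu) hσ.ne',
    dotProduct_smul_inv_inv (isUnit_det_matM Ψ hσ hu hv) hσ.ne',
    Matrix.nonsing_inv_nonsing_inv _ (isUnit_det_diagonal hv), Matrix.smul_mulVec, dotProduct_smul,
    smul_eq_mul]
  have hdet' : (Ψ.σ2 • (diagonal u)⁻¹).det ^ (-(1 / 2) : ℝ) * ((diagonal v)⁻¹).det ^ (-(1 / 2) : ℝ) =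
      (marginalCov Ψ u v).det ^ (-(1 / 2) : ℝ) * (Ψ.σ2 • (matM Ψ u v)⁻¹).det ^ (-(1 / 2) : ℝ) := by
    rw [← Real.mul_rpow (posDef_smul_inv_diagonal hσ hu).det_pos.le
      (PosDef.diagonal hv).inv.det_pos.le, hdet,
      Real.mul_rpow hS.det_pos.le (hMp.inv.smul hσ).det_pos.le]
  have hexp : Real.exp (-(1 / 2) * (Ψ.σ2⁻¹ * ((r - Ψ.W *ᵥ (x - c)) ⬝ᵥ
        (diagonal u *ᵥ (r - Ψ.W *ᵥ (x - c)))))) *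
      Real.exp (-(1 / 2) * ((x - c) ⬝ᵥ (diagonal v *ᵥ (x - c)))) =
      Real.exp (-(1 / 2) * (Ψ.σ2⁻¹ * (r ⬝ᵥ (matDN Ψ u v *ᵥ r)))) *
      Real.exp (-(1 / 2) * (Ψ.σ2⁻¹ * ((x - c - (matM Ψ u v)⁻¹ *ᵥ ((Ψ.Wᵀ * diagonal u) *ᵥ r)) ⬝ᵥ
        (matM Ψ u v *ᵥ (x - c - (matM Ψ u v)⁻¹ *ᵥ ((Ψ.Wᵀ * diagonal u) *ᵥ r)))))) := by
    rw [← Real.exp_add, ← Real.exp_add]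
    congr 1
    have : (x - c) ⬝ᵥ (diagonal v *ᵥ (x - c)) =
        Ψ.σ2⁻¹ * (Ψ.σ2 * ((x - c) ⬝ᵥ (diagonal v *ᵥ (x - c)))) := by
      rw [← mul_assoc, inv_mul_cancel₀ hσ.ne', one_mul]
    rw [this]
    linear_combination (-(1 / 2) * Ψ.σ2⁻¹) * hq
  calc _ = (2 * Real.pi) ^ (-(Fintype.card (Fin d) : ℝ) / 2) *
        (2 * Real.pi) ^ (-(Fintype.card (Fin k) : ℝ) / 2) *
        ((Ψ.σ2 • (diagonal u)⁻¹).det ^ (-(1 / 2) : ℝ) * ((diagonal v)⁻¹).det ^ (-(1 / 2) : ℝ)) *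
        (Real.exp (-(1 / 2) * (Ψ.σ2⁻¹ * ((r - Ψ.W *ᵥ (x - c)) ⬝ᵥ
          (diagonal u *ᵥ (r - Ψ.W *ᵥ (x - c)))))) *
        Real.exp (-(1 / 2) * ((x - c) ⬝ᵥ (diagonal v *ᵥ (x - c))))) := by ring
    _ = _ := by rw [hdet', hexp]; ring

end Factorisation

/-! ### The complete-data log-density as a quadratic polynomial. -/

section LogDensity

variable {d k : ℕ} (Ψ Ψs : Params d k) {u : Fin d → ℝ} {v : Fin k → ℝ}
  (νε : Fin d → ℝ) (νx : Fin k → ℝ)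

theorem log_gaussDensity {ι : Type*} [Fintype ι] [DecidableEq ι] (m : ι → ℝ) {C : Matrix ι ι ℝ}
    (hC : C.PosDef) (y : ι → ℝ) :
    Real.log (gaussDensity m C y) = -(Fintype.card ι : ℝ) / 2 * Real.log (2 * Real.pi) -
      1 / 2 * Real.log C.det - 1 / 2 * ((y - m) ⬝ᵥ (C⁻¹ *ᵥ (y - m))) := by
  have h1 : (0 : ℝ) < (2 * Real.pi) ^ (-(Fintype.card ι : ℝ) / 2) := by positivity
  have h2 : (0 : ℝ) < C.det ^ (-(1 / 2) : ℝ) := Real.rpow_pos_of_pos hC.det_pos _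
  rw [gaussDensity, Real.log_mul (by positivity) (Real.exp_pos _).ne', Real.log_mul h1.ne' h2.ne',
    Real.log_exp, Real.log_rpow (by positivity), Real.log_rpow hC.det_pos]
  ring

theorem condJointDensity_pos (hσ : 0 < Ψ.σ2) (hu : ∀ i, 0 < u i) (hv : ∀ j, 0 < v j)
    (y : Fin d → ℝ) (x : Fin k → ℝ) : 0 < condJointDensity Ψ y x u v :=
  mul_pos (gaussDensity_pos _ (posDef_smul_inv_diagonal hσ hu) _)
    (gaussDensity_pos _ (PosDef.diagonal hv).inv _)

/-- The part of the complete-data log-likelihood that does not depend on `(y, x)`. -/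
def logConst (u : Fin d → ℝ) (v : Fin k → ℝ) : ℝ :=
  Real.log (scaleDensity νε u) + Real.log (scaleDensity νx v)
  - ((k : ℝ) + d) / 2 * Real.log (2 * Real.pi) - (d : ℝ) / 2 * Real.log Ψs.σ2
  + 1 / 2 * ∑ i, Real.log (u i) + 1 / 2 * ∑ j, Real.log (v j)
  - 1 / 2 * (Ψs.δx ⬝ᵥ ((diagonal v)⁻¹ *ᵥ Ψs.δx))
  - 1 / (2 * Ψs.σ2) * (Ψs.μ ⬝ᵥ (diagonal u *ᵥ Ψs.μ))
  - 1 / Ψs.σ2 * (Ψs.μ ⬝ᵥ Ψs.δε)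
  - 1 / (2 * Ψs.σ2) * (Ψs.δε ⬝ᵥ ((diagonal u)⁻¹ *ᵥ Ψs.δε))

theorem diagonal_mulVec_comm {ι : Type*} [Fintype ι] [DecidableEq ι] (u a b : ι → ℝ) :
    a ⬝ᵥ (diagonal u *ᵥ b) = b ⬝ᵥ (diagonal u *ᵥ a) := by
  rw [dotProduct_mulVec, ← Matrix.mulVec_transpose, Matrix.diagonal_transpose, dotProduct_comm]

theorem diagonal_square_expand {ι : Type*} [Fintype ι] [DecidableEq ι] {u : ι → ℝ}
    (hu : ∀ i, 0 < u i) (y μ δ w : ι → ℝ) :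
    (y - (μ + (diagonal u)⁻¹ *ᵥ δ + w)) ⬝ᵥ (diagonal u *ᵥ (y - (μ + (diagonal u)⁻¹ *ᵥ δ + w))) =
      y ⬝ᵥ (diagonal u *ᵥ y) - 2 * (y ⬝ᵥ (diagonal u *ᵥ μ + δ)) - 2 * (w ⬝ᵥ (diagonal u *ᵥ y))
      + 2 * (w ⬝ᵥ (diagonal u *ᵥ μ + δ)) + w ⬝ᵥ (diagonal u *ᵥ w) + μ ⬝ᵥ (diagonal u *ᵥ μ)
      + 2 * (μ ⬝ᵥ δ) + δ ⬝ᵥ ((diagonal u)⁻¹ *ᵥ δ) := by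
  have hD : diagonal u *ᵥ ((diagonal u)⁻¹ *ᵥ δ) = δ := by
    rw [Matrix.mulVec_mulVec, Matrix.mul_nonsing_inv _ (isUnit_det_diagonal hu), Matrix.one_mulVec]
  have h1 : ∀ a, ((diagonal u)⁻¹ *ᵥ δ) ⬝ᵥ (diagonal u *ᵥ a) = a ⬝ᵥ δ := fun a => by
    rw [diagonal_mulVec_comm, hD]
  simp only [Matrix.mulVec_sub, Matrix.mulVec_add, dotProduct_sub, dotProduct_add, sub_dotProduct,
    add_dotProduct, hD, h1]
  rw [diagonal_mulVec_comm u μ y, diagonal_mulVec_comm u y w, diagonal_mulVec_comm u μ w,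
    dotProduct_comm ((diagonal u)⁻¹ *ᵥ δ) δ]
  ring

/-- The complete-data log-likelihood at one time point as a quadratic polynomial in `x`. -/
theorem log_jointDensity (hσ : 0 < Ψs.σ2) (hu : ∀ i, 0 < u i) (hv : ∀ j, 0 < v j)
    (hsu : 0 < scaleDensity νε u) (hsv : 0 < scaleDensity νx v) (y : Fin d → ℝ) (x : Fin k → ℝ) :
    Real.log (jointDensity νε νx Ψs y x u v) =
      (logConst Ψs νε νx u v - 1 / (2 * Ψs.σ2) * (y ⬝ᵥ (diagonal u *ᵥ y)) +
        1 / Ψs.σ2 * (y ⬝ᵥ (diagonal u *ᵥ Ψs.μ + Ψs.δε))) +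
      ((1 / Ψs.σ2) • ((Ψs.Wᵀ * diagonal u) *ᵥ y) + vecBs Ψs u) ⬝ᵥ x +
      x ⬝ᵥ (((-(1 / 2 : ℝ)) • matGs Ψs u v) *ᵥ x) := by
  have hc1 : Ψs.δε ᵥ* (diagonal u)⁻¹ = (diagonal u)⁻¹ *ᵥ Ψs.δε := by
    rw [← Matrix.mulVec_transpose, transpose_eq_of_posDef (PosDef.diagonal hu).inv]
  have hc2 : Ψs.δx ᵥ* (diagonal v)⁻¹ = (diagonal v)⁻¹ *ᵥ Ψs.δx := by
    rw [← Matrix.mulVec_transpose, transpose_eq_of_posDef (PosDef.diagonal hv).inv]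
  have hg1 := gaussDensity_pos (Ψs.μ + Ψs.δε ᵥ* (diagonal u)⁻¹ + x ᵥ* Ψs.Wᵀ)
    (posDef_smul_inv_diagonal hσ hu) y
  have hg2 := gaussDensity_pos (Ψs.δx ᵥ* (diagonal v)⁻¹) (PosDef.diagonal hv).inv x
  have hq1 := diagonal_square_expand hu y Ψs.μ Ψs.δε (Ψs.W *ᵥ x)
  -- The prior term for `x` is the same square with zero location and no regression term.
  have hq2 := diagonal_square_expand hv x 0 Ψs.δx 0
  have hd1 : Real.log (Ψs.σ2 • (diagonal u)⁻¹).det =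
      d * Real.log Ψs.σ2 - ∑ i, Real.log (u i) := by
    rw [Matrix.det_smul, Matrix.det_nonsing_inv, Ring.inverse_eq_inv', Fintype.card_fin,
      Real.log_mul (pow_pos hσ _).ne' (inv_pos.2 (PosDef.diagonal hu).det_pos).ne', Real.log_pow,
      Real.log_inv, Matrix.det_diagonal, Real.log_prod fun i _ => (hu i).ne']
    ring
  have hd2 : Real.log ((diagonal v)⁻¹).det = - ∑ j, Real.log (v j) := by
    rw [Matrix.det_nonsing_inv, Ring.inverse_eq_inv', Real.log_inv, Matrix.det_diagonal,
      Real.log_prod fun i _ => (hv i).ne']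
  rw [jointDensity, condJointDensity, Real.log_mul (mul_pos (mul_pos hg1 hg2) hsu).ne' hsv.ne',
    Real.log_mul (mul_pos hg1 hg2).ne' hsu.ne', Real.log_mul hg1.ne' hg2.ne',
    log_gaussDensity _ (posDef_smul_inv_diagonal hσ hu),
    log_gaussDensity _ (PosDef.diagonal hv).inv, hd1, hd2,
    dotProduct_smul_inv_inv (isUnit_det_diagonal hu) hσ.ne',
    Matrix.nonsing_inv_nonsing_inv _ (isUnit_det_diagonal hv), hc1, hc2, Matrix.vecMul_transpose,
    hq1, Fintype.card_fin, Fintype.card_fin]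
  simp only [Matrix.mulVec_zero, zero_add, add_zero, zero_dotProduct, dotProduct_zero] at hq2
  rw [hq2, logConst, vecBs, matGs]
  simp only [mulVec_dotProduct_eq, dotProduct_add, add_dotProduct,
    smul_dotProduct, dotProduct_smul, Matrix.smul_mulVec, Matrix.add_mulVec, smul_eq_mul,
    Matrix.mulVec_mulVec, neg_dotProduct, sub_dotProduct, Matrix.transpose_mul,
    Matrix.transpose_transpose, Matrix.diagonal_transpose, Matrix.mul_assoc]
  have s1 : ∀ z, x ⬝ᵥ ((Ψs.Wᵀ * diagonal u) *ᵥ z) = z ⬝ᵥ ((diagonal u * Ψs.W) *ᵥ x) := fun z => by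
    rw [dotProduct_mulVec, ← Matrix.mulVec_transpose, dotProduct_comm]
    simp only [Matrix.transpose_mul, Matrix.transpose_transpose, Matrix.diagonal_transpose]
  have s2 : x ⬝ᵥ (Ψs.Wᵀ *ᵥ Ψs.δε) = Ψs.δε ⬝ᵥ (Ψs.W *ᵥ x) := by
    rw [dotProduct_comm, mulVec_dotProduct_eq, Matrix.transpose_transpose]
  have s3 : x ⬝ᵥ Ψs.δx = Ψs.δx ⬝ᵥ x := dotProduct_comm _ _
  rw [s1, s1, s2, s3]
  field_simp
  ring

end LogDensity

/-! ### Gaussian expectations of quadratic polynomials. -/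

section Moments

/-- The expectation of a quadratic polynomial depends only on the first two moments. -/
theorem integral_quadratic {ι Ω : Type*} [Fintype ι] [MeasurableSpace Ω] (ρ : Measure Ω)
    [IsProbabilityMeasure ρ] {Y : Ω → ι → ℝ} {e : ι → ℝ} {E : Matrix ι ι ℝ}
    (hY : ∀ i, Integrable (fun ω => Y ω i) ρ) (hYY : ∀ i j, Integrable (fun ω => Y ω i * Y ω j) ρ)
    (he : ∀ i, ∫ ω, Y ω i ∂ρ = e i) (hE : ∀ i j, ∫ ω, Y ω i * Y ω j ∂ρ = E i j)
    (c : ℝ) (h : ι → ℝ) (A : Matrix ι ι ℝ) :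
    ∫ ω, (c + h ⬝ᵥ Y ω + Y ω ⬝ᵥ (A *ᵥ Y ω)) ∂ρ = c + h ⬝ᵥ e + trace (Aᵀ * E) := by
  have hexp : ∀ y : ι → ℝ, y ⬝ᵥ (A *ᵥ y) = ∑ i, ∑ j, A i j * (y i * y j) := fun y => by
    simp only [dotProduct, Matrix.mulVec, Finset.mul_sum]
    exact Finset.sum_congr rfl fun i _ => Finset.sum_congr rfl fun j _ => by ring
  simp_rw [hexp]
  simp only [dotProduct]
  have j1 : Integrable (fun ω => ∑ i, h i * Y ω i) ρ :=
    integrable_finsetSum _ fun i _ => (hY i).const_mul _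
  have j2 : ∀ i, Integrable (fun ω => ∑ j, A i j * (Y ω i * Y ω j)) ρ := fun i =>
    integrable_finsetSum _ fun j _ => (hYY i j).const_mul _
  have j0 : Integrable (fun ω => c + ∑ i, h i * Y ω i) ρ := (integrable_const c).add j1
  rw [integral_add j0 (integrable_finsetSum _ fun i _ => j2 i), integral_add (integrable_const c) j1,
    integral_finsetSum _ fun i _ => (hY i).const_mul _, integral_finsetSum _ fun i _ => j2 i]
  simp_rw [integral_finsetSum _ fun j _ => (hYY _ j).const_mul _, integral_const_mul, he, hE]
  simp only [integral_const, probReal_univ, smul_eq_mul, one_mul, trace, diag, Matrix.mul_apply,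
    Matrix.transpose_apply]
  rw [Finset.sum_comm]

theorem integral_quadratic_gaussLaw {ι : Type*} [Fintype ι] [DecidableEq ι] (m : ι → ℝ)
    {C : Matrix ι ι ℝ} (hC : C.PosDef) (c : ℝ) (h : ι → ℝ) (A : Matrix ι ι ℝ) :
    ∫ y, (c + h ⬝ᵥ y + y ⬝ᵥ (A *ᵥ y)) ∂(gaussLaw m C) =
      c + h ⬝ᵥ m + trace (Aᵀ * (vecMulVec m m + C)) := by
  have := isProbabilityMeasure_gaussLaw m hC
  exact integral_quadratic (gaussLaw m C) (integrable_eval_gaussLaw m hC)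
    (integrable_eval_mul_eval_gaussLaw m hC) (integral_eval_gaussLaw m hC)
    (fun i j => by rw [integral_eval_mul_eval_gaussLaw m hC]; rfl) c h A

variable {d : ℕ} {O : Finset (Fin d)}

/-- Observed entries are constants under the law of `y^m`; the covariance therefore enters only the
missing-missing block of the second moment. -/
theorem integral_quadratic_assemble (yo : Obs O) (m : Mis O) {C : Matrix {i // i ∉ O} {i // i ∉ O} ℝ}
    (hC : C.PosDef) (c : ℝ) (h : Fin d → ℝ) (A : Matrix (Fin d) (Fin d) ℝ) :
    ∫ ym, (c + h ⬝ᵥ assemble O yo ym + assemble O yo ym ⬝ᵥ (A *ᵥ assemble O yo ym)) ∂(gaussLaw m C) =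
      c + h ⬝ᵥ assemble O yo m + trace (Aᵀ * (Matrix.of (fun i j =>
        if h : i ∉ O ∧ j ∉ O then C ⟨i, h.1⟩ ⟨j, h.2⟩ else 0) +
          vecMulVec (assemble O yo m) (assemble O yo m))) := by
  have := isProbabilityMeasure_gaussLaw m hC
  have hi := integrable_eval_gaussLaw m hC
  refine integral_quadratic (gaussLaw m C) (fun i => ?_) (fun i j => ?_) (fun i => ?_)
    (fun i j => ?_) c h A
  · by_cases hO : i ∈ O
    · simp [assemble, hO]
    · simpa [assemble, hO] using hi ⟨i, hO⟩
  · by_cases hO : i ∈ O <;> by_cases hO' : j ∈ O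
    · simpa [assemble, hO, hO'] using integrable_const _
    · simpa [assemble, hO, hO'] using (hi ⟨j, hO'⟩).const_mul (yo ⟨i, hO⟩)
    · simpa [assemble, hO, hO'] using (hi ⟨i, hO⟩).mul_const (yo ⟨j, hO'⟩)
    · simpa [assemble, hO, hO'] using integrable_eval_mul_eval_gaussLaw m hC ⟨i, hO⟩ ⟨j, hO'⟩
  · by_cases hO : i ∈ O
    · simp [assemble, hO]
    · simpa [assemble, hO] using integral_eval_gaussLaw m hC ⟨i, hO⟩
  · by_cases hO : i ∈ O <;> by_cases hO' : j ∈ O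
    · simp [assemble, hO, hO', vecMulVec_apply]
    · simp [assemble, hO, hO', vecMulVec_apply, integral_const_mul, integral_eval_gaussLaw m hC]
    · simp [assemble, hO, hO', vecMulVec_apply, integral_mul_const, integral_eval_gaussLaw m hC]
    · simp [assemble, hO, hO', vecMulVec_apply, integral_eval_mul_eval_gaussLaw m hC]
      exact add_comm _ _

end Moments

/-! ### Integrating out `x` and `y^m` at fixed scales. -/

section EStep

variable {d k : ℕ} (Ψ Ψs : Params d k) {u : Fin d → ℝ} {v : Fin k → ℝ}
  (νε : Fin d → ℝ) (νx : Fin k → ℝ)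

theorem trace_transpose_mul_vecMulVec {ι : Type*} [Fintype ι] (A : Matrix ι ι ℝ) (x : ι → ℝ) :
    trace (Aᵀ * vecMulVec x x) = x ⬝ᵥ (A *ᵥ x) := by
  rw [Matrix.mul_vecMulVec, trace_vecMulVec, mulVec_dotProduct_eq, Matrix.transpose_transpose]

theorem transpose_matGs : (matGs Ψs u v)ᵀ = matGs Ψs u v := by
  simp only [matGs, Matrix.transpose_add, Matrix.transpose_smul, Matrix.transpose_mul,
    Matrix.transpose_transpose, Matrix.diagonal_transpose, Matrix.mul_assoc]

/-- The conditional expectation of the log-likelihood given `y, u, v`, a quadratic polynomial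
in `y`. -/
theorem integral_log_jointDensity_mul_gaussDensity (hσ : 0 < Ψ.σ2) (hσs : 0 < Ψs.σ2)
    (hu : ∀ i, 0 < u i) (hv : ∀ j, 0 < v j)
    (hsu : 0 < scaleDensity νε u) (hsv : 0 < scaleDensity νx v) (y : Fin d → ℝ) :
    ∫ x, Real.log (jointDensity νε νx Ψs y x u v) *
        gaussDensity (postMean Ψ u v y) (Ψ.σ2 • (matM Ψ u v)⁻¹) x =
      (logConst Ψs νε νx u v + ((matM Ψ u v)⁻¹ *ᵥ vecB Ψ u) ⬝ᵥ vecBs Ψs u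
        - 1 / 2 * (((matM Ψ u v)⁻¹ *ᵥ vecB Ψ u) ⬝ᵥ
          (matGs Ψs u v *ᵥ ((matM Ψ u v)⁻¹ *ᵥ vecB Ψ u)))
        - Ψ.σ2 / 2 * trace ((matM Ψ u v)⁻¹ * matGs Ψs u v)) +
      ((1 / Ψs.σ2) • (diagonal u *ᵥ Ψs.μ + Ψs.δε) +
        (1 / Ψs.σ2) • ((diagonal u * Ψs.W) *ᵥ ((matM Ψ u v)⁻¹ *ᵥ vecB Ψ u)) +
        (diagonal u * Ψ.W * (matM Ψ u v)⁻¹) *ᵥ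
          (vecBs Ψs u - matGs Ψs u v *ᵥ ((matM Ψ u v)⁻¹ *ᵥ vecB Ψ u))) ⬝ᵥ y +
      y ⬝ᵥ ((-(1 / (2 * Ψs.σ2)) • diagonal u +
        (1 / Ψs.σ2) • (diagonal u * Ψs.W * (matM Ψ u v)⁻¹ * Ψ.Wᵀ * diagonal u) -
        (1 / 2 : ℝ) • (diagonal u * Ψ.W * (matM Ψ u v)⁻¹ * matGs Ψs u v * (matM Ψ u v)⁻¹ *
          Ψ.Wᵀ * diagonal u)) *ᵥ y) := by
  have hM := posDef_matM Ψ hσ hu hv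
  have hKt : ((matM Ψ u v)⁻¹)ᵀ = (matM Ψ u v)⁻¹ := transpose_eq_of_posDef hM.inv
  have hG := transpose_matGs Ψs (u := u) (v := v)
  rw [← integral_gaussLaw _ (hM.inv.smul hσ)]
  simp_rw [log_jointDensity Ψs νε νx hσs hu hv hsu hsv]
  -- The second moment of `x` splits into the square of `postMean`, quadratic in `y`, and the
  -- covariance `σ² M⁻¹`, which contributes the constant `-σ²/2 tr (M⁻¹ G*)`.
  rw [integral_quadratic_gaussLaw _ (hM.inv.smul hσ), Matrix.mul_add, trace_add,
    trace_transpose_mul_vecMulVec, Matrix.transpose_smul, hG, Matrix.smul_mul, Matrix.mul_smul,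
    trace_smul, trace_smul, trace_mul_comm (matGs Ψs u v), postMean, Matrix.mulVec_add]
  set K := (matM Ψ u v)⁻¹
  set β := K *ᵥ vecB Ψ u
  set G := matGs Ψs u v
  set b := vecBs Ψs u
  set D := diagonal u with hD
  have hDt : Dᵀ = D := Matrix.diagonal_transpose _
  have e1 : ∀ (A : Matrix (Fin d) (Fin k) ℝ) (z : Fin k → ℝ), (A *ᵥ z) ⬝ᵥ y = z ⬝ᵥ (Aᵀ *ᵥ y) :=
    fun A z => mulVec_dotProduct_eq _ _ _
  have e2 : ∀ z w : Fin k → ℝ, (G *ᵥ z) ⬝ᵥ w = z ⬝ᵥ (G *ᵥ w) := fun z w => by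
    rw [mulVec_dotProduct_eq, hG]
  have e3 : ∀ (A : Matrix (Fin k) (Fin d) ℝ) (z : Fin k → ℝ), (A *ᵥ y) ⬝ᵥ z = z ⬝ᵥ (A *ᵥ y) :=
    fun A z => dotProduct_comm _ _
  have e4 : ∀ A : Matrix (Fin d) (Fin k) ℝ, ∀ B : Matrix (Fin k) (Fin d) ℝ,
      y ⬝ᵥ ((A * B) *ᵥ y) = (Aᵀ *ᵥ y) ⬝ᵥ (B *ᵥ y) := fun A B => by
    rw [← Matrix.mulVec_mulVec, mulVec_dotProduct_eq, Matrix.transpose_transpose]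
  have f1 : y ⬝ᵥ ((D * Ψs.W * K * Ψ.Wᵀ * D) *ᵥ y) =
      ((Ψs.Wᵀ * D) *ᵥ y) ⬝ᵥ (K *ᵥ ((Ψ.Wᵀ * D) *ᵥ y)) := by
    rw [show D * Ψs.W * K * Ψ.Wᵀ * D = (D * Ψs.W) * (K * (Ψ.Wᵀ * D)) by
      simp only [Matrix.mul_assoc], e4, Matrix.mulVec_mulVec, Matrix.transpose_mul, hDt]
  have f2 : y ⬝ᵥ ((D * Ψ.W * K * G * K * Ψ.Wᵀ * D) *ᵥ y) =
      (K *ᵥ ((Ψ.Wᵀ * D) *ᵥ y)) ⬝ᵥ (G *ᵥ (K *ᵥ ((Ψ.Wᵀ * D) *ᵥ y))) := by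
    rw [show D * Ψ.W * K * G * K * Ψ.Wᵀ * D = (D * Ψ.W * K) * (G * (K * (Ψ.Wᵀ * D))) by
      simp only [Matrix.mul_assoc], e4]
    simp only [Matrix.mulVec_mulVec, Matrix.transpose_mul, hDt, hKt]
  have f3 : ((D * Ψs.W) *ᵥ β) ⬝ᵥ y = ((Ψs.Wᵀ * D) *ᵥ y) ⬝ᵥ β := by
    rw [e1, Matrix.transpose_mul, hDt, dotProduct_comm]
  have f4 : ∀ z, ((D * Ψ.W * K) *ᵥ z) ⬝ᵥ y = (K *ᵥ ((Ψ.Wᵀ * D) *ᵥ y)) ⬝ᵥ z := fun z => by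
    rw [e1, dotProduct_comm]
    simp only [Matrix.mulVec_mulVec, Matrix.transpose_mul, hDt, hKt]
  simp only [Matrix.add_mulVec, Matrix.sub_mulVec, Matrix.smul_mulVec, add_dotProduct,
    dotProduct_add, dotProduct_sub, smul_dotProduct, dotProduct_smul, f1, f2, f3, f4,
    smul_eq_mul, Matrix.mulVec_add]
  rw [← e2 β, dotProduct_comm (G *ᵥ β) (K *ᵥ _), dotProduct_comm b, dotProduct_comm b,
    dotProduct_comm y (D *ᵥ Ψs.μ), dotProduct_comm y Ψs.δε, ← e2 β β, dotProduct_comm (G *ᵥ β) β]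
  ring

theorem gaussDensity_meanY_covY_assemble (hσ : 0 < Ψ.σ2) (hu : ∀ i, 0 < u i) (hv : ∀ j, 0 < v j)
    (O : Finset (Fin d)) (yo : Obs O) (ym : Mis O) :
    gaussDensity (meanY Ψ u v) (covY Ψ u v) (assemble O yo ym) =
      densityO Ψ u v O yo * gaussDensity (condMeanM Ψ u v O yo) (condCovM Ψ u v O) ym :=
  gaussDensity_assemble _ (posDef_covY Ψ hσ hu hv) yo ym

theorem posDef_condCovM (hσ : 0 < Ψ.σ2) (hu : ∀ i, 0 < u i) (hv : ∀ j, 0 < v j)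
    (O : Finset (Fin d)) : (condCovM Ψ u v O).PosDef :=
  posDef_schurMM (posDef_covY Ψ hσ hu hv)

/-- The density of `Y^o` given `u, v` is obtained by integrating out `y^m` and `x`. -/
theorem lintegral_lintegral_condJointDensity (hσ : 0 < Ψ.σ2) (hu : ∀ i, 0 < u i)
    (hv : ∀ j, 0 < v j) (O : Finset (Fin d)) (yo : Obs O) :
    ∫⁻ ym, ∫⁻ x, ENNReal.ofReal (condJointDensity Ψ (assemble O yo ym) x u v) =
      ENNReal.ofReal (densityO Ψ u v O yo) := by
  have hd : 0 ≤ densityO Ψ u v O yo :=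
    (gaussDensity_pos _ (posDef_blockOO (posDef_covY Ψ hσ hu hv)) _).le
  have hg : ∀ y, 0 ≤ gaussDensity (meanY Ψ u v) (covY Ψ u v) y := fun y =>
    (gaussDensity_pos _ (posDef_covY Ψ hσ hu hv) _).le
  simp_rw [condJointDensity_eq Ψ hσ hu hv, ENNReal.ofReal_mul (hg _)]
  simp_rw [lintegral_const_mul' _ _ ENNReal.ofReal_ne_top,
    lintegral_gaussDensity _ ((posDef_matM Ψ hσ hu hv).inv.smul hσ), mul_one,
    gaussDensity_meanY_covY_assemble Ψ hσ hu hv, ENNReal.ofReal_mul hd]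
  rw [lintegral_const_mul' _ _ ENNReal.ofReal_ne_top,
    lintegral_gaussDensity _ (posDef_condCovM Ψ hσ hu hv O), mul_one]

/-- Integrating out `y^m` and `x` turns the log-likelihood into `v(y^o, u, v)`. -/
theorem integral_integral_log_jointDensity (hσ : 0 < Ψ.σ2) (hσs : 0 < Ψs.σ2)
    (hu : ∀ i, 0 < u i) (hv : ∀ j, 0 < v j)
    (hsu : 0 < scaleDensity νε u) (hsv : 0 < scaleDensity νx v) (O : Finset (Fin d)) (yo : Obs O) :
    ∫ ym, ∫ x, Real.log (jointDensity νε νx Ψs (assemble O yo ym) x u v) *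
        condJointDensity Ψ (assemble O yo ym) x u v =
      fnV Ψ Ψs u v O νε νx yo * densityO Ψ u v O yo := by
  have hM := posDef_matM Ψ hσ hu hv
  have hKt : ((matM Ψ u v)⁻¹)ᵀ = (matM Ψ u v)⁻¹ := transpose_eq_of_posDef hM.inv
  have hG := transpose_matGs Ψs (u := u) (v := v)
  -- The factorisation pulls the `y`-density out of the `x`-integral; what remains is a quadratic
  -- polynomial in `y`, weighted by the density of `y^o` and the conditional density of `y^m`.
  simp_rw [condJointDensity_eq Ψ hσ hu hv, mul_left_comm (Real.log _), integral_const_mul,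
    integral_log_jointDensity_mul_gaussDensity Ψ Ψs νε νx hσ hσs hu hv hsu hsv,
    gaussDensity_meanY_covY_assemble Ψ hσ hu hv, mul_assoc, integral_const_mul]
  rw [mul_comm (fnV _ _ _ _ _ _ _ _)]
  congr 1
  simp_rw [mul_comm (gaussDensity _ _ _)]
  rw [← integral_gaussLaw _ (posDef_condCovM Ψ hσ hu hv O),
    integral_quadratic_assemble yo _ (posDef_condCovM Ψ hσ hu hv O)]
  have hE : Matrix.of (fun i j =>
        if h : i ∉ O ∧ j ∉ O then condCovM Ψ u v O ⟨i, h.1⟩ ⟨j, h.2⟩ else 0) +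
          vecMulVec (assemble O yo (condMeanM Ψ u v O yo)) (assemble O yo (condMeanM Ψ u v O yo)) =
      expYY Ψ u v O yo := rfl
  rw [hE, show assemble O yo (condMeanM Ψ u v O yo) = expY Ψ u v O yo from rfl, fnV, logConst]
  set K := (matM Ψ u v)⁻¹
  set β := K *ᵥ vecB Ψ u with hβ
  set G := matGs Ψs u v
  set b := vecBs Ψs u
  set D := diagonal u with hD
  set E := expYY Ψ u v O yo
  set e := expY Ψ u v O yo
  have hDt : Dᵀ = D := Matrix.diagonal_transpose _
  -- Cyclicity of the trace and symmetry of `D`, `K`, `G` bring the terms of `fnV` to the shape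
  -- produced by the moment formula.
  have t1 : trace (E * D * Ψ.W * K * Ψs.Wᵀ * D) = trace (D * (Ψ.W * (K * (Ψs.Wᵀ * (D * E))))) := by
    rw [show E * D * Ψ.W * K * Ψs.Wᵀ * D = E * (D * (Ψ.W * (K * (Ψs.Wᵀ * D)))) by
      simp only [Matrix.mul_assoc], trace_mul_comm]
    simp only [Matrix.mul_assoc]
  have t2 : trace (K * Ψ.Wᵀ * D * E * D * Ψ.W * K * G) =
      trace (D * (Ψ.W * (K * (G * (K * (Ψ.Wᵀ * (D * E))))))) := by
    rw [show K * Ψ.Wᵀ * D * E * D * Ψ.W * K * G = (K * Ψ.Wᵀ * D * E) * (D * Ψ.W * K * G) by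
      simp only [Matrix.mul_assoc], trace_mul_comm]
    simp only [Matrix.mul_assoc]
  have t3 : trace (K * vecMulVec (vecB Ψ u) (vecB Ψ u) * K * G) = β ⬝ᵥ (G *ᵥ β) := by
    rw [Matrix.mul_vecMulVec, Matrix.vecMulVec_mul, Matrix.vecMulVec_mul, trace_vecMulVec,
      ← Matrix.mulVec_transpose K, hKt, ← Matrix.mulVec_transpose, hG]
  have t4 : trace (K * Ψ.Wᵀ * D * vecMulVec e (vecB Ψ u) * K * G) =
      ((D * Ψ.W * K) *ᵥ (G *ᵥ β)) ⬝ᵥ e := by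
    rw [Matrix.mul_vecMulVec, Matrix.vecMulVec_mul, Matrix.vecMulVec_mul, trace_vecMulVec,
      ← Matrix.mulVec_transpose K, hKt, ← Matrix.mulVec_transpose G, hG, mulVec_dotProduct_eq,
      mulVec_dotProduct_eq (D * Ψ.W * K), dotProduct_comm]
    simp only [Matrix.transpose_mul, Matrix.transpose_transpose, hKt, hDt, Matrix.mul_assoc,
      mulVec_dotProduct_eq, Matrix.mulVec_mulVec, hβ]
  have t5 : vecB Ψ u ⬝ᵥ ((K * Ψs.Wᵀ * D) *ᵥ e) = ((D * Ψs.W) *ᵥ β) ⬝ᵥ e := by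
    simp only [Matrix.transpose_mul, hKt, hDt, Matrix.mul_assoc,
      mulVec_dotProduct_eq, Matrix.mulVec_mulVec, hβ]
  have t6 : vecB Ψ u ⬝ᵥ (K *ᵥ b) = β ⬝ᵥ b := by
    rw [hβ, mulVec_dotProduct_eq, hKt]
  rw [t1, t2, t3, t4, t5, t6, dotProduct_comm e (_ *ᵥ b), dotProduct_comm e (_ + _),
    trace_mul_comm E D]
  simp only [Matrix.transpose_add, Matrix.transpose_sub, Matrix.transpose_smul,
    Matrix.transpose_mul, Matrix.transpose_transpose, hDt, hKt, hG, Matrix.add_mul, Matrix.sub_mul,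
    Matrix.smul_mul, trace_add, trace_sub, trace_smul, Matrix.mul_assoc, Matrix.mulVec_sub,
    add_dotProduct, sub_dotProduct, smul_dotProduct, smul_eq_mul]
  ring

end EStep

/-! ### One time point: Fubini, integrability and positivity. -/

instance {n : ℕ} (ν : Fin n → ℝ) : IsFiniteMeasure (scaleLaw ν) := by
  unfold scaleLaw
  infer_instance

section

variable {α β γ : Type*} [MeasurableSpace α] [MeasurableSpace β] [MeasurableSpace γ]

/-- Tonelli with the last variable outermost, so that the Gaussian integrals are computed at fixed
scales. -/
theorem lintegral_prod_prod (μ : Measure α) (ν : Measure β) (ρ : Measure γ) [SFinite μ] [SFinite ν]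
    [SFinite ρ] {F : α × β × γ → ENNReal} (hF : Measurable F) :
    ∫⁻ h, F h ∂μ.prod (ν.prod ρ) = ∫⁻ w, ∫⁻ a, ∫⁻ b, F (a, b, w) ∂ν ∂μ ∂ρ := by
  have h := (measurePreserving_prodAssoc μ ν ρ).lintegral_comp hF
  rw [← h, lintegral_prod_symm (fun a => F (MeasurableEquiv.prodAssoc a))
    (hF.comp MeasurableEquiv.prodAssoc.measurable).aemeasurable]
  refine lintegral_congr fun w => ?_
  rw [lintegral_prod (fun z => F (MeasurableEquiv.prodAssoc (z, w)))
    ((hF.comp MeasurableEquiv.prodAssoc.measurable).comp measurable_prodMk_right).aemeasurable]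
  rfl

end

section OneTime

variable {d k : ℕ} (νε : Fin d → ℝ) (νx : Fin k → ℝ) (Ψ Ψs : Params d k) (O : Finset (Fin d))

/-- The measure `dy^m dx π(du) π(dv)` at one time point. -/
def timeRef : Measure (Hidden k O) :=
  (volume : Measure (Mis O)).prod
    ((volume : Measure (Fin k → ℝ)).prod ((scaleLaw νε).prod (scaleLaw νx)))

instance : SigmaFinite
    ((volume : Measure (Fin k → ℝ)).prod ((scaleLaw νε).prod (scaleLaw νx))) :=
  Measure.prod.instSigmaFinite

instance : SigmaFinite (timeRef νε νx O) :=
  Measure.prod.instSigmaFinite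

/-- `π(y | x, u, v, Ψ) π(x | u, v, Ψ)` as a function of the hidden data. -/
def timeLik (yo : Obs O) (h : Hidden k O) : ℝ :=
  condJointDensity Ψ (assemble O yo h.1) h.2.1 h.2.2.1 h.2.2.2

theorem measurable_assemble : Measurable fun p : Obs O × Mis O => assemble O p.1 p.2 := by
  refine measurable_pi_lambda _ fun i => ?_
  by_cases hi : i ∈ O
  · simp only [assemble, hi, dite_true]
    exact (measurable_pi_apply _).comp measurable_fst
  · simp only [assemble, hi, dite_false]
    exact (measurable_pi_apply _).comp measurable_snd

theorem measurable_inv_diagonal_apply {X ι : Type*} [Fintype ι] [DecidableEq ι] [MeasurableSpace X]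
    {f : X → ι → ℝ} (hf : Measurable f) (i j : ι) :
    Measurable fun x => (diagonal (f x))⁻¹ i j := by
  refine measurable_matrix_inv_apply (fun a b => ?_) i j
  by_cases hab : a = b
  · subst hab
    simp only [Matrix.diagonal_apply_eq]
    exact (measurable_pi_apply a).comp hf
  · simp [Matrix.diagonal_apply_ne _ hab]

theorem measurable_vecMul {X m n : Type*} [Fintype m] [Fintype n] [MeasurableSpace X]
    {f : X → m → ℝ} (hf : Measurable f) {A : X → Matrix m n ℝ}
    (hA : ∀ i j, Measurable fun x => A x i j) : Measurable fun x => f x ᵥ* A x := by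
  refine measurable_pi_lambda _ fun j => ?_
  simp only [Matrix.vecMul, dotProduct]
  exact Finset.measurable_sum _ fun i _ => ((measurable_pi_apply i).comp hf).mul (hA i j)

theorem measurable_condJointDensity {X : Type*} [MeasurableSpace X] {y u : X → Fin d → ℝ}
    {x v : X → Fin k → ℝ} (hy : Measurable y) (hx : Measurable x) (hu : Measurable u)
    (hv : Measurable v) : Measurable fun a => condJointDensity Ψ (y a) (x a) (u a) (v a) := by
  refine (measurable_gaussDensity ?_ (fun i j => ?_) hy).mul (measurable_gaussDensity ?_ ?_ hx)
  · exact ((measurable_vecMul measurable_const (measurable_inv_diagonal_apply hu)).const_add _).add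
      (measurable_vecMul hx fun _ _ => measurable_const)
  · exact (measurable_inv_diagonal_apply hu i j).const_mul _
  · exact measurable_vecMul measurable_const (measurable_inv_diagonal_apply hv)
  · exact measurable_inv_diagonal_apply hv

theorem measurable_timeLik_prod :
    Measurable fun p : Obs O × Hidden k O => timeLik Ψ O p.1 p.2 := by
  have h2 : Measurable fun p : Obs O × Hidden k O => p.2 := measurable_snd
  have h3 : Measurable fun p : Obs O × Hidden k O => p.2.2 := measurable_snd.comp h2
  have h4 : Measurable fun p : Obs O × Hidden k O => p.2.2.2 := measurable_snd.comp h3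
  have h1 : Measurable fun p : Obs O × Hidden k O => (p.1, p.2.1) :=
    measurable_fst.prodMk (measurable_fst.comp h2)
  exact measurable_condJointDensity Ψ ((measurable_assemble O).comp h1) (measurable_fst.comp h3)
    (measurable_fst.comp h4) (measurable_snd.comp h4)

theorem measurable_timeLik (yo : Obs O) : Measurable (timeLik Ψ O yo) := by
  have h := measurable_timeLik_prod Ψ O
  exact h.of_uncurry_left (x := yo)

variable {νε νx Ψ} in
theorem ae_scaleLaw_prod_pos (hνε : ∀ i, 0 < νε i) (hνx : ∀ j, 0 < νx j) :
    ∀ᵐ w ∂(scaleLaw νε).prod (scaleLaw νx), (∀ i, 0 < w.1 i) ∧ ∀ j, 0 < w.2 j :=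
  (Measure.quasiMeasurePreserving_fst.ae (ae_scaleLaw_pos hνε)).and
    (Measure.quasiMeasurePreserving_snd.ae (ae_scaleLaw_pos hνx))

variable {νε νx} in
theorem ae_scaleDensity_prod_pos (hd : 0 < d) (hk : 0 < k)
    (hνε : ∀ i, 0 < νε i) (hνx : ∀ j, 0 < νx j) :
    ∀ᵐ w ∂(scaleLaw νε).prod (scaleLaw νx), 0 < scaleDensity νε w.1 ∧ 0 < scaleDensity νx w.2 :=
  (Measure.quasiMeasurePreserving_fst.ae (ae_scaleDensity_pos hd hνε)).and
    (Measure.quasiMeasurePreserving_snd.ae (ae_scaleDensity_pos hk hνx))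

variable {νε νx O} in
theorem ae_timeRef_of_ae_scaleLaw_prod {p : (Fin d → ℝ) × (Fin k → ℝ) → Prop}
    (hp : ∀ᵐ w ∂(scaleLaw νε).prod (scaleLaw νx), p w) : ∀ᵐ h ∂timeRef νε νx O, p h.2.2 :=
  Measure.quasiMeasurePreserving_snd.ae (Measure.quasiMeasurePreserving_snd.ae hp)

theorem lintegral_timeRef {F : Hidden k O → ENNReal} (hF : Measurable F) :
    ∫⁻ h, F h ∂timeRef νε νx O =
      ∫⁻ w, (∫⁻ ym, ∫⁻ x, F (ym, x, w)) ∂(scaleLaw νε).prod (scaleLaw νx) :=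
  lintegral_prod_prod _ _ _ hF

variable {νε νx O} in
-- Fubini with the scales outermost. The inner integral need only be known for almost all scales,
-- which allows positivity to be assumed, and `g` inherits integrability from `F`.
theorem integrable_and_integral_timeRef {F : Hidden k O → ℝ} (hF : Integrable F (timeRef νε νx O))
    {g : (Fin d → ℝ) × (Fin k → ℝ) → ℝ}
    (hg : ∀ᵐ w ∂(scaleLaw νε).prod (scaleLaw νx), ∫ ym, ∫ x, F (ym, x, w) = g w) :
    Integrable g ((scaleLaw νε).prod (scaleLaw νx)) ∧
      ∫ h, F h ∂timeRef νε νx O = ∫ w, g w ∂(scaleLaw νε).prod (scaleLaw νx) := by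
  have hmp := measurePreserving_prodAssoc (volume : Measure (Mis O))
    (volume : Measure (Fin k → ℝ)) ((scaleLaw νε).prod (scaleLaw νx))
  have hi : Integrable (F ∘ MeasurableEquiv.prodAssoc)
      (((volume : Measure (Mis O)).prod (volume : Measure (Fin k → ℝ))).prod
        ((scaleLaw νε).prod (scaleLaw νx))) :=
    (hmp.integrable_comp_emb (MeasurableEquiv.measurableEmbedding _)).2 hF
  have hg' : (fun w => ∫ z, (F ∘ MeasurableEquiv.prodAssoc) (z, w)
      ∂(volume : Measure (Mis O)).prod (volume : Measure (Fin k → ℝ)))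
        =ᵐ[(scaleLaw νε).prod (scaleLaw νx)] g := by
    filter_upwards [hi.prod_left_ae, hg] with w hw hgw
    rw [integral_prod _ hw, ← hgw]
    rfl
  refine ⟨hi.integral_prod_right.congr hg', ?_⟩
  rw [timeRef, ← hmp.integral_comp (MeasurableEquiv.measurableEmbedding _), ← integral_congr_ae hg']
  exact integral_prod_symm _ hi

theorem gaussDensity_le {ι : Type*} [Fintype ι] [DecidableEq ι] (m : ι → ℝ) {C : Matrix ι ι ℝ}
    (hC : C.PosDef) (y : ι → ℝ) :
    gaussDensity m C y ≤ (2 * Real.pi) ^ (-(Fintype.card ι : ℝ) / 2) * C.det ^ (-(1 / 2) : ℝ) := by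
  have h : 0 ≤ (y - m) ⬝ᵥ (C⁻¹ *ᵥ (y - m)) := by
    simpa using hC.inv.posSemidef.dotProduct_mulVec_nonneg (y - m)
  refine mul_le_of_le_one_right ?_ (Real.exp_le_one_iff.2 (by linarith))
  exact mul_nonneg (by positivity) (Real.rpow_nonneg hC.det_pos.le _)

/-- A bound, uniform in `y^o`, for the density of `Y^o` given `u, v`. -/
theorem densityO_le (hσ : 0 < Ψ.σ2) : ∃ c : ℝ, ∀ (u : Fin d → ℝ) (v : Fin k → ℝ),
    (∀ i, 0 < u i) → (∀ j, 0 < v j) → ∀ yo : Obs O,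
      densityO Ψ u v O yo ≤ c * ∏ i ∈ O, (1 + u i) := by
  -- `|O|` factors `(2π)^(-1/2) σ⁻¹`, from the peak of a Gaussian density with variances `σ² / u^i`.
  refine ⟨(2 * Real.pi) ^ (-(Fintype.card {i // i ∈ O} : ℝ) / 2) *
    ∏ _i : {i // i ∈ O}, (Ψ.σ2 ^ (1 / 2 : ℝ))⁻¹, fun u v hu hv yo => ?_⟩
  set S := Ψ.σ2 • (diagonal u)⁻¹ with hSdef
  have hS : S.PosDef := posDef_smul_inv_diagonal hσ hu
  have hSO : blockOO O S = diagonal fun i : {i // i ∈ O} => Ψ.σ2 * (u i)⁻¹ := by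
    rw [hSdef, inv_diagonal_of_pos hu]
    ext i j
    by_cases hij : i = j
    · subst hij; simp
    · have : i.1 ≠ j.1 := fun h => hij (Subtype.ext h)
      simp [Matrix.diagonal_apply_ne _ hij, Matrix.diagonal_apply_ne _ this]
  have hdet : (blockOO O S).det ^ (-(1 / 2) : ℝ) =
      ∏ i : {i // i ∈ O}, ((Ψ.σ2 ^ (1 / 2 : ℝ))⁻¹ * (u i.1) ^ (1 / 2 : ℝ)) := by
    rw [hSO, Matrix.det_diagonal, ← Real.finsetProd_rpow _ _ fun i _ =>
      (mul_pos hσ (inv_pos.2 (hu i.1))).le]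
    refine Finset.prod_congr rfl fun i _ => ?_
    rw [Real.mul_rpow hσ.le (inv_pos.2 (hu i.1)).le, Real.inv_rpow (hu i.1).le, Real.rpow_neg hσ.le,
      Real.rpow_neg (hu i.1).le, inv_inv]
  -- Replaces the square roots in the peak by factors with integer moments.
  have hsqrt : ∀ i, (u i) ^ (1 / 2 : ℝ) ≤ 1 + u i := fun i => by
    rw [← Real.sqrt_eq_rpow]
    exact Real.sqrt_le_iff.2 ⟨by linarith [hu i], by nlinarith [hu i]⟩
  set c := (2 * Real.pi) ^ (-(Fintype.card {i // i ∈ O} : ℝ) / 2) * (blockOO O S).det ^ (-(1 / 2) : ℝ)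
    with hc
  have hc0 : 0 ≤ c := mul_nonneg (by positivity)
    (Real.rpow_nonneg (posDef_blockOO (O := O) hS).det_pos.le _)
  -- The density of `y^o` is a mixture over `x` of Gaussian densities with the same diagonal
  -- covariance `σ² / u^i`; each is at most its peak `c`, and so is the mixture.
  have hbound : densityO Ψ u v O yo ≤ c := by
    rw [← ENNReal.ofReal_le_ofReal_iff hc0, ← lintegral_lintegral_condJointDensity Ψ hσ hu hv]
    have hm : Measurable fun p : Mis O × (Fin k → ℝ) =>
        ENNReal.ofReal (condJointDensity Ψ (assemble O yo p.1) p.2 u v) :=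
      (measurable_condJointDensity Ψ ((measurable_assemble O).comp
        (measurable_const.prodMk measurable_fst)) measurable_snd measurable_const
        measurable_const).ennreal_ofReal
    rw [lintegral_lintegral_swap hm.aemeasurable]
    calc _ ≤ ∫⁻ x, ENNReal.ofReal c *
          ENNReal.ofReal (gaussDensity (Ψ.δx ᵥ* (diagonal v)⁻¹) (diagonal v)⁻¹ x) := by
          refine lintegral_mono fun x => ?_
          have hx := (gaussDensity_pos (Ψ.δx ᵥ* (diagonal v)⁻¹) (PosDef.diagonal hv).inv x).le
          simp only [condJointDensity]
          simp_rw [ENNReal.ofReal_mul' hx, ← hSdef]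
          rw [lintegral_mul_const' _ _ ENNReal.ofReal_ne_top]
          refine mul_le_mul_left ?_ _
          simp_rw [gaussDensity_assemble _ hS]
          rw [← mul_one (ENNReal.ofReal c)]
          set m := Ψ.μ + Ψ.δε ᵥ* (diagonal u)⁻¹ + x ᵥ* Ψ.Wᵀ
          have hO0 := (gaussDensity_pos (fun i : {i // i ∈ O} => m i.1)
            (posDef_blockOO (O := O) hS) yo).le
          simp_rw [ENNReal.ofReal_mul hO0]
          rw [lintegral_const_mul' _ _ ENNReal.ofReal_ne_top,
            lintegral_gaussDensity _ (posDef_schurMM hS)]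
          gcongr
          exact gaussDensity_le _ (posDef_blockOO (O := O) hS) _
      _ = _ := by
          rw [lintegral_const_mul' _ _ ENNReal.ofReal_ne_top,
            lintegral_gaussDensity _ (PosDef.diagonal hv).inv, mul_one]
  refine hbound.trans ?_
  rw [hc, hdet, Finset.prod_mul_distrib, mul_assoc,
    ← Finset.prod_coe_sort O fun i => 1 + u i]
  gcongr with i
  · exact fun i _ => (Real.rpow_pos_of_pos (hu i.1) _).le
  · exact hsqrt i

/-- The density of `Y^o` at one time point. -/
def timeObsDensity (yo : Obs O) : ℝ := ∫ h, timeLik Ψ O yo h ∂timeRef νε νx O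

variable {Ψ} in
theorem densityO_pos (hσ : 0 < Ψ.σ2) {u : Fin d → ℝ} {v : Fin k → ℝ} (hu : ∀ i, 0 < u i)
    (hv : ∀ j, 0 < v j) (yo : Obs O) : 0 < densityO Ψ u v O yo :=
  gaussDensity_pos _ (posDef_blockOO (posDef_covY Ψ hσ hu hv)) _

variable {νε νx Ψ}

theorem ae_timeLik_pos (hσ : 0 < Ψ.σ2) (hνε : ∀ i, 0 < νε i) (hνx : ∀ j, 0 < νx j) (yo : Obs O) :
    ∀ᵐ h ∂timeRef νε νx O, 0 < timeLik Ψ O yo h := by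
  filter_upwards [ae_timeRef_of_ae_scaleLaw_prod (ae_scaleLaw_prod_pos hνε hνx)] with h hh
  exact condJointDensity_pos Ψ hσ hh.1 hh.2 _ _

/-- Integrating out `y^m` and `x` leaves the density of `y^o`, which is at most `c ∏ (1 + u^i)`; the
scales have finite moments of every order. -/
theorem integrable_timeLik (hσ : 0 < Ψ.σ2) (hνε : ∀ i, 0 < νε i) (hνx : ∀ j, 0 < νx j)
    (yo : Obs O) : Integrable (timeLik Ψ O yo) (timeRef νε νx O) := by
  have := isProbabilityMeasure_scaleLaw hνx
  obtain ⟨c, hc⟩ := densityO_le Ψ O hσ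
  refine ⟨(measurable_timeLik Ψ O yo).aestronglyMeasurable, ?_⟩
  rw [hasFiniteIntegral_iff_ofReal ((ae_timeLik_pos O hσ hνε hνx yo).mono fun _ h => h.le),
    lintegral_timeRef _ _ _ (measurable_timeLik Ψ O yo).ennreal_ofReal]
  have hi : Integrable (fun w : (Fin d → ℝ) × (Fin k → ℝ) => c * ∏ i ∈ O, (1 + w.1 i))
      ((scaleLaw νε).prod (scaleLaw νx)) :=
    ((integrable_prod_one_add_scaleLaw hνε O).const_mul c).comp_fst _
  refine lt_of_le_of_lt (lintegral_mono_ae ?_) hi.lintegral_lt_top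
  filter_upwards [ae_scaleLaw_prod_pos hνε hνx] with w hw
  exact (lintegral_lintegral_condJointDensity Ψ hσ hw.1 hw.2 O yo).trans_le
    (ENNReal.ofReal_le_ofReal (hc _ _ hw.1 hw.2 yo))

theorem integrable_densityO_and_timeObsDensity_eq (hσ : 0 < Ψ.σ2) (hνε : ∀ i, 0 < νε i)
    (hνx : ∀ j, 0 < νx j) (yo : Obs O) :
    Integrable (fun w => densityO Ψ w.1 w.2 O yo) ((scaleLaw νε).prod (scaleLaw νx)) ∧
      timeObsDensity νε νx Ψ O yo =
        ∫ w, densityO Ψ w.1 w.2 O yo ∂(scaleLaw νε).prod (scaleLaw νx) := by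
  refine integrable_and_integral_timeRef (integrable_timeLik O hσ hνε hνx yo) ?_
  filter_upwards [ae_scaleLaw_prod_pos hνε hνx] with w hw
  have hg : ∀ {ι : Type} [Fintype ι] [DecidableEq ι] (m : ι → ℝ) {C : Matrix ι ι ℝ},
      C.PosDef → ∫ y, gaussDensity m C y = 1 := fun m C hC => by
    have := isProbabilityMeasure_gaussLaw m hC
    simpa using (integral_gaussLaw m hC fun _ => 1).symm
  simp only [timeLik, condJointDensity_eq Ψ hσ hw.1 hw.2, integral_const_mul,
    hg _ ((posDef_matM Ψ hσ hw.1 hw.2).inv.smul hσ), mul_one,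
    gaussDensity_meanY_covY_assemble Ψ hσ hw.1 hw.2, hg _ (posDef_condCovM Ψ hσ hw.1 hw.2 O)]

theorem timeObsDensity_pos (hσ : 0 < Ψ.σ2) (hνε : ∀ i, 0 < νε i) (hνx : ∀ j, 0 < νx j)
    (yo : Obs O) : 0 < timeObsDensity νε νx Ψ O yo := by
  have := isProbabilityMeasure_scaleLaw hνx
  have := isProbabilityMeasure_scaleLaw hνε
  obtain ⟨hi, he⟩ := integrable_densityO_and_timeObsDensity_eq O hσ hνε hνx yo
  have hpos : ∀ᵐ w ∂(scaleLaw νε).prod (scaleLaw νx), 0 < densityO Ψ w.1 w.2 O yo := by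
    filter_upwards [ae_scaleLaw_prod_pos hνε hνx] with w hw using densityO_pos O hσ hw.1 hw.2 yo
  have hnn := hpos.mono fun _ h => h.le
  rw [he]
  refine (integral_nonneg_of_ae hnn).lt_of_ne fun h0 => ?_
  obtain ⟨w, hw, hw'⟩ := (hpos.and ((integral_eq_zero_iff_of_nonneg_ae hnn hi).1 h0.symm)).exists
  exact hw.ne' hw'

theorem lintegral_timeLik (hσ : 0 < Ψ.σ2) (hνε : ∀ i, 0 < νε i) (hνx : ∀ j, 0 < νx j)
    (yo : Obs O) : ∫⁻ h, ENNReal.ofReal (timeLik Ψ O yo h) ∂timeRef νε νx O =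
      ENNReal.ofReal (timeObsDensity νε νx Ψ O yo) :=
  (ofReal_integral_eq_lintegral_ofReal (integrable_timeLik O hσ hνε hνx yo)
    ((ae_timeLik_pos O hσ hνε hνx yo).mono fun _ h => h.le)).symm

end OneTime

/-! ### From the laws of the scales to integrals over the unit square. -/

section Pullback

variable {m n : ℕ} {νε : Fin m → ℝ} {νx : Fin n → ℝ}

/-- Integrals over the laws of the scales as integrals over the unit square. -/
theorem integrableOn_and_integral_scaleLaw_prod (hνε : ∀ i, 0 < νε i) (hνx : ∀ j, 0 < νx j)
    {g : (Fin m → ℝ) × (Fin n → ℝ) → ℝ} (hg : Integrable g ((scaleLaw νε).prod (scaleLaw νx)))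
    {G : ℝ → ℝ → ℝ} (hG : ∀ s ∈ Set.Ioo (0 : ℝ) 1, ∀ r ∈ Set.Ioo (0 : ℝ) 1,
      g (scale νε s, scale νx r) = G s r) :
    IntegrableOn (fun s : ℝ × ℝ => G s.1 s.2) (Set.Icc 0 1 ×ˢ Set.Icc 0 1) ∧
      ∫ sx in (0 : ℝ)..1, ∫ sε in (0 : ℝ)..1, G sε sx =
        ∫ w, g w ∂(scaleLaw νε).prod (scaleLaw νx) := by
  have hm : Measurable (Prod.map (scale νε) (scale νx)) :=
    (measurable_scale hνε).prodMap (measurable_scale hνx)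
  have hW : (scaleLaw νε).prod (scaleLaw νx) =
      (uniform01.prod uniform01).map (Prod.map (scale νε) (scale νx)) :=
    Measure.map_prod_map _ _ (measurable_scale hνε) (measurable_scale hνx)
  rw [hW] at hg ⊢
  -- The boundary of the square is null; this removes the endpoints, where the quantiles only have
  -- default values.
  have hae : ∀ᵐ s ∂uniform01.prod uniform01, s.1 ∈ Set.Ioo (0 : ℝ) 1 ∧ s.2 ∈ Set.Ioo (0 : ℝ) 1 :=
    (Measure.quasiMeasurePreserving_fst.ae ae_uniform01_mem_Ioo).and
      (Measure.quasiMeasurePreserving_snd.ae ae_uniform01_mem_Ioo)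
  have hGe : (fun s => g (Prod.map (scale νε) (scale νx) s)) =ᵐ[uniform01.prod uniform01]
      fun s => G s.1 s.2 := by
    filter_upwards [hae] with s hs using hG _ hs.1 _ hs.2
  have hi : Integrable (fun s : ℝ × ℝ => G s.1 s.2) (uniform01.prod uniform01) :=
    ((integrable_map_measure hg.1 hm.aemeasurable).1 hg).congr hGe
  have hu : uniform01.prod uniform01 = volume.restrict (Set.Icc (0 : ℝ) 1 ×ˢ Set.Icc (0 : ℝ) 1) := by
    rw [uniform01, Measure.prod_restrict, Measure.volume_eq_prod]
  refine ⟨by rwa [IntegrableOn, ← hu], ?_⟩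
  rw [integral_map hm.aemeasurable hg.1, integral_congr_ae hGe, integral_prod_symm _ hi]
  simp_rw [intervalIntegral.integral_of_le zero_le_one, ← integral_Icc_eq_integral_Ioc]
  rfl

end Pullback

/-! ### One time point: `I₂` as a density and `I₁` as a conditional expectation. -/

section OneTime

variable {d k : ℕ} {νε : Fin d → ℝ} {νx : Fin k → ℝ} {Ψ Ψs : Params d k} (O : Finset (Fin d))

theorem integrableOn_fnM_and_I₂_eq (hσ : 0 < Ψ.σ2) (hνε : ∀ i, 0 < νε i)
    (hνx : ∀ j, 0 < νx j) (yo : Obs O) :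
    IntegrableOn (fun s : ℝ × ℝ => fnM Ψ O νε νx yo s.1 s.2) (Set.Icc 0 1 ×ˢ Set.Icc 0 1) ∧
      I₂ Ψ O νε νx yo = timeObsDensity νε νx Ψ O yo := by
  obtain ⟨hi, he⟩ := integrable_densityO_and_timeObsDensity_eq O hσ hνε hνx yo
  have h := integrableOn_and_integral_scaleLaw_prod hνε hνx hi (G := fnM Ψ O νε νx yo)
    fun s hs r hr => (weight_eq_densityO Ψ hσ (scale_pos hνε hs) (scale_pos hνx hr) O yo).symm
  exact ⟨h.1, h.2.trans he.symm⟩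

variable (νε νx Ψ) in
/-- The conditional law of the hidden data given the observed data at one time point. -/
def timeCondLaw (yo : Obs O) : Measure (Hidden k O) :=
  (timeRef νε νx O).withDensity
    fun h => ENNReal.ofReal (timeLik Ψ O yo h / timeObsDensity νε νx Ψ O yo)

theorem isProbabilityMeasure_timeCondLaw (hσ : 0 < Ψ.σ2) (hνε : ∀ i, 0 < νε i)
    (hνx : ∀ j, 0 < νx j) (yo : Obs O) : IsProbabilityMeasure (timeCondLaw νε νx Ψ O yo) := by
  have hZ := timeObsDensity_pos O hσ hνε hνx yo
  refine ⟨?_⟩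
  rw [timeCondLaw, withDensity_apply _ MeasurableSet.univ, Measure.restrict_univ]
  simp_rw [div_eq_mul_inv, ENNReal.ofReal_mul' (inv_pos.2 hZ).le]
  rw [lintegral_mul_const' _ _ ENNReal.ofReal_ne_top, lintegral_timeLik O hσ hνε hνx,
    ← ENNReal.ofReal_mul hZ.le, mul_inv_cancel₀ hZ.ne', ENNReal.ofReal_one]

/-- The conditional law has density `timeLik / Z`, so the expectation is `Z⁻¹` times the integral of
log-density times likelihood. Fubini reduces this to the Gaussian computation at fixed scales. -/
theorem integrableOn_fnVTilde_mul_fnM_and_integral_timeCondLaw (hd : 0 < d) (hk : 0 < k)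
    (hσ : 0 < Ψ.σ2) (hσs : 0 < Ψs.σ2) (hνε : ∀ i, 0 < νε i) (hνx : ∀ j, 0 < νx j) (yo : Obs O)
    (hi : Integrable (fun h : Hidden k O => Real.log (jointDensity νε νx Ψs
      (assemble O yo h.1) h.2.1 h.2.2.1 h.2.2.2)) (timeCondLaw νε νx Ψ O yo)) :
    IntegrableOn (fun s : ℝ × ℝ => fnVTilde Ψ Ψs O νε νx yo s.1 s.2 * fnM Ψ O νε νx yo s.1 s.2)
        (Set.Icc 0 1 ×ˢ Set.Icc 0 1) ∧
      ∫ h, Real.log (jointDensity νε νx Ψs (assemble O yo h.1) h.2.1 h.2.2.1 h.2.2.2)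
          ∂(timeCondLaw νε νx Ψ O yo) =
        I₁ Ψ Ψs O νε νx yo / timeObsDensity νε νx Ψ O yo := by
  have hZ := timeObsDensity_pos O hσ hνε hνx yo
  set Z := timeObsDensity νε νx Ψ O yo
  set l : Hidden k O → ℝ := fun h => Real.log (jointDensity νε νx Ψs
    (assemble O yo h.1) h.2.1 h.2.2.1 h.2.2.2) with hl
  have hm : Measurable fun h : Hidden k O => ENNReal.ofReal (timeLik Ψ O yo h / Z) :=
    ((measurable_timeLik Ψ O yo).div_const Z).ennreal_ofReal
  have htop : ∀ᵐ h ∂timeRef νε νx O, ENNReal.ofReal (timeLik Ψ O yo h / Z) < ⊤ :=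
    ae_of_all _ fun _ => ENNReal.ofReal_lt_top
  have hcongr : (fun h => (ENNReal.ofReal (timeLik Ψ O yo h / Z)).toReal • l h)
      =ᵐ[timeRef νε νx O] fun h => (l h * timeLik Ψ O yo h) / Z := by
    filter_upwards [ae_timeLik_pos O hσ hνε hνx yo] with h hh
    rw [ENNReal.toReal_ofReal (div_pos hh hZ).le, smul_eq_mul]
    ring
  -- Integrability under the conditional law becomes integrability against the reference measure
  -- after multiplication by the constant `Z`.
  have hi' : Integrable (fun h => l h * timeLik Ψ O yo h) (timeRef νε νx O) := by
    have h1 := ((integrable_withDensity_iff_integrable_smul' hm htop).1 hi).congr hcongr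
    refine (h1.mul_const Z).congr (ae_of_all _ fun h => ?_)
    simp only
    rw [div_mul_cancel₀ _ hZ.ne']
  obtain ⟨hgi, hge⟩ := integrable_and_integral_timeRef hi'
    (g := fun w => fnV Ψ Ψs w.1 w.2 O νε νx yo * densityO Ψ w.1 w.2 O yo) (by
      filter_upwards [ae_scaleLaw_prod_pos hνε hνx, ae_scaleDensity_prod_pos hd hk hνε hνx]
        with w hw hw'
      exact integral_integral_log_jointDensity Ψ Ψs νε νx hσ hσs hw.1 hw.2 hw'.1 hw'.2 O yo)
  have h := integrableOn_and_integral_scaleLaw_prod hνε hνx hgi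
    (G := fun s r => fnVTilde Ψ Ψs O νε νx yo s r * fnM Ψ O νε νx yo s r)
    fun s hs r hr => by
      simp only [fnVTilde, fnM,
        weight_eq_densityO Ψ hσ (scale_pos hνε hs) (scale_pos hνx hr) O yo]
  refine ⟨h.1, ?_⟩
  rw [timeCondLaw, integral_withDensity_eq_integral_toReal_smul hm htop, integral_congr_ae hcongr,
    integral_div, hge, ← h.2]
  rfl

end OneTime

/-! ### All time points: product structure and the closed form of `Q`. -/

section AllTimes

variable {d k N : ℕ} {νε : Fin d → ℝ} {νx : Fin k → ℝ} {Ψ Ψs : Params d k}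
  (O : Fin N → Finset (Fin d))

theorem obsDensity_eq_prod (yo : ∀ t, Obs (O t)) :
    obsDensity νε νx Ψ O yo = ∏ t, timeObsDensity νε νx Ψ (O t) (yo t) :=
  integral_fintype_prod_eq_prod (fun t => timeLik Ψ (O t) (yo t))
    (μ := fun t => timeRef νε νx (O t))

theorem obsDensity_pos (hσ : 0 < Ψ.σ2) (hνε : ∀ i, 0 < νε i) (hνx : ∀ j, 0 < νx j)
    (yo : ∀ t, Obs (O t)) : 0 < obsDensity νε νx Ψ O yo := by
  rw [obsDensity_eq_prod]
  exact Finset.prod_pos fun t _ => timeObsDensity_pos _ hσ hνε hνx _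

theorem ae_hiddenRef_of_ae_timeRef {p : ∀ t, Hidden k (O t) → Prop}
    (hp : ∀ t, ∀ᵐ h ∂timeRef νε νx (O t), p t h) :
    ∀ᵐ h ∂hiddenRef νε νx O, ∀ t, p t (h t) :=
  ae_all_iff.2 fun t =>
    (Measure.quasiMeasurePreserving_eval (μ := fun t => timeRef νε νx (O t)) t).ae (hp t)

/-- Conditional independence over time: the likelihood, its normaliser and the reference measure all
factor. `ENNReal.ofReal` commutes with the product because the factors are almost everywhere
positive. -/
theorem hiddenCondLaw_eq_pi (hσ : 0 < Ψ.σ2) (hνε : ∀ i, 0 < νε i) (hνx : ∀ j, 0 < νx j)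
    (yo : ∀ t, Obs (O t)) :
    hiddenCondLaw νε νx Ψ O yo = Measure.pi fun t => timeCondLaw νε νx Ψ (O t) (yo t) := by
  have h := pi_withDensity (μ := fun t => timeRef νε νx (O t))
    (f := fun t h => ENNReal.ofReal
      (timeLik Ψ (O t) (yo t) h / timeObsDensity νε νx Ψ (O t) (yo t)))
    (fun t => ((measurable_timeLik Ψ (O t) (yo t)).div_const _).ennreal_ofReal)
    fun _ _ => ENNReal.ofReal_ne_top
  refine Eq.trans ?_ h.symm
  refine withDensity_congr_ae ?_
  filter_upwards [ae_hiddenRef_of_ae_timeRef O fun t => ae_timeLik_pos (O t) hσ hνε hνx (yo t)]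
    with h hh
  rw [← ENNReal.ofReal_prod_of_nonneg fun t _ =>
    (div_pos (hh t) (timeObsDensity_pos _ hσ hνε hνx _)).le, Finset.prod_div_distrib,
    obsDensity_eq_prod]
  rfl

theorem isProbabilityMeasure_hiddenCondLaw (hσ : 0 < Ψ.σ2) (hνε : ∀ i, 0 < νε i)
    (hνx : ∀ j, 0 < νx j) (yo : ∀ t, Obs (O t)) :
    IsProbabilityMeasure (hiddenCondLaw νε νx Ψ O yo) := by
  have := fun t => isProbabilityMeasure_timeCondLaw (O t) hσ hνε hνx (yo t)
  rw [hiddenCondLaw_eq_pi O hσ hνε hνx]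
  infer_instance

/-- The complete-data log-likelihood is the sum of the log-likelihoods of the time points. -/
theorem completeLogLik_ae_eq (hd : 0 < d) (hk : 0 < k) (hσs : 0 < Ψs.σ2)
    (hνε : ∀ i, 0 < νε i) (hνx : ∀ j, 0 < νx j) (yo : ∀ t, Obs (O t)) :
    completeLogLik νε νx Ψs O yo =ᵐ[hiddenCondLaw νε νx Ψ O yo] fun h =>
      ∑ t, Real.log (jointDensity νε νx Ψs
        (assemble (O t) (yo t) (h t).1) (h t).2.1 (h t).2.2.1 (h t).2.2.2) := by
  refine (withDensity_absolutelyContinuous _ _).ae_le ?_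
  have hw := (ae_scaleLaw_prod_pos hνε hνx).and (ae_scaleDensity_prod_pos hd hk hνε hνx)
  filter_upwards [ae_hiddenRef_of_ae_timeRef O fun t =>
    ae_timeRef_of_ae_scaleLaw_prod (O := O t) hw] with h hh
  refine Real.log_prod fun t _ => ?_
  obtain ⟨h1, h2⟩ := hh t
  exact (mul_pos (mul_pos (condJointDensity_pos Ψs hσs h1.1 h1.2 _ _) h2.1) h2.2).ne'

/-- Under the product conditional law the expected log-likelihood is `∑ I₁(t) / Z_t`. Each fraction
is expanded by `∏_{s ≠ t} Z_s = ∏_{s ≠ t} I₂(s)`, so that the common denominator is the density of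
all observations. -/
theorem eStepQ_closed_form (hd : 0 < d) (hk : 0 < k) (hσ : 0 < Ψ.σ2) (hσs : 0 < Ψs.σ2)
    (hνε : ∀ i, 0 < νε i) (hνx : ∀ j, 0 < νx j) (yo : ∀ t, Obs (O t))
    (hi : Integrable (completeLogLik νε νx Ψs O yo) (hiddenCondLaw νε νx Ψ O yo)) :
    (∀ t, IntegrableOn (fun s : ℝ × ℝ =>
      fnVTilde Ψ Ψs (O t) νε νx (yo t) s.1 s.2 * fnM Ψ (O t) νε νx (yo t) s.1 s.2)
      (Set.Icc 0 1 ×ˢ Set.Icc 0 1)) ∧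
    eStepQ νε νx Ψ Ψs O yo =
      1 / obsDensity νε νx Ψ O yo *
        ∑ t, I₁ Ψ Ψs (O t) νε νx (yo t) *
          ∏ s ∈ Finset.univ.erase t, I₂ Ψ (O s) νε νx (yo s) := by
  have hprob := fun t => isProbabilityMeasure_timeCondLaw (O t) hσ hνε hνx (yo t)
  have hlog := completeLogLik_ae_eq (Ψ := Ψ) O hd hk hσs hνε hνx yo
  have hsum := hi.congr hlog
  have hpi := hiddenCondLaw_eq_pi O hσ hνε hνx yo
  rw [hpi] at hsum
  have hit := integrable_of_integrable_sum_eval (μ := fun t => timeCondLaw νε νx Ψ (O t) (yo t))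
    (f := fun t h => Real.log (jointDensity νε νx Ψs
      (assemble (O t) (yo t) h.1) h.2.1 h.2.2.1 h.2.2.2)) hsum
  have hT := fun t => integrableOn_fnVTilde_mul_fnM_and_integral_timeCondLaw (O t) hd hk hσ hσs
    hνε hνx (yo t) (hit t)
  have hcomp : ∀ t, Integrable (fun h : ∀ t, Hidden k (O t) => Real.log (jointDensity νε νx Ψs
      (assemble (O t) (yo t) (h t).1) (h t).2.1 (h t).2.2.1 (h t).2.2.2))
      (Measure.pi fun t => timeCondLaw νε νx Ψ (O t) (yo t)) := fun t =>
    (measurePreserving_eval (fun t => timeCondLaw νε νx Ψ (O t) (yo t)) t).integrable_comp_of_integrable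
      (hit t)
  refine ⟨fun t => (hT t).1, ?_⟩
  rw [eStepQ, integral_congr_ae hlog, hpi, integral_finsetSum _ fun t _ => hcomp t, Finset.mul_sum]
  refine Finset.sum_congr rfl fun t _ => ?_
  rw [integral_comp_eval (μ := fun t => timeCondLaw νε νx Ψ (O t) (yo t)) (i := t)
    (f := fun h => Real.log (jointDensity νε νx Ψs
      (assemble (O t) (yo t) h.1) h.2.1 h.2.2.1 h.2.2.2)) (hit t).1, (hT t).2, obsDensity_eq_prod,
    Finset.prod_congr rfl fun s _ => (integrableOn_fnM_and_I₂_eq (O s) hσ hνε hνx (yo s)).2,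
    ← Finset.mul_prod_erase Finset.univ _ (Finset.mem_univ t)]
  have h1 := (timeObsDensity_pos (O t) hσ hνε hνx (yo t)).ne'
  have h2 : ∏ s ∈ Finset.univ.erase t, timeObsDensity νε νx Ψ (O s) (yo s) ≠ 0 :=
    (Finset.prod_pos fun s _ => timeObsDensity_pos (O s) hσ hνε hνx (yo s)).ne'
  field_simp

end AllTimes

/-! ### Law of the complete data at one time point. -/

section Generic

variable {α β γ : Type*} [MeasurableSpace α] [MeasurableSpace β] [MeasurableSpace γ]

theorem map_withDensity_comp_of_measurePreserving {μ : Measure α} {ν : Measure β} {e : α → β}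
    (he : MeasurePreserving e μ ν) {g : β → ENNReal} (hg : Measurable g) :
    (μ.withDensity (g ∘ e)).map e = ν.withDensity g := by
  ext s hs
  rw [Measure.map_apply he.measurable hs, withDensity_apply _ (he.measurable hs),
    withDensity_apply _ hs]
  exact he.setLIntegral_comp_preimage hs hg

end Generic

theorem lintegral_stdNormal_add_sqrt_mul {n : ℕ} (m : Fin n → ℝ) {c : Fin n → ℝ}
    (hc : ∀ i, 0 < c i) {h : (Fin n → ℝ) → ENNReal} (hh : Measurable h) :
    ∫⁻ z, h (fun i => m i + Real.sqrt (c i) * z i) ∂stdNormal n =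
      ∫⁻ y, ENNReal.ofReal (gaussDensity m (diagonal c) y) * h y := by
  set B : Matrix (Fin n) (Fin n) ℝ := diagonal fun i => Real.sqrt (c i) with hB
  have hBB : B * Bᵀ = diagonal c := by
    rw [hB, Matrix.diagonal_transpose, Matrix.diagonal_mul_diagonal]
    congr 1
    ext i
    exact Real.mul_self_sqrt (hc i).le
  have hdet : B.det ≠ 0 := by
    rw [hB, Matrix.det_diagonal]
    exact (Finset.prod_pos fun i _ => Real.sqrt_pos.2 (hc i)).ne'
  have hmap := map_add_mulVec_pi_gaussianReal m hdet
  rw [hBB] at hmap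
  refine Eq.trans ?_ (lintegral_withDensity_eq_lintegral_mul₀
    (measurable_gaussDensity_right m _).ennreal_ofReal.aemeasurable hh.aemeasurable)
  rw [← hmap, lintegral_map hh (measurable_add_mulVec m B)]
  refine lintegral_congr fun z => congrArg h ?_
  ext i
  simp [hB, Matrix.mulVec_diagonal]

section Sample

variable {d k : ℕ} (νε : Fin d → ℝ) (νx : Fin k → ℝ) (Ψ : Params d k)

theorem measurable_latentX {X : Type*} [MeasurableSpace X] {v z : X → Fin k → ℝ}
    (hv : Measurable v) (hz : Measurable z) : Measurable fun a => latentX Ψ (v a) (z a) := by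
  refine measurable_pi_lambda _ fun j => ?_
  have h1 : Measurable fun a => v a j := (measurable_pi_apply j).comp hv
  have h2 : Measurable fun a => z a j := (measurable_pi_apply j).comp hz
  exact (h1.inv.mul_const _).add (h1.inv.sqrt.mul h2)

theorem measurable_noise {X : Type*} [MeasurableSpace X] {u z : X → Fin d → ℝ}
    (hu : Measurable u) (hz : Measurable z) : Measurable fun a => noise Ψ (u a) (z a) := by
  refine measurable_pi_lambda _ fun j => ?_
  have h1 : Measurable fun a => u a j := (measurable_pi_apply j).comp hu
  have h2 : Measurable fun a => z a j := (measurable_pi_apply j).comp hz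
  exact (h1.inv.mul_const _).add ((h1.inv.const_mul _).sqrt.mul h2)

theorem measurable_obsY {X : Type*} [MeasurableSpace X] {x : X → Fin k → ℝ} {e : X → Fin d → ℝ}
    (hx : Measurable x) (he : Measurable e) : Measurable fun a => obsY Ψ (x a) (e a) := by
  have h : Measurable fun a => x a ᵥ* Ψ.Wᵀ := measurable_vecMul hx fun _ _ => measurable_const
  exact (h.const_add Ψ.μ).add he

theorem vecMul_inv_diagonal {n : ℕ} {u : Fin n → ℝ} (hu : ∀ i, 0 < u i) (δ : Fin n → ℝ) :
    δ ᵥ* (diagonal u)⁻¹ = fun i => (u i)⁻¹ * δ i := by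
  rw [inv_diagonal_of_pos hu]
  ext i
  rw [Matrix.vecMul_diagonal, mul_comm]

/-- Given the scales, `(Y, X)` has density `π(y | x, u, v) π(x | u, v)`. -/
theorem lintegral_stdNormal_stdNormal (hσ : 0 < Ψ.σ2) {u : Fin d → ℝ} {v : Fin k → ℝ}
    (hu : ∀ i, 0 < u i) (hv : ∀ j, 0 < v j) {f : (Fin d → ℝ) × (Fin k → ℝ) → ENNReal}
    (hf : Measurable f) :
    ∫⁻ z, f (obsY Ψ (latentX Ψ v z.2) (noise Ψ u z.1), latentX Ψ v z.2)
        ∂(stdNormal d).prod (stdNormal k) =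
      ∫⁻ y, ∫⁻ x, ENNReal.ofReal (condJointDensity Ψ y x u v) * f (y, x) := by
  have : SFinite (stdNormal d) := by unfold stdNormal; infer_instance
  have : SFinite (stdNormal k) := by unfold stdNormal; infer_instance
  have hm1 : Measurable fun z : (Fin d → ℝ) × (Fin k → ℝ) =>
      f (obsY Ψ (latentX Ψ v z.2) (noise Ψ u z.1), latentX Ψ v z.2) := by
    have hx := measurable_latentX Ψ (v := fun z : (Fin d → ℝ) × (Fin k → ℝ) => v)
      measurable_const measurable_snd
    exact hf.comp ((measurable_obsY Ψ hx (measurable_noise Ψ measurable_const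
      measurable_fst)).prodMk hx)
  have hm2 : Measurable fun p : (Fin d → ℝ) × (Fin k → ℝ) =>
      ENNReal.ofReal (condJointDensity Ψ p.1 p.2 u v) * f (p.1, p.2) :=
    (measurable_condJointDensity Ψ measurable_fst measurable_snd measurable_const
      measurable_const).ennreal_ofReal.mul hf
  -- The noise is integrated first, with `x` held fixed, and the latent variable afterwards,
  -- following the factorisation `π(y | x, u, v) π(x | u, v)`.
  rw [lintegral_prod_symm _ hm1.aemeasurable]
  refine Eq.trans ?_ (lintegral_lintegral_swap hm2.aemeasurable).symm
  have hinv : (diagonal v)⁻¹ = diagonal fun j => (v j)⁻¹ := inv_diagonal_of_pos hv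
  have hinv' : Ψ.σ2 • (diagonal u)⁻¹ = diagonal fun i => Ψ.σ2 * (u i)⁻¹ := by
    rw [inv_diagonal_of_pos hu, ← Matrix.diagonal_smul]
    rfl
  have hy : ∀ x, ∫⁻ z, f (obsY Ψ x (noise Ψ u z), x) ∂stdNormal d = ∫⁻ y, ENNReal.ofReal
      (gaussDensity (Ψ.μ + Ψ.δε ᵥ* (diagonal u)⁻¹ + x ᵥ* Ψ.Wᵀ) (Ψ.σ2 • (diagonal u)⁻¹) y) *
        f (y, x) := fun x => by
    have hfx : Measurable fun y => f (y, x) := hf.comp measurable_prodMk_right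
    rw [hinv', ← lintegral_stdNormal_add_sqrt_mul _ (fun i => mul_pos hσ (inv_pos.2 (hu i))) hfx]
    refine lintegral_congr fun z => congrArg (fun y => f (y, x)) ?_
    rw [vecMul_inv_diagonal hu]
    ext i
    simp only [obsY, noise, Pi.add_apply]
    ring
  have hgm : Measurable fun x => ∫⁻ y, ENNReal.ofReal (gaussDensity
      (Ψ.μ + Ψ.δε ᵥ* (diagonal u)⁻¹ + x ᵥ* Ψ.Wᵀ) (Ψ.σ2 • (diagonal u)⁻¹) y) * f (y, x) := by
    refine Measurable.lintegral_prod_right' (f := fun p : (Fin k → ℝ) × (Fin d → ℝ) =>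
      ENNReal.ofReal (gaussDensity (Ψ.μ + Ψ.δε ᵥ* (diagonal u)⁻¹ + p.1 ᵥ* Ψ.Wᵀ)
        (Ψ.σ2 • (diagonal u)⁻¹) p.2) * f (p.2, p.1)) ?_
    have h1 : Measurable fun p : (Fin k → ℝ) × (Fin d → ℝ) => p.1 ᵥ* Ψ.Wᵀ :=
      measurable_vecMul measurable_fst fun _ _ => measurable_const
    have h2 : Measurable fun p : (Fin k → ℝ) × (Fin d → ℝ) =>
        gaussDensity (Ψ.μ + Ψ.δε ᵥ* (diagonal u)⁻¹ + p.1 ᵥ* Ψ.Wᵀ) (Ψ.σ2 • (diagonal u)⁻¹) p.2 :=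
      measurable_gaussDensity (h1.const_add (Ψ.μ + Ψ.δε ᵥ* (diagonal u)⁻¹))
        (fun _ _ => measurable_const) measurable_snd
    exact h2.ennreal_ofReal.mul (hf.comp measurable_swap)
  have hx := lintegral_stdNormal_add_sqrt_mul (Ψ.δx ᵥ* (diagonal v)⁻¹)
    (c := fun j => (v j)⁻¹) (fun j => inv_pos.2 (hv j)) hgm
  have hlat : ∀ z, latentX Ψ v z =
      fun j => (Ψ.δx ᵥ* (diagonal v)⁻¹) j + Real.sqrt ((v j)⁻¹) * z j := fun z => by
    rw [vecMul_inv_diagonal hv]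
    rfl
  simp_rw [hy, hlat]
  rw [hx, ← hinv]
  refine lintegral_congr fun x => ?_
  rw [← lintegral_const_mul' _ _ ENNReal.ofReal_ne_top]
  refine lintegral_congr fun y => ?_
  rw [← mul_assoc, condJointDensity, mul_comm (gaussDensity _ _ y),
    ENNReal.ofReal_mul (gaussDensity_pos _ (PosDef.diagonal hv).inv x).le]

/-- The law of the primitive variables at one time point. -/
abbrev primitiveLaw (d k : ℕ) : Measure (ℝ × ℝ × (Fin d → ℝ) × (Fin k → ℝ)) :=
  uniform01.prod (uniform01.prod ((stdNormal d).prod (stdNormal k)))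

/-- The complete data `(Y, X, U, V)` as a function of the primitive variables. -/
def completeSample (q : ℝ × ℝ × (Fin d → ℝ) × (Fin k → ℝ)) :
    (Fin d → ℝ) × (Fin k → ℝ) × (Fin d → ℝ) × (Fin k → ℝ) :=
  (randY νε νx Ψ q.1 q.2.1 q.2.2.1 q.2.2.2, latentX Ψ (scale νx q.2.1) q.2.2.2,
    scale νε q.1, scale νx q.2.1)

variable {νε νx}

theorem measurable_completeSample (hνε : ∀ i, 0 < νε i) (hνx : ∀ j, 0 < νx j) :
    Measurable (completeSample νε νx Ψ) := by
  have h2 : Measurable fun q : ℝ × ℝ × (Fin d → ℝ) × (Fin k → ℝ) => q.2 := measurable_snd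
  have h3 : Measurable fun q : ℝ × ℝ × (Fin d → ℝ) × (Fin k → ℝ) => q.2.2 := measurable_snd.comp h2
  have hu := (measurable_scale hνε).comp
    (measurable_fst : Measurable fun q : ℝ × ℝ × (Fin d → ℝ) × (Fin k → ℝ) => q.1)
  have hv := (measurable_scale hνx).comp (measurable_fst.comp h2)
  have hx := measurable_latentX Ψ hv (measurable_snd.comp h3)
  exact (measurable_obsY Ψ hx (measurable_noise Ψ hu (measurable_fst.comp h3))).prodMk
    (hx.prodMk (hu.prodMk hv))

/-- The law of the complete data at one time point. -/
theorem map_completeSample (hσ : 0 < Ψ.σ2) (hνε : ∀ i, 0 < νε i) (hνx : ∀ j, 0 < νx j) :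
    (primitiveLaw d k).map (completeSample νε νx Ψ) =
      ((volume : Measure (Fin d → ℝ)).prod ((volume : Measure (Fin k → ℝ)).prod
        ((scaleLaw νε).prod (scaleLaw νx)))).withDensity
          fun p => ENNReal.ofReal (condJointDensity Ψ p.1 p.2.1 p.2.2.1 p.2.2.2) := by
  have : SFinite (stdNormal d) := by unfold stdNormal; infer_instance
  have : SFinite (stdNormal k) := by unfold stdNormal; infer_instance
  have hΦ := measurable_completeSample Ψ hνε hνx
  have hcj : Measurable fun p : (Fin d → ℝ) × (Fin k → ℝ) × (Fin d → ℝ) × (Fin k → ℝ) =>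
      ENNReal.ofReal (condJointDensity Ψ p.1 p.2.1 p.2.2.1 p.2.2.2) :=
    (measurable_condJointDensity Ψ (by fun_prop) (by fun_prop) (by fun_prop)
      (by fun_prop)).ennreal_ofReal
  refine Measure.ext_of_lintegral _ fun f hf => ?_
  rw [lintegral_map hf hΦ, lintegral_withDensity_eq_lintegral_mul _ hcj hf,
    lintegral_prod_prod _ _ _ (hcj.mul hf)]
  have hW : (scaleLaw νε).prod (scaleLaw νx) =
      (uniform01.prod uniform01).map (Prod.map (scale νε) (scale νx)) :=
    Measure.map_prod_map _ _ (measurable_scale hνε) (measurable_scale hνx)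
  have hinner : Measurable fun w : (Fin d → ℝ) × (Fin k → ℝ) => ∫⁻ y, ∫⁻ x,
      ((fun p : (Fin d → ℝ) × (Fin k → ℝ) × (Fin d → ℝ) × (Fin k → ℝ) =>
        ENNReal.ofReal (condJointDensity Ψ p.1 p.2.1 p.2.2.1 p.2.2.2)) * f) (y, x, w) := by
    refine Measurable.lintegral_prod_right (f := fun w y => ∫⁻ x, _) ?_
    refine Measurable.lintegral_prod_right (f := fun (p : ((Fin d → ℝ) × (Fin k → ℝ)) ×
      (Fin d → ℝ)) x => _) ?_
    exact (hcj.mul hf).comp (by fun_prop : Measurable fun p : (((Fin d → ℝ) × (Fin k → ℝ)) ×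
      (Fin d → ℝ)) × (Fin k → ℝ) => (p.1.2, p.2, p.1.1))
  rw [hW, lintegral_map hinner ((measurable_scale hνε).prodMap (measurable_scale hνx))]
  -- Grouping the two uniform variables allows the Gaussian vectors to be integrated at fixed levels
  -- `s`, where the scales are almost surely positive constants.
  refine Eq.trans ((measurePreserving_prodAssoc uniform01 uniform01
    ((stdNormal d).prod (stdNormal k))).lintegral_comp (hf.comp hΦ)).symm ?_
  refine Eq.trans (lintegral_prod _
    ((hf.comp hΦ).comp MeasurableEquiv.prodAssoc.measurable).aemeasurable) ?_
  have hae : ∀ᵐ s ∂uniform01.prod uniform01, s.1 ∈ Set.Ioo (0 : ℝ) 1 ∧ s.2 ∈ Set.Ioo (0 : ℝ) 1 :=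
    (Measure.quasiMeasurePreserving_fst.ae ae_uniform01_mem_Ioo).and
      (Measure.quasiMeasurePreserving_snd.ae ae_uniform01_mem_Ioo)
  refine lintegral_congr_ae ?_
  filter_upwards [hae] with s hs
  exact lintegral_stdNormal_stdNormal Ψ hσ (scale_pos hνε hs.1) (scale_pos hνx hs.2)
    (f := fun p => f (p.1, p.2, scale νε s.1, scale νx s.2))
    (hf.comp (measurable_fst.prodMk (measurable_snd.prodMk measurable_const)))

/-- Splitting the data vector into its observed and missing entries. -/
def splitSample (O : Finset (Fin d)) (p : (Fin d → ℝ) × (Fin k → ℝ) × (Fin d → ℝ) × (Fin k → ℝ)) :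
    Obs O × Hidden k O :=
  (fun i => p.1 i.1, fun i => p.1 i.1, p.2)

theorem measurePreserving_splitSample {O : Finset (Fin d)} :
    MeasurePreserving (splitSample O) ((volume : Measure (Fin d → ℝ)).prod
      ((volume : Measure (Fin k → ℝ)).prod ((scaleLaw νε).prod (scaleLaw νx))))
      ((volume : Measure (Obs O)).prod (timeRef νε νx O)) := by
  have h0 : MeasurePreserving (MeasurableEquiv.piEquivPiSubtypeProd (fun _ : Fin d => ℝ) (· ∈ O))
      volume ((volume : Measure (Obs O)).prod (volume : Measure (Mis O))) := by
    have h := volume_preserving_piEquivPiSubtypeProd (fun _ : Fin d => ℝ) (· ∈ O)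
    -- The volume on a function space depends on the `Fintype` instance of the index set; two
    -- instances for the observed indices are identified.
    rw [Subsingleton.elim (Subtype.fintype (· ∈ O)) (Finset.Subtype.fintype O)] at h
    exact h
  have h := h0.prod
    (MeasurePreserving.id ((volume : Measure (Fin k → ℝ)).prod
      ((scaleLaw νε).prod (scaleLaw νx))))
  exact (measurePreserving_prodAssoc (volume : Measure (Obs O)) (volume : Measure (Mis O))
    ((volume : Measure (Fin k → ℝ)).prod ((scaleLaw νε).prod (scaleLaw νx)))).comp h

/-- The law of the observed and the hidden data at one time point. -/
theorem map_splitSample_completeSample (hσ : 0 < Ψ.σ2) (hνε : ∀ i, 0 < νε i)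
    (hνx : ∀ j, 0 < νx j) (O : Finset (Fin d)) :
    (primitiveLaw d k).map (fun q => splitSample O (completeSample νε νx Ψ q)) =
      ((volume : Measure (Obs O)).prod (timeRef νε νx O)).withDensity
        fun p => ENNReal.ofReal (timeLik Ψ O p.1 p.2) := by
  have hs := measurePreserving_splitSample (νε := νε) (νx := νx) (O := O)
  have h := Measure.map_map hs.measurable (measurable_completeSample Ψ hνε hνx)
    (μ := primitiveLaw d k)
  rw [map_completeSample Ψ hσ hνε hνx] at h
  refine Eq.trans h.symm ?_
  rw [← map_withDensity_comp_of_measurePreserving hs (measurable_timeLik_prod Ψ O).ennreal_ofReal]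
  congr 2
  ext p
  have : assemble O (splitSample O p).1 (splitSample O p).2.1 = p.1 := by
    ext i
    simp only [assemble, splitSample]
    split_ifs <;> rfl
  simp only [Function.comp_apply, timeLik, this]
  rfl

end Sample

/-! ### Joint law, marginal law and conditional law over all time points. -/

section Law

variable {d k N : ℕ} {νε : Fin d → ℝ} {νx : Fin k → ℝ} {Ψ : Params d k}
  (O : Fin N → Finset (Fin d))

instance (νε : Fin d → ℝ) (νx : Fin k → ℝ) : SigmaFinite (hiddenRef νε νx O) :=
  inferInstanceAs (SigmaFinite (Measure.pi fun t => timeRef νε νx (O t)))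

variable (Ψ) in
theorem measurable_timeLik_eval (t : Fin N) :
    Measurable fun p : (∀ t, Obs (O t)) × (∀ t, Hidden k (O t)) =>
      timeLik Ψ (O t) (p.1 t) (p.2 t) := by
  have h : Measurable fun p : (∀ t, Obs (O t)) × (∀ t, Hidden k (O t)) => (p.1 t, p.2 t) :=
    ((measurable_pi_apply t).comp measurable_fst).prodMk
      ((measurable_pi_apply t).comp measurable_snd)
  have h' := (measurable_timeLik_prod Ψ (O t)).comp h
  rw [Function.comp_def] at h'
  exact h'

variable (Ψ) in
theorem measurable_completeLik :
    Measurable fun p : (∀ t, Obs (O t)) × (∀ t, Hidden k (O t)) => completeLik Ψ O p.1 p.2 :=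
  Finset.measurable_prod (f := fun t (p : (∀ t, Obs (O t)) × (∀ t, Hidden k (O t))) =>
    timeLik Ψ (O t) (p.1 t) (p.2 t)) _ fun t _ => measurable_timeLik_eval Ψ O t

variable (νε νx Ψ) in
theorem measurable_obsDensity : Measurable (obsDensity νε νx Ψ O) :=
  ((measurable_completeLik Ψ O).stronglyMeasurable.integral_prod_right).measurable

variable {O} in
-- The exceptional null set concerns the scales only, so it can be chosen independently of `yo`.
theorem ae_completeLik_eq_prod (hσ : 0 < Ψ.σ2) (hνε : ∀ i, 0 < νε i) (hνx : ∀ j, 0 < νx j) :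
    ∀ᵐ h ∂hiddenRef νε νx O, ∀ yo : ∀ t, Obs (O t),
      ∏ t, ENNReal.ofReal (timeLik Ψ (O t) (yo t) (h t)) =
        ENNReal.ofReal (completeLik Ψ O yo h) := by
  filter_upwards [ae_hiddenRef_of_ae_timeRef O fun t =>
    ae_timeRef_of_ae_scaleLaw_prod (O := O t) (ae_scaleLaw_prod_pos hνε hνx)] with h hh yo
  exact (ENNReal.ofReal_prod_of_nonneg fun t _ =>
    (condJointDensity_pos Ψ hσ (hh t).1 (hh t).2 _ _).le).symm

theorem lintegral_completeLik (hσ : 0 < Ψ.σ2) (hνε : ∀ i, 0 < νε i) (hνx : ∀ j, 0 < νx j)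
    (yo : ∀ t, Obs (O t)) :
    ∫⁻ h, ENNReal.ofReal (completeLik Ψ O yo h) ∂hiddenRef νε νx O =
      ENNReal.ofReal (obsDensity νε νx Ψ O yo) := by
  rw [obsDensity_eq_prod, ENNReal.ofReal_prod_of_nonneg fun t _ =>
    (timeObsDensity_pos _ hσ hνε hνx _).le]
  simp_rw [← lintegral_timeLik _ hσ hνε hνx]
  rw [← lintegral_congr_ae ((ae_completeLik_eq_prod hσ hνε hνx).mono fun h hh => hh yo)]
  exact lintegral_fintype_prod_eq_prod (μ := fun t => timeRef νε νx (O t))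
    fun t => (measurable_timeLik Ψ (O t) (yo t)).ennreal_ofReal

/-- The joint law of the observed and the hidden data over all time points. -/
theorem map_randObs_randHidden (hσ : 0 < Ψ.σ2) (hνε : ∀ i, 0 < νε i) (hνx : ∀ j, 0 < νx j)
    {Ω : Type*} [MeasurableSpace Ω] {P : Measure Ω} [IsProbabilityMeasure P]
    {Sε Sx : Fin N → Ω → ℝ} {Zε : Fin N → Ω → Fin d → ℝ} {Zx : Fin N → Ω → Fin k → ℝ}
    (hmodel : IsModel P Sε Sx Zε Zx) :
    P.map (fun ω => (randObs νε νx Ψ O Sε Sx Zε Zx ω, randHidden νε νx Ψ O Sε Sx Zε Zx ω)) =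
      ((volume : Measure (∀ t, Obs (O t))).prod (hiddenRef νε νx O)).withDensity
        fun p => ENNReal.ofReal (completeLik Ψ O p.1 p.2) := by
  set G : ∀ t, ℝ × ℝ × (Fin d → ℝ) × (Fin k → ℝ) → Obs (O t) × Hidden k (O t) :=
    fun t q => splitSample (O t) (completeSample νε νx Ψ q) with hG
  have hGm : ∀ t, Measurable (G t) := fun t =>
    (measurePreserving_splitSample (νε := νε) (νx := νx)).measurable.comp
      (measurable_completeSample Ψ hνε hνx)
  have hq : ∀ t, AEMeasurable (fun ω => (Sε t ω, Sx t ω, Zε t ω, Zx t ω)) P :=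
    fun t => (hmodel.law t).aemeasurable
  have hGq : ∀ t, AEMeasurable (fun ω => G t (Sε t ω, Sx t ω, Zε t ω, Zx t ω)) P :=
    fun t => (hGm t).comp_aemeasurable (hq t)
  have hlaw : ∀ t, P.map (fun ω => G t (Sε t ω, Sx t ω, Zε t ω, Zx t ω)) =
      ((volume : Measure (Obs (O t))).prod (timeRef νε νx (O t))).withDensity
        fun p => ENNReal.ofReal (timeLik Ψ (O t) p.1 p.2) := fun t => by
    rw [← map_splitSample_completeSample Ψ hσ hνε hνx, primitiveLaw, ← (hmodel.law t).map_eq]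
    exact (AEMeasurable.map_map_of_aemeasurable (hGm t).aemeasurable (hq t)).symm
  -- Independence over time makes the joint law a product, and the densities multiply.
  have hpi : P.map (fun ω t => G t (Sε t ω, Sx t ω, Zε t ω, Zx t ω)) =
      (Measure.pi fun t => (volume : Measure (Obs (O t))).prod (timeRef νε νx (O t))).withDensity
        fun x => ∏ t, ENNReal.ofReal (timeLik Ψ (O t) (x t).1 (x t).2) := by
    rw [(iIndepFun_iff_map_fun_eq_pi_map hGq).1 (hmodel.indep.comp G hGm)]
    simp_rw [hlaw]
    exact pi_withDensity (fun t => (measurable_timeLik_prod Ψ (O t)).ennreal_ofReal)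
      fun _ _ => ENNReal.ofReal_ne_top
  set e : (∀ t, Obs (O t) × Hidden k (O t)) → (∀ t, Obs (O t)) × (∀ t, Hidden k (O t)) :=
    fun x => (fun t => (x t).1, fun t => (x t).2) with he
  have hem : Measurable e :=
    (measurable_pi_lambda _ fun t => measurable_fst.comp (measurable_pi_apply t)).prodMk
      (measurable_pi_lambda _ fun t => measurable_snd.comp (measurable_pi_apply t))
  have hmp : MeasurePreserving e
      (Measure.pi fun t => (volume : Measure (Obs (O t))).prod (timeRef νε νx (O t)))
      ((volume : Measure (∀ t, Obs (O t))).prod (hiddenRef νε νx O)) :=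
    ⟨hem, map_unzip_pi_prod _ _⟩
  have hg : Measurable fun p : (∀ t, Obs (O t)) × (∀ t, Hidden k (O t)) =>
      ∏ t, ENNReal.ofReal (timeLik Ψ (O t) (p.1 t) (p.2 t)) :=
    Finset.measurable_prod _ fun t _ => (measurable_timeLik_eval Ψ O t).ennreal_ofReal
  have h1 := map_withDensity_comp_of_measurePreserving hmp hg
  have h2 : P.map (fun ω => e fun t => G t (Sε t ω, Sx t ω, Zε t ω, Zx t ω)) =
      (P.map (fun ω t => G t (Sε t ω, Sx t ω, Zε t ω, Zx t ω))).map e :=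
    (AEMeasurable.map_map_of_aemeasurable hem.aemeasurable (aemeasurable_pi_lambda _ hGq)).symm
  refine Eq.trans h2 ?_
  rw [hpi]
  refine Eq.trans h1 (withDensity_congr_ae ?_)
  exact (Measure.quasiMeasurePreserving_snd.ae (ae_completeLik_eq_prod hσ hνε hνx)).mono
    fun p hp => hp p.1

variable {O} in
theorem aemeasurable_randObs_randHidden (hνε : ∀ i, 0 < νε i) (hνx : ∀ j, 0 < νx j)
    {Ω : Type*} [MeasurableSpace Ω] {P : Measure Ω}
    {Sε Sx : Fin N → Ω → ℝ} {Zε : Fin N → Ω → Fin d → ℝ} {Zx : Fin N → Ω → Fin k → ℝ}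
    (hmodel : IsModel P Sε Sx Zε Zx) :
    AEMeasurable (randObs νε νx Ψ O Sε Sx Zε Zx) P ∧
      AEMeasurable (randHidden νε νx Ψ O Sε Sx Zε Zx) P := by
  have h : ∀ t, AEMeasurable (fun ω => splitSample (O t)
      (completeSample νε νx Ψ (Sε t ω, Sx t ω, Zε t ω, Zx t ω))) P := fun t =>
    ((measurePreserving_splitSample (νε := νε) (νx := νx)).measurable.comp
      (measurable_completeSample Ψ hνε hνx)).comp_aemeasurable (hmodel.law t).aemeasurable
  exact ⟨aemeasurable_pi_lambda _ fun t => (h t).fst, aemeasurable_pi_lambda _ fun t => (h t).snd⟩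

/-- The first marginal of the joint law: by Tonelli, integrating `completeLik` over the hidden data
gives `obsDensity`. -/
theorem map_randObs (hσ : 0 < Ψ.σ2) (hνε : ∀ i, 0 < νε i) (hνx : ∀ j, 0 < νx j)
    {Ω : Type*} [MeasurableSpace Ω] {P : Measure Ω} [IsProbabilityMeasure P]
    {Sε Sx : Fin N → Ω → ℝ} {Zε : Fin N → Ω → Fin d → ℝ} {Zx : Fin N → Ω → Fin k → ℝ}
    (hmodel : IsModel P Sε Sx Zε Zx) :
    P.map (randObs νε νx Ψ O Sε Sx Zε Zx) =
      volume.withDensity (fun yo => ENNReal.ofReal (obsDensity νε νx Ψ O yo)) := by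
  obtain ⟨ho, hh⟩ := aemeasurable_randObs_randHidden (Ψ := Ψ) (O := O) hνε hνx hmodel
  have hfst : P.map (randObs νε νx Ψ O Sε Sx Zε Zx) =
      (P.map (fun ω => (randObs νε νx Ψ O Sε Sx Zε Zx ω,
        randHidden νε νx Ψ O Sε Sx Zε Zx ω))).map Prod.fst :=
    (AEMeasurable.map_map_of_aemeasurable measurable_fst.aemeasurable (ho.prodMk hh)).symm
  have hc := (measurable_completeLik Ψ O).ennreal_ofReal
  have hz := (measurable_obsDensity νε νx Ψ O).ennreal_ofReal
  rw [hfst, map_randObs_randHidden O hσ hνε hνx hmodel]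
  refine Measure.ext_of_lintegral _ fun f hf => ?_
  have hf1 : Measurable fun p : (∀ t, Obs (O t)) × (∀ t, Hidden k (O t)) => f p.1 :=
    hf.comp measurable_fst
  rw [lintegral_map hf measurable_fst,
    lintegral_withDensity_eq_lintegral_mul _ hc hf1,
    lintegral_withDensity_eq_lintegral_mul _ hz hf, lintegral_prod _ (hc.mul hf1).aemeasurable]
  refine lintegral_congr fun yo => ?_
  have hcy : Measurable fun h => ENNReal.ofReal (completeLik Ψ O yo h) :=
    (measurable_completeLik Ψ O).of_uncurry_left.ennreal_ofReal
  simp only [Pi.mul_apply]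
  rw [lintegral_mul_const _ hcy, lintegral_completeLik O hσ hνε hνx]

/-- Uniqueness of disintegrations: the joint density is `obsDensity` times the density of
`hiddenCondLaw`. -/
theorem condDistrib_randHidden_ae_eq (hσ : 0 < Ψ.σ2) (hνε : ∀ i, 0 < νε i)
    (hνx : ∀ j, 0 < νx j)
    {Ω : Type*} [MeasurableSpace Ω] {P : Measure Ω} [IsProbabilityMeasure P]
    {Sε Sx : Fin N → Ω → ℝ} {Zε : Fin N → Ω → Fin d → ℝ} {Zx : Fin N → Ω → Fin k → ℝ}
    (hmodel : IsModel P Sε Sx Zε Zx) :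
    ∀ᵐ yo ∂(P.map (randObs νε νx Ψ O Sε Sx Zε Zx)),
      condDistrib (randHidden νε νx Ψ O Sε Sx Zε Zx) (randObs νε νx Ψ O Sε Sx Zε Zx) P yo =
        hiddenCondLaw νε νx Ψ O yo := by
  obtain ⟨ho, hh⟩ := aemeasurable_randObs_randHidden (Ψ := Ψ) (O := O) hνε hνx hmodel
  have hc := (measurable_completeLik Ψ O).ennreal_ofReal
  have hz := (measurable_obsDensity νε νx Ψ O).ennreal_ofReal
  have hm : Measurable (Function.uncurry fun (yo : ∀ t, Obs (O t)) (h : ∀ t, Hidden k (O t)) =>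
      ENNReal.ofReal (completeLik Ψ O yo h / obsDensity νε νx Ψ O yo)) := by
    have h1 : Measurable fun p : (∀ t, Obs (O t)) × (∀ t, Hidden k (O t)) => p.1 := measurable_fst
    have h := (measurable_obsDensity νε νx Ψ O).comp h1
    rw [Function.comp_def] at h
    exact ((measurable_completeLik Ψ O).div h).ennreal_ofReal
  set κ : Kernel (∀ t, Obs (O t)) (∀ t, Hidden k (O t)) :=
    (Kernel.const _ (hiddenRef νε νx O)).withDensity fun yo h =>
      ENNReal.ofReal (completeLik Ψ O yo h / obsDensity νε νx Ψ O yo) with hκ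
  have hκa : ∀ yo, κ yo = hiddenCondLaw νε νx Ψ O yo := fun yo => by
    rw [hκ, Kernel.withDensity_apply _ hm, Kernel.const_apply]
    rfl
  -- `obsDensity` is positive at every `yo`, so normalisation holds everywhere and no exceptional
  -- set has to be treated.
  have : IsMarkovKernel κ := ⟨fun yo => by
    rw [hκa]
    exact isProbabilityMeasure_hiddenCondLaw O hσ hνε hνx yo⟩
  refine (condDistrib_ae_eq_of_measure_eq_compProd _ hh (κ := κ) ?_).mono
    fun yo h => h.trans (hκa yo)
  rw [map_randObs_randHidden O hσ hνε hνx hmodel, map_randObs O hσ hνε hνx hmodel]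
  have : IsProbabilityMeasure (volume.withDensity
      fun yo : ∀ t, Obs (O t) => ENNReal.ofReal (obsDensity νε νx Ψ O yo)) := by
    rw [← map_randObs O hσ hνε hνx hmodel]
    exact Measure.isProbabilityMeasure_map ho
  refine Measure.ext_of_lintegral _ fun f hf => ?_
  have hin : Measurable fun yo => ∫⁻ h, f (yo, h) ∂κ yo := hf.lintegral_kernel_prod_right'
  rw [lintegral_withDensity_eq_lintegral_mul _ hc hf, lintegral_prod _ (hc.mul hf).aemeasurable,
    Measure.lintegral_compProd hf, lintegral_withDensity_eq_lintegral_mul _ hz hin]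
  refine lintegral_congr fun yo => ?_
  have hZ := obsDensity_pos O hσ hνε hνx yo
  have hfy : Measurable fun h => f (yo, h) := hf.comp measurable_prodMk_left
  have hmy : Measurable fun h =>
      ENNReal.ofReal (completeLik Ψ O yo h / obsDensity νε νx Ψ O yo) :=
    (((measurable_completeLik Ψ O).of_uncurry_left (x := yo)).div_const _).ennreal_ofReal
  simp only [Pi.mul_apply]
  rw [hκa, hiddenCondLaw, lintegral_withDensity_eq_lintegral_mul _ hmy hfy,
    ← lintegral_const_mul' _ _ ENNReal.ofReal_ne_top]
  refine lintegral_congr fun h => ?_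
  simp only [Pi.mul_apply]
  rw [← mul_assoc, ← ENNReal.ofReal_mul hZ.le, mul_div_cancel₀ _ hZ.ne']

end Law

end GStPPCA

end

theorem theorem1 {d k N : ℕ} (hd : 0 < d) (hk : 0 < k)
    (νε : Fin d → ℝ) (νx : Fin k → ℝ) (hνε : ∀ i, 0 < νε i) (hνx : ∀ j, 0 < νx j)
    (Ψ Ψs : Params d k) (hΨ : 0 < Ψ.σ2) (hΨs : 0 < Ψs.σ2)
    (O : Fin N → Finset (Fin d))
    {Ω : Type*} [MeasurableSpace Ω] (P : Measure Ω) [IsProbabilityMeasure P]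
    (Sε Sx : Fin N → Ω → ℝ) (Zε : Fin N → Ω → Fin d → ℝ) (Zx : Fin N → Ω → Fin k → ℝ)
    (hmodel : IsModel P Sε Sx Zε Zx) :
    -- `π(y^o | Ψ)` is the Lebesgue density of the observed data
    P.map (randObs νε νx Ψ O Sε Sx Zε Zx) =
      volume.withDensity (fun yo => ENNReal.ofReal (obsDensity νε νx Ψ O yo)) ∧
    -- `hiddenCondLaw` is the conditional law of the hidden data given the observed data
    (∀ᵐ yo ∂(P.map (randObs νε νx Ψ O Sε Sx Zε Zx)),
      condDistrib (randHidden νε νx Ψ O Sε Sx Zε Zx) (randObs νε νx Ψ O Sε Sx Zε Zx) P yo =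
        hiddenCondLaw νε νx Ψ O yo) ∧
    -- the E-step, for every realisation of the observed data
    ∀ yo : (t : Fin N) → Obs (O t),
      0 < obsDensity νε νx Ψ O yo ∧
      IsProbabilityMeasure (hiddenCondLaw νε νx Ψ O yo) ∧
      (∀ t, IntegrableOn (fun s : ℝ × ℝ => fnM Ψ (O t) νε νx (yo t) s.1 s.2)
        (Set.Icc 0 1 ×ˢ Set.Icc 0 1)) ∧
      (Integrable (completeLogLik νε νx Ψs O yo) (hiddenCondLaw νε νx Ψ O yo) →
        (∀ t, IntegrableOn (fun s : ℝ × ℝ =>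
          fnVTilde Ψ Ψs (O t) νε νx (yo t) s.1 s.2 * fnM Ψ (O t) νε νx (yo t) s.1 s.2)
          (Set.Icc 0 1 ×ˢ Set.Icc 0 1)) ∧
        eStepQ νε νx Ψ Ψs O yo =
          1 / obsDensity νε νx Ψ O yo *
            ∑ t, I₁ Ψ Ψs (O t) νε νx (yo t) *
              ∏ s ∈ Finset.univ.erase t, I₂ Ψ (O s) νε νx (yo s)) := by
  refine ⟨map_randObs O hΨ hνε hνx hmodel, condDistrib_randHidden_ae_eq O hΨ hνε hνx hmodel,
    fun yo => ⟨obsDensity_pos O hΨ hνε hνx yo, isProbabilityMeasure_hiddenCondLaw O hΨ hνε hνx yo,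
      fun t => (integrableOn_fnM_and_I₂_eq (O t) hΨ hνε hνx (yo t)).1,
      eStepQ_closed_form O hd hk hΨ hΨs hνε hνx yo⟩⟩
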